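/- Let $A_0,A_1$ be quasi-normed spaces (real or complex) continuously embedded in a common Hausdorff topological vector space. For $f\in A_0+A_1$ and $t>0$ let $K(t,f)=K(t,f;A_0,A_1)=\inf\{\|f_0\|_{A_0}+t\|f_1\|_{A_1}: f=f_0+f_1,\ f_j\in A_j\}$, and write $\|\cdot\|_{q,(a,b)}$ for the $L^q$-quasi-norm on $(a,b)$. For non-negative quantities, $F\approx G$ means $c^{-1}G\le F\le cG$ with a constant $c>0$ independent of the variables. A Lebesgue measurable $b:(0,\infty)\to(0,\infty)$ is slowly varying if for every $\varepsilon>0$ the function $t^{\varepsilon}b(t)$ is equivalent ($\approx$) on $(0,\infty)$ to a positive non-decreasing function and $t^{-\varepsilon}b(t)$ to a positive non-increasing one. For $0<q\le\infty$ write $b\in SV_{0,q}$ if $b$ is slowly varying and $\|u^{-1/q}b(u)\|_{q,(1,\infty)}<\infty$ (with $1/\infty=0$), and let $\bar A_{0,q;b}$ be the space of all $f\in A_0+A_1$ for which $\|f\|_{\bar A_{0,q;b}}=\|u^{-1/q}b(u)K(u,f)\|_{q,(0,\infty)}$ is finite. Let $0<q_0,q_1\le\infty$, $q_0\ne q_1$,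 and $b_j\in SV_{0,q_j}$ $(j=0,1)$. For $t>0$ and $\epsilon>0$ put $$\rho(t)=\frac{\|u^{-1/q_0}b_0(u)\|_{q_0,(t,\infty)}}{\|u^{-1/q_1}b_1(u)\|_{q_1,(t,\infty)}},\qquad \rho_\epsilon(t)=\frac{\|u^{-1/q_0}b_0(u)\|_{q_0,(t,\infty)}^{1+\epsilon}}{\|u^{-1/q_1}b_1(u)\|_{q_1,(t,\infty)}},$$ $$I(t,f)=\|u^{-1/q_0}b_0(u)K(u,f)\|_{q_0,(0,t)},\qquad J(t,f)=\|u^{-1/q_1}b_1(u)K(u,f)\|_{q_1,(t,\infty)}.$$ Consider the condition (C) for some $\epsilon>0$, $\rho_\epsilon$ is equivalent on $(0,\infty)$ to a non-decreasing function, and the formula (H) $K(\rho(t),f;\bar A_{0,q_0;b_0},\bar A_{0,q_1;b_1})\approx I(t,f)+\rho(t)J(t,f)$ for all $f\in A_0+A_1$ and all $t>0$, with constants independent of $f$ and $t$, where $K(s,f;\bar A_{0,q_0;b_0},\bar A_{0,q_1;b_1})$ is the $K$-functional of the couple of the two interpolation spaces, equal to $\infty$ if $f\notin \bar A_{0,q_0;b_0}+\bar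 A_{0,q_1;b_1}$. Then (C) implies (H). Conversely, if the couple $(A_0,A_1)$ is $K$-surjective, that is, if for every $\phi:(0,\infty)\to(0,\infty)$ such that $\phi(t)$ and $t\phi(1/t)$ are non-decreasing there is $f\in A_0+A_1$ with $\phi(t)\approx K(t,f)$ for $t>0$ (with constants that may depend on $\phi$), then (H) implies (C). -/

import Mathlib

open MeasureTheory Set Topology
open scoped NNReal ENNReal

noncomputable section

namespace Holmstedt

/-- Two-sided equivalence `F ≈ G` on `S`, with a constant independent of the points of `S`. -/
def Equivalent {ι α : Type*} [LE α] [SMul ℝ≥0 α] (S : Set ι) (F G : ι → α) : Prop :=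
  ∃ c : ℝ≥0, 0 < c ∧ ∀ i ∈ S, F i ≤ c • G i ∧ G i ≤ c • F i

/-- Slowly varying functions on `(0, ∞)`; only the values of `b` on `(0, ∞)` matter. -/
structure SlowlyVarying (b : ℝ → ℝ) : Prop where
  pos : ∀ t, 0 < t → 0 < b t
  measurable : AEMeasurable b (volume.restrict (Ioi 0))
  exists_monotone : ∀ ε : ℝ, 0 < ε → ∃ g : ℝ → ℝ, (∀ t, 0 < t → 0 < g t) ∧
    MonotoneOn g (Ioi 0) ∧ Equivalent (Ioi 0) (fun t => t ^ ε * b t) g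
  exists_antitone : ∀ ε : ℝ, 0 < ε → ∃ g : ℝ → ℝ, (∀ t, 0 < t → 0 < g t) ∧
    AntitoneOn g (Ioi 0) ∧ Equivalent (Ioi 0) (fun t => t ^ (-ε) * b t) g

/-- The weight `u ^ (-θ - 1/q) * b u`, with `1/∞ = 0`. -/
def weight (θ : ℝ) (q : ℝ≥0∞) (b : ℝ → ℝ) (u : ℝ) : ℝ≥0∞ :=
  ENNReal.ofReal (u ^ (-θ - q⁻¹.toReal) * b u)

/-- The quasi-norm `‖u ^ (-1/q) b(u)‖` in `L^q` of the interval `(t, ∞)`. -/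
def tailNorm (q : ℝ≥0∞) (b : ℝ → ℝ) (t : ℝ) : ℝ≥0∞ :=
  eLpNorm (weight 0 q b) q (volume.restrict (Ioi t))

/-- The class `SV_{0,q}`. -/
def SVZero (q : ℝ≥0∞) (b : ℝ → ℝ) : Prop :=
  SlowlyVarying b ∧ tailNorm q b 1 < ∞

/-- The function `ρ`. -/
def rho (q₀ q₁ : ℝ≥0∞) (b₀ b₁ : ℝ → ℝ) (t : ℝ) : ℝ≥0∞ :=
  tailNorm q₀ b₀ t / tailNorm q₁ b₁ t

/-- The function `ρ_ε`. -/
def rhoEps (ε : ℝ) (q₀ q₁ : ℝ≥0∞) (b₀ b₁ : ℝ → ℝ) (t : ℝ) : ℝ≥0∞ :=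
  tailNorm q₀ b₀ t ^ (1 + ε) / tailNorm q₁ b₁ t

/-- For some `ε > 0`, the function `ρ_ε` is equivalent to a non-decreasing function
on `(0, ∞)`. -/
def RhoCondition (q₀ q₁ : ℝ≥0∞) (b₀ b₁ : ℝ → ℝ) : Prop :=
  ∃ ε : ℝ, 0 < ε ∧ ∃ g : ℝ → ℝ≥0, MonotoneOn g (Ioi 0) ∧
    Equivalent (Ioi 0) (rhoEps ε q₀ q₁ b₀ b₁) (fun t => (g t : ℝ≥0∞))

/-- A quasi-normed space continuously embedded in the topological vector space `V`, given by its
image in `V` and its quasi-norm (only the values of `qnorm` on that image matter). -/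
structure QuasiNormedSubspace (𝕜 V : Type*) [RCLike 𝕜] [AddCommGroup V] [Module 𝕜 V]
    [TopologicalSpace V] where
  toSubmodule : Submodule 𝕜 V
  qnorm : V → ℝ
  nonneg : ∀ x ∈ toSubmodule, 0 ≤ qnorm x
  eq_zero : ∀ x ∈ toSubmodule, qnorm x = 0 → x = 0
  smul : ∀ (c : 𝕜), ∀ x ∈ toSubmodule, qnorm (c • x) = ‖c‖ * qnorm x
  add_le : ∃ C : ℝ, ∀ x ∈ toSubmodule, ∀ y ∈ toSubmodule,
    qnorm (x + y) ≤ C * (qnorm x + qnorm y)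
  continuous_embedding : ∀ U ∈ 𝓝 (0 : V), ∃ δ : ℝ, 0 < δ ∧
    ∀ x ∈ toSubmodule, qnorm x < δ → x ∈ U

/-- The `K`-functional of two sets `S₀`, `S₁` carrying the functionals `N₀`, `N₁`; the infimum
over the empty set of decompositions is `∞`. -/
def kFunctional {V : Type*} [Add V] (S₀ S₁ : Set V) (N₀ N₁ : V → ℝ≥0∞) (t : ℝ≥0∞) (f : V) :
    ℝ≥0∞ :=
  ⨅ (f₀ ∈ S₀) (f₁ ∈ S₁) (_ : f = f₀ + f₁), N₀ f₀ + t * N₁ f₁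

section Couple

variable {𝕜 V : Type*} [RCLike 𝕜] [AddCommGroup V] [Module 𝕜 V] [TopologicalSpace V]

/-- `K(t, f; A₀, A₁)` for a couple of quasi-normed spaces embedded in `V`. -/
def K (A₀ A₁ : QuasiNormedSubspace 𝕜 V) (t : ℝ) (f : V) : ℝ≥0∞ :=
  kFunctional (A₀.toSubmodule : Set V) (A₁.toSubmodule : Set V)
    (fun x => ENNReal.ofReal (A₀.qnorm x)) (fun x => ENNReal.ofReal (A₁.qnorm x))
    (ENNReal.ofReal t) f

/-- `‖u ^ (-θ - 1/q) b(u) K(u, f; A₀, A₁)‖` in `L^q` of the set `E`. -/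
def kNorm (A₀ A₁ : QuasiNormedSubspace 𝕜 V) (θ : ℝ) (q : ℝ≥0∞) (b : ℝ → ℝ) (E : Set ℝ)
    (f : V) : ℝ≥0∞ :=
  eLpNorm (fun u => weight θ q b u * K A₀ A₁ u f) q (volume.restrict E)

/-- The quasi-norm of the `K`-interpolation space `(A₀, A₁)_{θ,q;b}`. -/
def interpNorm (A₀ A₁ : QuasiNormedSubspace 𝕜 V) (θ : ℝ) (q : ℝ≥0∞) (b : ℝ → ℝ) (f : V) :
    ℝ≥0∞ :=
  kNorm A₀ A₁ θ q b (Ioi 0) f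

/-- The `K`-interpolation space `(A₀, A₁)_{θ,q;b}` as a subset of `A₀ + A₁`. -/
def interpSpace (A₀ A₁ : QuasiNormedSubspace 𝕜 V) (θ : ℝ) (q : ℝ≥0∞) (b : ℝ → ℝ) : Set V :=
  {f | f ∈ A₀.toSubmodule ⊔ A₁.toSubmodule ∧ interpNorm A₀ A₁ θ q b f < ∞}

/-- `K(s, f; (A₀, A₁)_{0,q₀;b₀}, (A₀, A₁)_{0,q₁;b₁})`. -/
def interpK (A₀ A₁ : QuasiNormedSubspace 𝕜 V) (q₀ q₁ : ℝ≥0∞) (b₀ b₁ : ℝ → ℝ) (s : ℝ≥0∞)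
    (f : V) : ℝ≥0∞ :=
  kFunctional (interpSpace A₀ A₁ 0 q₀ b₀) (interpSpace A₀ A₁ 0 q₁ b₁)
    (interpNorm A₀ A₁ 0 q₀ b₀) (interpNorm A₀ A₁ 0 q₁ b₁) s f

/-- The Holmstedt-type formula `K(ρ(t), f; …) ≈ I(t, f) + ρ(t) J(t, f)`, for all `f ∈ A₀ + A₁`
and `t > 0`, with constants independent of `f` and `t`. -/
def HolmstedtFormula (A₀ A₁ : QuasiNormedSubspace 𝕜 V) (q₀ q₁ : ℝ≥0∞) (b₀ b₁ : ℝ → ℝ) : Prop :=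
  Equivalent {p : V × ℝ | p.1 ∈ A₀.toSubmodule ⊔ A₁.toSubmodule ∧ 0 < p.2}
    (fun p => interpK A₀ A₁ q₀ q₁ b₀ b₁ (rho q₀ q₁ b₀ b₁ p.2) p.1)
    (fun p => kNorm A₀ A₁ 0 q₀ b₀ (Ioo 0 p.2) p.1 +
      rho q₀ q₁ b₀ b₁ p.2 * kNorm A₀ A₁ 0 q₁ b₁ (Ioi p.2) p.1)

/-- Quasi-concave functions `(0, ∞) → (0, ∞)`. -/
structure QuasiConcave (φ : ℝ → ℝ) : Prop where
  pos : ∀ t, 0 < t → 0 < φ t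
  monotone : MonotoneOn φ (Ioi 0)
  monotone_transpose : MonotoneOn (fun t => t * φ (1 / t)) (Ioi 0)

/-- `K`-surjective couples; the constants of the equivalence may depend on `φ`. -/
def KSurjective (A₀ A₁ : QuasiNormedSubspace 𝕜 V) : Prop :=
  ∀ φ : ℝ → ℝ, QuasiConcave φ → ∃ f ∈ A₀.toSubmodule ⊔ A₁.toSubmodule,
    Equivalent (Ioi 0) (fun t => ENNReal.ofReal (φ t)) (fun t => K A₀ A₁ t f)

end Couple

end Holmstedt

end

/-! Write T_j(t) for `tailNorm q_j b_j t`, so that ρ = T₀/T₁. Each tail T is non-increasing while t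
T(t) is almost increasing. For q < ∞ the substitution s = T(u)^q carries the measure (u^(-1/q)
b(u))^q du to ds, so weighted norms of powers of T become elementary integrals
(`lintegral_comp_tailInt`); for q = ∞ the pointwise bound b ≲ T does the same work.

(C) implies (H). The upper estimate needs no condition: a near-optimal decomposition for K(t, f)
serves as decomposition in the interpolation couple (`exists_interpK_le`). For the lower estimate
take any f = f₀ + f₁ in that couple. Only I(t, f₁) and J(t, f₀) need work. Monotonicity of K gives
K(u, f_j) T_j(u) ≤ ‖f_j‖. Condition (C) dominates 1/T₁(u) by a multiple of T₀(u)^(-(1+ε)) for u < t,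
and 1/T₀(u) by a multiple of T₁(u)^(-1/(1+ε)) for u > t. The norms of these powers over (0, t) and
(t, ∞) are finite and of the right size (`exists_wNorm_Ioo_le_rho`, `exists_rho_mul_wNorm_Ioi_le`).

(H) implies (C). By K-surjectivity, (H) yields weighted inequalities for quasi-concave functions,
with constants depending on the function; a gliding hump makes them uniform
(`exists_uniform_bound`). Testing on min(1, u/t) shows that ρ is almost increasing. Let p < q be the
two exponents. Where ρ is nearly constant the two tails are proportional, and testing on a
quasi-concave majorant of 1/T gives x^(1/p) ≲ 1 + x^(1/q), with x the logarithm of the drop of the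
tail of exponent p; hence x is bounded (`exists_log_tailNorm_le`). So ρ doubles whenever that tail S
drops by a fixed factor, and iteration makes ρ S^δ almost increasing for some δ in (0, 1), which is
(C). -/

noncomputable section

namespace Holmstedt

/-! ### Weighted quasi-norms on sets. -/

/-- The quasi-norm `‖u ^ (-1/q) b(u) φ(u)‖` in `L^q` of the set `E`. -/
def wNorm (q : ℝ≥0∞) (b : ℝ → ℝ) (E : Set ℝ) (φ : ℝ → ℝ≥0∞) : ℝ≥0∞ :=
  eLpNorm (fun u => weight 0 q b u * φ u) q (volume.restrict E)

theorem eLpNorm_le_const_mul {α : Type*} {m : MeasurableSpace α} {μ : Measure α}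
    {f g : α → ℝ≥0∞} {C : ℝ≥0∞} (hC : C ≠ ∞) (q : ℝ≥0∞) (h : ∀ᵐ x ∂μ, f x ≤ C * g x) :
    eLpNorm f q μ ≤ C * eLpNorm g q μ := by
  lift C to ℝ≥0 using hC
  have := eLpNorm_le_nnreal_smul_eLpNorm_of_ae_le_mul' (μ := μ) (f := f) (g := g) (c := C)
    (by simpa using h) q
  simpa [ENNReal.smul_def] using this

section wNorm

variable {q : ℝ≥0∞} {b : ℝ → ℝ} {E F : Set ℝ} {φ ψ : ℝ → ℝ≥0∞}

theorem wNorm_le_mul {C : ℝ≥0∞} (hC : C ≠ ∞) (hE : MeasurableSet E)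
    (h : ∀ u ∈ E, φ u ≤ C * ψ u) : wNorm q b E φ ≤ C * wNorm q b E ψ := by
  refine eLpNorm_le_const_mul hC q ?_
  filter_upwards [ae_restrict_mem hE] with u hu
  calc weight 0 q b u * φ u ≤ weight 0 q b u * (C * ψ u) := by gcongr; exact h u hu
    _ = C * (weight 0 q b u * ψ u) := by ring

theorem wNorm_mono (hE : MeasurableSet E) (h : ∀ u ∈ E, φ u ≤ ψ u) :
    wNorm q b E φ ≤ wNorm q b E ψ := by
  simpa using wNorm_le_mul (q := q) (b := b) ENNReal.one_ne_top hE
    (fun u hu => by simpa using h u hu)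

theorem wNorm_const_mul_le {C : ℝ≥0∞} (hC : C ≠ ∞) (φ : ℝ → ℝ≥0∞) :
    wNorm q b E (fun u => C * φ u) ≤ C * wNorm q b E φ :=
  eLpNorm_le_const_mul hC q (Filter.Eventually.of_forall fun u => (by ring_nf; exact le_rfl))

theorem wNorm_mono_set (h : E ⊆ F) (φ : ℝ → ℝ≥0∞) : wNorm q b E φ ≤ wNorm q b F φ :=
  eLpNorm_mono_measure _ (Measure.restrict_mono h le_rfl)

theorem wNorm_one (t : ℝ) : wNorm q b (Ioi t) (fun _ => 1) = tailNorm q b t := by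
  simp [wNorm, tailNorm]

theorem wNorm_Ioo_eq_Ioc (s t : ℝ) : wNorm q b (Ioo s t) φ = wNorm q b (Ioc s t) φ := by
  rw [wNorm, wNorm, Measure.restrict_congr_set Ioo_ae_eq_Ioc]

/-- The quasi-triangle inequality for `x ↦ x ^ r`. -/
theorem exists_add_rpow_le {r : ℝ} (hr : 0 ≤ r) :
    ∃ C : ℝ≥0, ∀ x y : ℝ≥0∞, (x + y) ^ r ≤ C * (x ^ r + y ^ r) := by
  rcases le_total r 1 with h | h
  · exact ⟨1, fun x y => by simpa using ENNReal.rpow_add_le_add_rpow x y hr h⟩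
  · refine ⟨2 ^ (r - 1), fun x y => ?_⟩
    have := ENNReal.rpow_add_le_mul_rpow_add_rpow x y h
    rwa [ENNReal.coe_rpow_of_nonneg _ (by linarith), ENNReal.coe_ofNat]

/-- For finite `q` the integral is subadditive in the set and the outer power `1/q` costs a
constant. No measurability of `φ` is involved. -/
theorem exists_wNorm_union_le (q : ℝ≥0∞) (b : ℝ → ℝ) : ∃ C : ℝ≥0, ∀ (E F : Set ℝ)
    (φ : ℝ → ℝ≥0∞), MeasurableSet E → MeasurableSet F →
      wNorm q b (E ∪ F) φ ≤ C * (wNorm q b E φ + wNorm q b F φ) := by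
  rcases eq_or_ne q 0 with rfl | h0
  · exact ⟨1, fun E F φ _ _ => by simp [wNorm]⟩
  rcases eq_or_ne q ∞ with rfl | ht
  · refine ⟨1, fun E F φ hE hF => ?_⟩
    simp only [wNorm, eLpNorm_exponent_top, ENNReal.coe_one, one_mul]
    refine eLpNormEssSup_le_of_ae_enorm_bound ?_
    rw [ae_restrict_union_iff]
    constructor
    · filter_upwards [ae_le_eLpNormEssSup (f := fun u => weight 0 ∞ b u * φ u)
        (μ := volume.restrict E)] with x hx using hx.trans le_self_add
    · filter_upwards [ae_le_eLpNormEssSup (f := fun u => weight 0 ∞ b u * φ u)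
        (μ := volume.restrict F)] with x hx using hx.trans le_add_self
  · obtain ⟨C, hC⟩ := exists_add_rpow_le (r := 1 / q.toReal) (by positivity)
    refine ⟨C, fun E F φ _ _ => ?_⟩
    simp only [wNorm, eLpNorm_eq_lintegral_rpow_enorm_toReal h0 ht]
    refine le_trans ?_ (hC _ _)
    gcongr
    exact lintegral_union_le _ _ _

end wNorm

/-! ### Slowly varying weights and their tails. -/

theorem SlowlyVarying.exists_rpow_mul_le {b : ℝ → ℝ} (hb : SlowlyVarying b) {ε : ℝ}
    (hε : 0 < ε) :
    ∃ C : ℝ, 0 < C ∧ ∀ s u, 0 < s → s ≤ u → s ^ ε * b s ≤ C * (u ^ ε * b u) := by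
  obtain ⟨g, -, hm, c, hc, h⟩ := hb.exists_monotone ε hε
  refine ⟨c * c, by positivity, fun s u hs hsu => ?_⟩
  have hu : 0 < u := hs.trans_le hsu
  have h1 := (h s hs).1
  have h2 := (h u hu).2
  have h3 := hm (mem_Ioi.2 hs) (mem_Ioi.2 hu) hsu
  simp only [NNReal.smul_def, smul_eq_mul] at h1 h2
  calc s ^ ε * b s ≤ c * g s := h1
    _ ≤ c * (c * (u ^ ε * b u)) := by gcongr; exact h3.trans h2
    _ = _ := by ring

theorem weight_zero_eq (q : ℝ≥0∞) (b : ℝ → ℝ) (u : ℝ) :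
    weight 0 q b u = ENNReal.ofReal (u ^ (-q⁻¹.toReal) * b u) := by
  simp [weight]

theorem SlowlyVarying.aemeasurable_weight {b : ℝ → ℝ} (hb : SlowlyVarying b) (q : ℝ≥0∞) :
    AEMeasurable (weight 0 q b) (volume.restrict (Ioi 0)) := by
  unfold weight
  refine AEMeasurable.ennreal_ofReal (AEMeasurable.mul ?_ hb.measurable)
  exact (measurable_id.pow_const _).aemeasurable

theorem weight_pos {q : ℝ≥0∞} {b : ℝ → ℝ} (hb : SlowlyVarying b) {u : ℝ} (hu : 0 < u) :
    0 < weight 0 q b u := by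
  have := hb.pos u hu
  rw [weight_zero_eq, ENNReal.ofReal_pos]; positivity

/-- `‖u ^ (1/2 - 1/q)‖` in `L^q(0, s)` is at most a constant times `s ^ (1/2)`. -/
theorem exists_eLpNorm_rpow_le (q : ℝ≥0∞) (hq : q ≠ 0) : ∃ C : ℝ≥0, ∀ s : ℝ, 0 < s →
    eLpNorm (fun u : ℝ => ENNReal.ofReal (u ^ (1 / 2 - q⁻¹.toReal))) q
      (volume.restrict (Ioc 0 s)) ≤ C * ENNReal.ofReal (s ^ (1 / 2 : ℝ)) := by
  rcases eq_or_ne q ∞ with rfl | ht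
  · refine ⟨1, fun s hs => ?_⟩
    rw [eLpNorm_exponent_top]
    refine eLpNormEssSup_le_of_ae_enorm_bound ?_
    filter_upwards [ae_restrict_mem measurableSet_Ioc] with u hu
    simp only [enorm_eq_self, ENNReal.inv_top, ENNReal.toReal_zero, sub_zero, ENNReal.coe_one,
      one_mul]
    exact ENNReal.ofReal_le_ofReal (Real.rpow_le_rpow hu.1.le hu.2 (by norm_num))
  · have hr : 0 < q.toReal := ENNReal.toReal_pos hq ht
    set r := q.toReal with hrdef
    refine ⟨(Real.toNNReal (2 / r)) ^ (1 / r), fun s hs => ?_⟩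
    rw [eLpNorm_eq_lintegral_rpow_enorm_toReal hq ht, ← hrdef]
    -- The `r`-th power of the integrand is `u ^ (r/2 - 1)`, whose integral over `(0, s]` is `(2/r)
    -- * s ^ (r/2)`.
    have h1 : ∫⁻ u in Ioc 0 s, ‖ENNReal.ofReal (u ^ (1 / 2 - q⁻¹.toReal))‖ₑ ^ r
        = ∫⁻ u in Ioc 0 s, ENNReal.ofReal (u ^ (r / 2 - 1)) := by
      refine setLIntegral_congr_fun measurableSet_Ioc fun u hu => ?_
      simp only [enorm_eq_self]
      rw [ENNReal.ofReal_rpow_of_nonneg (Real.rpow_nonneg hu.1.le _) hr.le,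
        ← Real.rpow_mul hu.1.le, ENNReal.toReal_inv, ← hrdef]
      congr 2
      field_simp
    have h2 : IntegrableOn (fun u : ℝ => u ^ (r / 2 - 1)) (Ioc 0 s) := by
      rw [← intervalIntegrable_iff_integrableOn_Ioc_of_le hs.le]
      exact intervalIntegral.intervalIntegrable_rpow' (by linarith)
    rw [h1, ← ofReal_integral_eq_lintegral_ofReal h2 (by
      filter_upwards [ae_restrict_mem measurableSet_Ioc] with u hu
      exact Real.rpow_nonneg hu.1.le _),
      ← intervalIntegral.integral_of_le hs.le, integral_rpow (Or.inl (by linarith))]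
    rw [Real.zero_rpow (by linarith), sub_add_cancel, sub_zero]
    have h3 : s ^ (r / 2) / (r / 2) = (2 / r) * s ^ (r / 2) := by field_simp
    rw [h3, ENNReal.ofReal_mul (by positivity), ENNReal.mul_rpow_of_nonneg _ _ (by positivity),
      ENNReal.coe_rpow_of_nonneg _ (by positivity),
      ENNReal.ofReal_rpow_of_pos (x := s ^ _) (by positivity), ← Real.rpow_mul hs.le]
    refine le_of_eq ?_
    congr 3
    field_simp

section tail

variable {q : ℝ≥0∞} {b : ℝ → ℝ}

/-- Since `u ^ (1/2) * b u` is almost increasing, it can be replaced by its value at `s`; the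
remaining factor `u ^ (1/2 - 1/q)` has an explicit norm. Any exponent in `(0, 1)` would do in place
of `1/2`. -/
theorem exists_wNorm_id_le (hq : q ≠ 0) (hb : SlowlyVarying b) : ∃ C : ℝ≥0, ∀ s : ℝ, 0 < s →
    wNorm q b (Ioc 0 s) (fun u => ENNReal.ofReal u) ≤ C * ENNReal.ofReal (s * b s) := by
  obtain ⟨A, hA, h⟩ := hb.exists_rpow_mul_le (ε := 1 / 2) (by norm_num)
  obtain ⟨C, hC⟩ := exists_eLpNorm_rpow_le q hq
  refine ⟨Real.toNNReal A * C, fun s hs => ?_⟩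
  have hbs := hb.pos s hs
  calc wNorm q b (Ioc 0 s) (fun u => ENNReal.ofReal u)
      ≤ ENNReal.ofReal (A * (s ^ (1 / 2 : ℝ) * b s)) *
        eLpNorm (fun u : ℝ => ENNReal.ofReal (u ^ (1 / 2 - q⁻¹.toReal))) q
          (volume.restrict (Ioc 0 s)) := by
        refine eLpNorm_le_const_mul ENNReal.ofReal_ne_top q ?_
        filter_upwards [ae_restrict_mem measurableSet_Ioc] with u hu
        have hbu := hb.pos u hu.1
        have hu0 := hu.1
        rw [weight_zero_eq, ← ENNReal.ofReal_mul (by positivity),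
          ← ENNReal.ofReal_mul (by positivity)]
        refine ENNReal.ofReal_le_ofReal ?_
        have e : u ^ (-q⁻¹.toReal) * b u * u
            = (u ^ (1 / 2 : ℝ) * b u) * u ^ (1 / 2 - q⁻¹.toReal) := by
          have e1 : u ^ (1 / 2 - q⁻¹.toReal) = u ^ (1 / 2 : ℝ) * u ^ (-q⁻¹.toReal) := by
            rw [← Real.rpow_add hu0]; ring_nf
          have e2 : u = u ^ (1 / 2 : ℝ) * u ^ (1 / 2 : ℝ) := by
            rw [← Real.rpow_add hu0]; norm_num
          linear_combination (u ^ (-q⁻¹.toReal) * b u) * e2 - u ^ (1 / 2 : ℝ) * b u * e1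
        rw [e]
        exact mul_le_mul_of_nonneg_right (h u s hu.1 hu.2) (by positivity)
    _ ≤ ENNReal.ofReal (A * (s ^ (1 / 2 : ℝ) * b s)) * (C * ENNReal.ofReal (s ^ (1 / 2 : ℝ))) := by
        gcongr; exact hC s hs
    _ = _ := by
        have e2 : s * b s = s ^ (1 / 2 : ℝ) * b s * s ^ (1 / 2 : ℝ) := by
          have : s = s ^ (1 / 2 : ℝ) * s ^ (1 / 2 : ℝ) := by
            rw [← Real.rpow_add hs]; norm_num
          nth_rewrite 1 [this]; ring
        rw [ENNReal.ofReal_mul hA.le, e2,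
          ENNReal.ofReal_mul (p := s ^ (1 / 2 : ℝ) * b s) (by positivity)]
        push_cast
        rw [← ENNReal.ofReal]
        ring

/-- On `(u, 2u)` the weight is at least a constant `κ`, because `v * b v` is almost increasing; an
interval of length `u` then contributes `κ * u ^ (1/q)`, which is a multiple of `b u`. -/
theorem exists_le_tailNorm (hq : q ≠ 0) (hb : SlowlyVarying b) : ∃ C : ℝ≥0, ∀ u : ℝ, 0 < u →
    ENNReal.ofReal (b u) ≤ C * tailNorm q b u := by
  obtain ⟨A, hA, h⟩ := hb.exists_rpow_mul_le (ε := 1) (by norm_num)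
  set r := q⁻¹.toReal with hr
  have hr0 : 0 ≤ r := ENNReal.toReal_nonneg
  refine ⟨Real.toNNReal (2 ^ r * (2 * A)), fun u hu => ?_⟩
  have hbu := hb.pos u hu
  set κ := (2 * u) ^ (-r) * (b u / (2 * A)) with hκ
  have hκ0 : 0 < κ := by positivity
  have hμ : volume.restrict (Ioo u (2 * u)) ≠ 0 := by
    rw [Ne, Measure.restrict_eq_zero, Real.volume_Ioo]
    simp only [ENNReal.ofReal_eq_zero, not_le]; linarith
  have h1 : ENNReal.ofReal (κ * u ^ r) ≤ tailNorm q b u := by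
    calc ENNReal.ofReal (κ * u ^ r)
        = eLpNorm (fun _ : ℝ => ENNReal.ofReal κ) q (volume.restrict (Ioo u (2 * u))) := by
          rw [eLpNorm_const _ hq hμ, Measure.restrict_apply_univ, Real.volume_Ioo, enorm_eq_self,
            ENNReal.ofReal_mul hκ0.le, ENNReal.ofReal_rpow_of_pos (by linarith), hr,
            ENNReal.toReal_inv]
          congr 3
          · ring
          · simp
      _ ≤ eLpNorm (weight 0 q b) q (volume.restrict (Ioo u (2 * u))) := by
          refine eLpNorm_mono_enorm_ae ?_
          filter_upwards [ae_restrict_mem measurableSet_Ioo] with v hv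
          simp only [enorm_eq_self]
          rw [weight_zero_eq, ← hr]
          have hv0 : 0 < v := hu.trans hv.1
          refine ENNReal.ofReal_le_ofReal ?_
          refine mul_le_mul ?_ ?_ (by positivity) (by positivity)
          · exact Real.rpow_le_rpow_of_nonpos hv0 hv.2.le (by linarith)
          · have h2 := h u v hu hv.1.le
            simp only [Real.rpow_one] at h2
            have hbv := hb.pos v hv0
            have h3 : v * b v ≤ 2 * u * b v := by gcongr; exact hv.2.le
            have h4 : u * b u ≤ u * (2 * A * b v) := by nlinarith
            rw [div_le_iff₀ (by positivity)]
            linarith [le_of_mul_le_mul_left h4 hu]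
      _ ≤ tailNorm q b u := eLpNorm_mono_measure _ (Measure.restrict_mono Ioo_subset_Ioi_self le_rfl)
  have h5 : b u = (2 ^ r * (2 * A)) * (κ * u ^ r) := by
    rw [hκ, Real.mul_rpow (by norm_num) hu.le, Real.rpow_neg (by norm_num), Real.rpow_neg hu.le]
    field_simp
  rw [h5, ENNReal.ofReal_mul (by positivity)]
  exact mul_le_mul_right h1 _

theorem tailNorm_antitone : Antitone (tailNorm q b) := fun _ _ h =>
  eLpNorm_mono_measure _ (Measure.restrict_mono (Ioi_subset_Ioi h) le_rfl)

theorem tailNorm_pos (hq : q ≠ 0) (hb : SlowlyVarying b) {t : ℝ} (ht : 0 < t) :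
    0 < tailNorm q b t := by
  obtain ⟨C, hC⟩ := exists_le_tailNorm hq hb
  have h := hC t ht
  by_contra h0
  rw [not_lt, nonpos_iff_eq_zero] at h0
  have := hb.pos t ht
  simp [h0, this.not_ge] at h

theorem exists_wNorm_id_le_tailNorm (hq : q ≠ 0) (hb : SlowlyVarying b) : ∃ C : ℝ≥0,
    ∀ s : ℝ, 0 < s → wNorm q b (Ioc 0 s) (fun u => ENNReal.ofReal u) ≤
      C * (ENNReal.ofReal s * tailNorm q b s) := by
  obtain ⟨C, hC⟩ := exists_wNorm_id_le hq hb
  obtain ⟨D, hD⟩ := exists_le_tailNorm hq hb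
  refine ⟨C * D, fun s hs => (hC s hs).trans ?_⟩
  rw [ENNReal.ofReal_mul hs.le]
  calc (C : ℝ≥0∞) * (ENNReal.ofReal s * ENNReal.ofReal (b s))
      ≤ C * (ENNReal.ofReal s * (D * tailNorm q b s)) := by gcongr; exact hD s hs
    _ = _ := by push_cast; ring

/-- `s ↦ s * tailNorm q b s` is almost increasing. -/
theorem exists_mul_tailNorm_le (hq : q ≠ 0) (hb : SlowlyVarying b) : ∃ C : ℝ≥0,
    ∀ s u : ℝ, 0 < s → s ≤ u →
      ENNReal.ofReal s * tailNorm q b s ≤ C * (ENNReal.ofReal u * tailNorm q b u) := by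
  obtain ⟨C, hC⟩ := exists_wNorm_id_le_tailNorm hq hb
  obtain ⟨D, hD⟩ := exists_wNorm_union_le q b
  refine ⟨D * (C + 1), fun s u hs hsu => ?_⟩
  have hs0 : ENNReal.ofReal s ≠ 0 := by simpa using hs
  have hu : 0 < u := hs.trans_le hsu
  -- On `(s, u]` the constant 1 is at most `v / s`, so this piece is controlled by the norm of the
  -- identity on `(0, u]`.
  have h1 : ENNReal.ofReal s * wNorm q b (Ioc s u) (fun _ => 1) ≤
      C * (ENNReal.ofReal u * tailNorm q b u) := by
    calc ENNReal.ofReal s * wNorm q b (Ioc s u) (fun _ => 1)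
        ≤ ENNReal.ofReal s * ((ENNReal.ofReal s)⁻¹ *
          wNorm q b (Ioc s u) (fun v => ENNReal.ofReal v)) := by
          gcongr
          refine wNorm_le_mul (by simpa using hs) measurableSet_Ioc fun v hv => ?_
          rw [← ENNReal.inv_mul_cancel hs0 ENNReal.ofReal_ne_top]
          gcongr
          exact hv.1.le
      _ = wNorm q b (Ioc s u) (fun v => ENNReal.ofReal v) := by
          rw [← mul_assoc, ENNReal.mul_inv_cancel hs0 ENNReal.ofReal_ne_top, one_mul]
      _ ≤ _ := (wNorm_mono_set (Ioc_subset_Ioc_left hs.le) _).trans (hC u hu)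
  have h2 : tailNorm q b s ≤ D * (wNorm q b (Ioc s u) (fun _ => 1) + tailNorm q b u) := by
    rw [← wNorm_one, ← wNorm_one, ← Ioc_union_Ioi_eq_Ioi hsu]
    exact hD _ _ _ measurableSet_Ioc measurableSet_Ioi
  calc ENNReal.ofReal s * tailNorm q b s
      ≤ ENNReal.ofReal s * (D * (wNorm q b (Ioc s u) (fun _ => 1) + tailNorm q b u)) := by gcongr
    _ = D * (ENNReal.ofReal s * wNorm q b (Ioc s u) (fun _ => 1) +
          ENNReal.ofReal s * tailNorm q b u) := by ring
    _ ≤ D * (C * (ENNReal.ofReal u * tailNorm q b u) + ENNReal.ofReal u * tailNorm q b u) := by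
        gcongr
    _ = _ := by push_cast; ring

/-- Finiteness is assumed only at 1. Monotonicity carries it to the right, and the almost
monotonicity of `s * tailNorm q b s` carries it to the left. -/
theorem SVZero.tailNorm_ne_top (hq : q ≠ 0) (hb : SVZero q b) {t : ℝ} (ht : 0 < t) :
    tailNorm q b t ≠ ∞ := by
  rcases le_total 1 t with h | h
  · exact ((tailNorm_antitone h).trans_lt hb.2).ne
  · obtain ⟨C, hC⟩ := exists_mul_tailNorm_le hq hb.1
    have h1 := hC t 1 ht h
    intro h2
    rw [h2, ENNReal.mul_top (by simpa using ht), top_le_iff] at h1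
    exact ENNReal.mul_ne_top ENNReal.coe_ne_top (ENNReal.mul_ne_top ENNReal.ofReal_ne_top hb.2.ne) h1

end tail

/-! ### Change of variables along the tail function. -/

theorem measurable_measureReal_Ioi (ν : Measure ℝ) : Measurable (fun u => ν.real (Ioi u)) := by
  have h : Antitone (fun u => ν (Ioi u)) := fun _ _ h => measure_mono (Ioi_subset_Ioi h)
  exact h.measurable.ennreal_toReal

/-- A measure on a half-line that is finite, without atoms and positive on intervals is carried
to Lebesgue measure by its tail function. -/
theorem map_measureReal_Ioi {ν : Measure ℝ} [NullSingletonClass ν] {a : ℝ} (hfin : ν (Ioi a) ≠ ∞)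
    (hpos : ∀ x y, a < x → x < y → 0 < ν (Ioo x y)) :
    (ν.restrict (Ioi a)).map (fun u => ν.real (Ioi u)) =
      volume.restrict (Ioo 0 (ν.real (Ioi a))) := by
  have hf : ∀ u, a ≤ u → ν (Ioi u) ≠ ∞ := fun u hu =>
    ((measure_mono (Ioi_subset_Ioi hu)).trans_lt hfin.lt_top).ne
  have hlt : ∀ x y, a < x → x < y → ν.real (Ioi y) < ν.real (Ioi x) := by
    intro x y hx hxy
    refine (ENNReal.toReal_lt_toReal (hf y (hx.trans hxy).le) (hf x hx.le)).2 ?_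
    calc ν (Ioi y) < ν (Ioo x y) + ν (Ioi y) := by
          rw [add_comm]
          exact ENNReal.lt_add_right (hf y (hx.trans hxy).le) (hpos x y hx hxy).ne'
      _ = ν (Ioo x y ∪ Ioi y) := by
          rw [measure_union _ measurableSet_Ioi]
          exact Set.disjoint_left.2 fun z hz hz' => lt_asymm hz.2 hz'
      _ ≤ ν (Ioi x) := measure_mono (union_subset Ioo_subset_Ioi_self (Ioi_subset_Ioi hxy.le))
  have hmono : ∀ x y, a ≤ x → x ≤ y → ν.real (Ioi y) ≤ ν.real (Ioi x) := fun x y hx hxy =>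
    ENNReal.toReal_mono (hf x hx) (measure_mono (Ioi_subset_Ioi hxy))
  have hint : IntegrableOn (fun _ : ℝ => (1 : ℝ)) (Ioi a) ν := integrableOn_const hfin
  have hcont : ContinuousOn (fun u => ν.real (Ioi u)) (Ici a) := by
    simpa using hint.continuousOn_Ici_primitive_Ioi
  have hzero : Filter.Tendsto (fun u => ν.real (Ioi u)) Filter.atTop (𝓝 0) := by
    simpa using tendsto_integral_Ioi_zero (f := fun _ : ℝ => (1 : ℝ)) (μ := ν)
      (Filter.tendsto_id (α := ℝ))
  have hWpos : ∀ x, a < x → 0 < ν.real (Ioi x) := fun x hx =>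
    measureReal_nonneg.trans_lt (hlt x (x + 1) hx (by linarith))
  have hm := measurable_measureReal_Ioi ν
  have : IsFiniteMeasure ((ν.restrict (Ioi a)).map (fun u => ν.real (Ioi u))) := by
    have : IsFiniteMeasure (ν.restrict (Ioi a)) := ⟨by simpa using hfin.lt_top⟩
    infer_instance
  -- Finite measures on the line are determined by their values on the half-lines `Iic s`; only `s`
  -- strictly between 0 and the total mass is not immediate.
  refine Measure.ext_of_Iic _ _ fun s => ?_
  rw [Measure.map_apply hm measurableSet_Iic, Measure.restrict_apply (hm measurableSet_Iic),
    Measure.restrict_apply measurableSet_Iic]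
  rcases le_or_gt s 0 with hs | hs
  · have e1 : (fun u => ν.real (Ioi u)) ⁻¹' Iic s ∩ Ioi a = ∅ := by
      ext u
      simp only [mem_inter_iff, mem_preimage, mem_Iic, mem_Ioi, mem_empty_iff_false, iff_false,
        not_and]
      intro h1 h2
      exact absurd (hWpos u h2) (by linarith)
    have e2 : Iic s ∩ Ioo 0 (ν.real (Ioi a)) = ∅ := by
      ext u
      simp only [mem_inter_iff, mem_Iic, mem_Ioo, mem_empty_iff_false, iff_false, not_and]
      intro h1 h2
      linarith
    rw [e1, e2]; simp
  rcases le_or_gt (ν.real (Ioi a)) s with hs' | hs'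
  · have e1 : (fun u => ν.real (Ioi u)) ⁻¹' Iic s ∩ Ioi a = Ioi a := by
      refine inter_eq_right.2 fun u hu => ?_
      exact (hmono a u le_rfl (le_of_lt hu)).trans hs'
    have e2 : Iic s ∩ Ioo 0 (ν.real (Ioi a)) = Ioo 0 (ν.real (Ioi a)) :=
      inter_eq_right.2 fun u hu => hu.2.le.trans hs'
    rw [e1, e2, Real.volume_Ioo, sub_zero, ofReal_measureReal hfin]
  -- Continuity gives a point `x` with tail mass exactly `s`, and strict monotonicity makes the
  -- preimage of `Iic s` equal to `[x, ∞)`, which has mass `s`.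
  · obtain ⟨y, hya, hys⟩ : ∃ y, a ≤ y ∧ ν.real (Ioi y) < s :=
      ((Filter.eventually_ge_atTop a).and (hzero.eventually_lt_const hs)).exists
    obtain ⟨x, hx, hxs⟩ := intermediate_value_Icc' hya (hcont.mono Icc_subset_Ici_self)
      ⟨hys.le, hs'.le⟩
    simp only at hxs
    have hax : a < x := by
      refine lt_of_le_of_ne hx.1 fun h => ?_
      rw [h, hxs] at hs'
      exact lt_irrefl _ hs'
    have e1 : (fun u => ν.real (Ioi u)) ⁻¹' Iic s ∩ Ioi a = Ici x := by
      ext u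
      simp only [mem_inter_iff, mem_preimage, mem_Iic, mem_Ioi, mem_Ici]
      constructor
      · rintro ⟨h1, h2⟩
        by_contra h3
        exact absurd (hlt u x h2 (not_le.1 h3)) (by rw [hxs]; exact not_lt.2 h1)
      · intro h
        exact ⟨(hmono x u hax.le h).trans hxs.le, hax.trans_le h⟩
    have e2 : Iic s ∩ Ioo 0 (ν.real (Ioi a)) = Ioc 0 s := by
      ext u
      simp only [mem_inter_iff, mem_Iic, mem_Ioo, mem_Ioc]
      constructor
      · rintro ⟨h1, h2, -⟩; exact ⟨h2, h1⟩
      · rintro ⟨h1, h2⟩; exact ⟨h2, h1, h2.trans_lt hs'⟩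
    rw [e1, e2, Real.volume_Ioc, sub_zero, ← measure_congr Ioi_ae_eq_Ici, ← hxs,
      ofReal_measureReal (hf x hax.le)]

section FiniteExponent

variable {q : ℝ≥0∞} {b : ℝ → ℝ}

/-- The `q`-th power of `tailNorm q b`, as a real number. -/
def tailInt (q : ℝ≥0∞) (b : ℝ → ℝ) (t : ℝ) : ℝ := (tailNorm q b t ^ q.toReal).toReal

theorem tailNorm_rpow (hq : q ≠ 0) (ht : q ≠ ∞) (t : ℝ) :
    tailNorm q b t ^ q.toReal = ∫⁻ u in Ioi t, weight 0 q b u ^ q.toReal := by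
  have := ENNReal.toReal_pos hq ht
  rw [tailNorm, eLpNorm_eq_lintegral_rpow_enorm_toReal hq ht, ← ENNReal.rpow_mul,
    one_div_mul_cancel this.ne', ENNReal.rpow_one]
  simp

theorem wNorm_rpow (hq : q ≠ 0) (ht : q ≠ ∞) (E : Set ℝ) (φ : ℝ → ℝ≥0∞) :
    wNorm q b E φ = (∫⁻ u in E, weight 0 q b u ^ q.toReal * φ u ^ q.toReal) ^ (1 / q.toReal) := by
  rw [wNorm, eLpNorm_eq_lintegral_rpow_enorm_toReal hq ht]
  simp [ENNReal.mul_rpow_of_nonneg]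

theorem ofReal_tailInt (hq : q ≠ 0) (hb : SVZero q b) {t : ℝ} (h0 : 0 < t) :
    ENNReal.ofReal (tailInt q b t) = tailNorm q b t ^ q.toReal :=
  ENNReal.ofReal_toReal (ENNReal.rpow_ne_top_of_nonneg (by positivity) (hb.tailNorm_ne_top hq h0))

theorem tailInt_eq (t : ℝ) : tailInt q b t = (tailNorm q b t).toReal ^ q.toReal :=
  (ENNReal.toReal_rpow _ _).symm

theorem toReal_tailNorm_pos (hq : q ≠ 0) (hb : SVZero q b) {t : ℝ} (h0 : 0 < t) :
    0 < (tailNorm q b t).toReal :=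
  ENNReal.toReal_pos (tailNorm_pos hq hb.1 h0).ne' (hb.tailNorm_ne_top hq h0)

theorem tailInt_pos (hq : q ≠ 0) (hb : SVZero q b) {t : ℝ} (h0 : 0 < t) : 0 < tailInt q b t := by
  rw [tailInt_eq]; exact Real.rpow_pos_of_pos (toReal_tailNorm_pos hq hb h0) _

theorem tailNorm_rpow_mul (hq : q ≠ 0) (ht : q ≠ ∞) (hb : SVZero q b) {t : ℝ} (h0 : 0 < t)
    (c : ℝ) : (tailNorm q b t ^ c) ^ q.toReal = ENNReal.ofReal (tailInt q b t ^ c) := by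
  have := ENNReal.toReal_pos hq ht
  rw [← ENNReal.ofReal_rpow_of_pos (tailInt_pos hq hb h0), ofReal_tailInt hq hb h0,
    ← ENNReal.rpow_mul, ← ENNReal.rpow_mul, mul_comm]

theorem tailInt_anti (hq : q ≠ 0) (hb : SVZero q b) {s t : ℝ} (hs : 0 < s) (hst : s ≤ t) :
    tailInt q b t ≤ tailInt q b s := by
  refine ENNReal.toReal_mono (ENNReal.rpow_ne_top_of_nonneg (by positivity)
    (hb.tailNorm_ne_top hq hs)) ?_
  gcongr
  exact tailNorm_antitone hst

/-- The measure with density `(u ^ (-1/q) b(u)) ^ q` on `(0, ∞)`. -/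
def tailMeasure (q : ℝ≥0∞) (b : ℝ → ℝ) : Measure ℝ :=
  (volume.restrict (Ioi 0)).withDensity (fun u => weight 0 q b u ^ q.toReal)

theorem tailMeasure_apply {E : Set ℝ} (hE : MeasurableSet E) (h : E ⊆ Ioi 0) :
    tailMeasure q b E = ∫⁻ u in E, weight 0 q b u ^ q.toReal := by
  rw [tailMeasure, withDensity_apply _ hE, Measure.restrict_restrict hE, inter_eq_left.2 h]

theorem restrict_tailMeasure_Ioi {a : ℝ} (ha : 0 ≤ a) :
    (tailMeasure q b).restrict (Ioi a) =
      (volume.restrict (Ioi a)).withDensity (fun u => weight 0 q b u ^ q.toReal) := by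
  rw [tailMeasure, restrict_withDensity measurableSet_Ioi,
    Measure.restrict_restrict measurableSet_Ioi, inter_eq_left.2 (Ioi_subset_Ioi ha)]

theorem tailMeasure_Ioi (hq : q ≠ 0) (ht : q ≠ ∞) {t : ℝ} (h0 : 0 ≤ t) :
    tailMeasure q b (Ioi t) = tailNorm q b t ^ q.toReal := by
  rw [tailMeasure_apply measurableSet_Ioi (Ioi_subset_Ioi h0), tailNorm_rpow hq ht]

theorem tailMeasure_real_Ioi (hq : q ≠ 0) (ht : q ≠ ∞) {t : ℝ} (h0 : 0 ≤ t) :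
    (tailMeasure q b).real (Ioi t) = tailInt q b t := by
  rw [measureReal_def, tailMeasure_Ioi hq ht h0, tailInt]

instance nullSingletonClass_tailMeasure (q : ℝ≥0∞) (b : ℝ → ℝ) :
    NullSingletonClass (tailMeasure q b) := by
  unfold tailMeasure; infer_instance

theorem tailMeasure_Ioo_pos (hb : SlowlyVarying b) {x y : ℝ} (hx : 0 < x)
    (hxy : x < y) : 0 < tailMeasure q b (Ioo x y) := by
  have hsub : Ioo x y ⊆ Ioi 0 := fun u hu => hx.trans hu.1
  rw [tailMeasure_apply measurableSet_Ioo hsub]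
  have hm : AEMeasurable (fun u => weight 0 q b u ^ q.toReal) (volume.restrict (Ioo x y)) :=
    ((hb.aemeasurable_weight q).mono_measure (Measure.restrict_mono hsub le_rfl)).pow_const _
  rw [pos_iff_ne_zero, Ne, lintegral_eq_zero_iff' hm]
  intro h
  have h1 : ∀ᵐ u ∂volume.restrict (Ioo x y), False := by
    filter_upwards [h, ae_restrict_mem measurableSet_Ioo] with u hu hu'
    have h2 := weight_pos (q := q) hb (hsub hu')
    refine (ENNReal.rpow_pos h2 ?_).ne' hu
    simp [weight]
  rw [Filter.eventually_false_iff_eq_bot, ae_eq_bot, Measure.restrict_eq_zero, Real.volume_Ioo,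
    ENNReal.ofReal_eq_zero] at h1
  linarith

/-- Change of variables `s = tailInt q b u`. -/
theorem lintegral_comp_tailInt (hq : q ≠ 0) (ht : q ≠ ∞) (hb : SVZero q b) {a : ℝ} (ha : 0 < a)
    {g : ℝ → ℝ≥0∞} (hg : Measurable g) :
    ∫⁻ u in Ioi a, weight 0 q b u ^ q.toReal * g (tailInt q b u) =
      ∫⁻ s in Ioo 0 (tailInt q b a), g s := by
  have hm := measurable_measureReal_Ioi (tailMeasure q b)
  rw [← tailMeasure_real_Ioi hq ht ha.le, ← map_measureReal_Ioi
    (by rw [tailMeasure_Ioi hq ht ha.le]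
        exact ENNReal.rpow_ne_top_of_nonneg (by positivity) (hb.tailNorm_ne_top hq ha))
    (fun x y hx hxy => tailMeasure_Ioo_pos hb.1 (ha.trans hx) hxy), lintegral_map hg hm,
    restrict_tailMeasure_Ioi ha.le, lintegral_withDensity_eq_lintegral_mul₀
      (((hb.1.aemeasurable_weight q).mono_measure (Measure.restrict_mono
        (Ioi_subset_Ioi ha.le) le_rfl)).pow_const _) (g := fun u => g ((tailMeasure q b).real (Ioi u))) (hg.comp hm).aemeasurable]
  refine setLIntegral_congr_fun measurableSet_Ioi fun u hu => ?_
  simp only [Pi.mul_apply, tailMeasure_real_Ioi (b := b) hq ht (ha.trans hu).le]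

/-- The upper limit `t` is encoded by an indicator in the new variable, which reduces the claim to
the substitution on `(a, ∞)`. The closed endpoint makes the indicator equal to 1 on all of `(a, t]`.
-/
theorem setLIntegral_comp_tailInt_le (hq : q ≠ 0) (ht : q ≠ ∞) (hb : SVZero q b) {a t : ℝ}
    (ha : 0 < a) {g : ℝ → ℝ≥0∞} (hg : Measurable g) :
    ∫⁻ u in Ioc a t, weight 0 q b u ^ q.toReal * g (tailInt q b u) ≤
      ∫⁻ s in Ico (tailInt q b t) (tailInt q b a), g s := by
  calc ∫⁻ u in Ioc a t, weight 0 q b u ^ q.toReal * g (tailInt q b u)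
      ≤ ∫⁻ u in Ioc a t, weight 0 q b u ^ q.toReal *
          (Ici (tailInt q b t)).indicator g (tailInt q b u) := by
        refine setLIntegral_mono' measurableSet_Ioc fun u hu => ?_
        rw [indicator_of_mem (mem_Ici.2 (tailInt_anti hq hb (ha.trans hu.1) hu.2))]
    _ ≤ ∫⁻ u in Ioi a, weight 0 q b u ^ q.toReal *
          (Ici (tailInt q b t)).indicator g (tailInt q b u) :=
        lintegral_mono_set Ioc_subset_Ioi_self
    _ = ∫⁻ s in Ioo 0 (tailInt q b a), (Ici (tailInt q b t)).indicator g s :=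
        lintegral_comp_tailInt hq ht hb ha (hg.indicator measurableSet_Ici)
    _ = ∫⁻ s in Ici (tailInt q b t) ∩ Ioo 0 (tailInt q b a), g s := by
        rw [lintegral_indicator measurableSet_Ici, Measure.restrict_restrict measurableSet_Ici]
    _ ≤ _ := lintegral_mono_set (fun s hs => mem_Ico.2 ⟨hs.1, hs.2.2⟩)

/-- Here the endpoint is open, so that the indicator vanishes for `u > t`, where the tail is at most
its value at `t`. -/
theorem le_setLIntegral_comp_tailInt (hq : q ≠ 0) (ht : q ≠ ∞) (hb : SVZero q b) {a t : ℝ}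
    (ha : 0 < a) (hat : a ≤ t) {g : ℝ → ℝ≥0∞} (hg : Measurable g) :
    ∫⁻ s in Ioo (tailInt q b t) (tailInt q b a), g s ≤
      ∫⁻ u in Ioc a t, weight 0 q b u ^ q.toReal * g (tailInt q b u) := by
  have h0 := tailInt_pos hq hb (ha.trans_le hat)
  calc ∫⁻ s in Ioo (tailInt q b t) (tailInt q b a), g s
      ≤ ∫⁻ s in Ioi (tailInt q b t) ∩ Ioo 0 (tailInt q b a), g s :=
        lintegral_mono_set fun s hs => ⟨hs.1, h0.trans hs.1, hs.2⟩
    _ = ∫⁻ s in Ioo 0 (tailInt q b a), (Ioi (tailInt q b t)).indicator g s := by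
        rw [lintegral_indicator measurableSet_Ioi, Measure.restrict_restrict measurableSet_Ioi]
    _ = ∫⁻ u in Ioi a, weight 0 q b u ^ q.toReal *
          (Ioi (tailInt q b t)).indicator g (tailInt q b u) :=
        (lintegral_comp_tailInt hq ht hb ha (hg.indicator measurableSet_Ioi)).symm
    _ ≤ ∫⁻ u in Ioi a, (Ioc a t).indicator
          (fun u => weight 0 q b u ^ q.toReal * g (tailInt q b u)) u := by
        refine setLIntegral_mono' measurableSet_Ioi fun u hu => ?_
        by_cases hut : u ≤ t
        · rw [indicator_of_mem (show u ∈ Ioc a t from ⟨hu, hut⟩)]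
          gcongr
          exact indicator_le_self _ _ _
        · rw [indicator_of_notMem, mul_zero]
          · exact zero_le
          · simpa using tailInt_anti hq hb (ha.trans_le hat) (not_le.1 hut).le
    _ = _ := by
        rw [lintegral_indicator measurableSet_Ioc, Measure.restrict_restrict measurableSet_Ioc,
          inter_eq_left.2 Ioc_subset_Ioi_self]

/-- The tail may blow up at 0, so the substitution is applied on `(a, t]` with `a > 0`; monotone
convergence then passes to `(0, t]`. -/
theorem setLIntegral_Ioc_zero_le {f : ℝ → ℝ≥0∞} {t : ℝ} {B : ℝ≥0∞}
    (h : ∀ a, 0 < a → ∫⁻ u in Ioc a t, f u ≤ B) : ∫⁻ u in Ioc 0 t, f u ≤ B := by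
  have e : Ioc 0 t = ⋃ n : ℕ, Ioc (1 / ((n : ℝ) + 1)) t := by
    ext u
    simp only [mem_Ioc, mem_iUnion]
    constructor
    · rintro ⟨h1, h2⟩
      obtain ⟨n, hn⟩ := exists_nat_one_div_lt h1
      exact ⟨n, hn, h2⟩
    · rintro ⟨n, h1, h2⟩
      exact ⟨lt_trans (by positivity) h1, h2⟩
  have hdir : Directed (· ⊆ ·) (fun n : ℕ => Ioc (1 / ((n : ℝ) + 1)) t) := by
    refine Monotone.directed_le fun m n hmn => Ioc_subset_Ioc_left ?_
    gcongr
  rw [e, setLIntegral_iUnion_of_directed _ hdir]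
  exact iSup_le fun n => h _ (by positivity)

theorem lintegral_Ici_rpow {c ε : ℝ} (hc : 0 < c) (hε : 0 < ε) :
    ∫⁻ s in Ici c, ENNReal.ofReal (s ^ (-(1 + ε))) = ENNReal.ofReal (c ^ (-ε) / ε) := by
  rw [← restrict_Ioi_eq_restrict_Ici, ← ofReal_integral_eq_lintegral_ofReal
    (integrableOn_Ioi_rpow_of_lt (by linarith) hc), integral_Ioi_rpow_of_lt (by linarith) hc]
  · congr 1
    rw [show -(1 + ε) + 1 = -ε by ring, neg_div_neg_eq]
  · filter_upwards [ae_restrict_mem measurableSet_Ioi] with s hs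
    exact Real.rpow_nonneg (hc.trans hs).le _

theorem lintegral_Ioo_rpow {c a : ℝ} (hc : 0 < c) (ha : a < 1) :
    ∫⁻ s in Ioo 0 c, ENNReal.ofReal (s ^ (-a)) = ENNReal.ofReal (c ^ (1 - a) / (1 - a)) := by
  have h2 : IntegrableOn (fun u : ℝ => u ^ (-a)) (Ioc 0 c) := by
    rw [← intervalIntegrable_iff_integrableOn_Ioc_of_le hc.le]
    exact intervalIntegral.intervalIntegrable_rpow' (by linarith)
  rw [restrict_Ioo_eq_restrict_Ioc, ← ofReal_integral_eq_lintegral_ofReal h2,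
    ← intervalIntegral.integral_of_le hc.le, integral_rpow (Or.inl (by linarith)),
    Real.zero_rpow (by linarith), sub_zero, neg_add_eq_sub]
  filter_upwards [ae_restrict_mem measurableSet_Ioc] with u hu
  exact Real.rpow_nonneg hu.1.le _

theorem lintegral_Ioc_inv {c d : ℝ} (hc : 0 < c) (hcd : c ≤ d) :
    ∫⁻ s in Ioc c d, ENNReal.ofReal (s ^ (-1 : ℝ)) = ENNReal.ofReal (Real.log (d / c)) := by
  have h0 : (0 : ℝ) ∉ uIcc c d := by
    rw [uIcc_of_le hcd]; exact fun h => absurd h.1 (not_le.2 hc)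
  have e : ∀ s : ℝ, s ^ (-1 : ℝ) = 1 / s := fun s => by rw [Real.rpow_neg_one, one_div]
  simp_rw [e]
  have h2 : IntegrableOn (fun u : ℝ => 1 / u) (Ioc c d) := by
    rw [← intervalIntegrable_iff_integrableOn_Ioc_of_le hcd]
    exact intervalIntegral.intervalIntegrable_one_div (fun x hx hx0 => h0 (hx0 ▸ hx))
      continuousOn_id
  rw [← ofReal_integral_eq_lintegral_ofReal h2, ← intervalIntegral.integral_of_le hcd,
    integral_one_div h0]
  filter_upwards [ae_restrict_mem measurableSet_Ioc] with u hu
  have := hc.trans hu.1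
  show 0 ≤ 1 / u
  positivity

/-- After the substitution the integrand is `1/s`, hence the logarithm; the factor `q` appears
because the new variable is the `q`-th power of the tail. This critical power is what separates
different exponents in the converse. -/
theorem wNorm_tailNorm_inv (hq : q ≠ 0) (ht : q ≠ ∞) (hb : SVZero q b) {a t : ℝ}
    (ha : 0 < a) (hat : a ≤ t) :
    wNorm q b (Ioc a t) (fun u => (tailNorm q b u)⁻¹) =
      ENNReal.ofReal (q.toReal * Real.log ((tailNorm q b a).toReal / (tailNorm q b t).toReal)) ^
        (1 / q.toReal) := by
  have hg : Measurable (fun s : ℝ => ENNReal.ofReal (s ^ (-1 : ℝ))) := by fun_prop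
  have h0 := tailInt_pos hq hb (ha.trans_le hat)
  have hle := tailInt_anti hq hb ha hat
  have e : ∫⁻ u in Ioc a t, weight 0 q b u ^ q.toReal * (tailNorm q b u)⁻¹ ^ q.toReal =
      ∫⁻ u in Ioc a t, weight 0 q b u ^ q.toReal * ENNReal.ofReal (tailInt q b u ^ (-1 : ℝ)) := by
    refine setLIntegral_congr_fun measurableSet_Ioc fun u hu => ?_
    rw [← tailNorm_rpow_mul hq ht hb (ha.trans hu.1), ENNReal.rpow_neg_one]
  rw [wNorm_rpow hq ht, e]
  congr 1
  have h3 : Real.log (tailInt q b a / tailInt q b t) =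
      q.toReal * Real.log ((tailNorm q b a).toReal / (tailNorm q b t).toReal) := by
    rw [tailInt_eq, tailInt_eq, ← Real.div_rpow ENNReal.toReal_nonneg ENNReal.toReal_nonneg,
      Real.log_rpow (div_pos (toReal_tailNorm_pos hq hb ha)
        (toReal_tailNorm_pos hq hb (ha.trans_le hat)))]
  rw [← h3, ← lintegral_Ioc_inv h0 hle]
  apply le_antisymm
  · refine (setLIntegral_comp_tailInt_le hq ht hb ha hg).trans ?_
    rw [restrict_Ico_eq_restrict_Ioc]
  · rw [← restrict_Ioo_eq_restrict_Ioc]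
    exact le_setLIntegral_comp_tailInt hq ht hb ha hat hg

end FiniteExponent

/-! ### Weighted norms of powers of the tail. -/

section

variable {q : ℝ≥0∞} {b : ℝ → ℝ}

theorem exists_weight_top_le (hb : SlowlyVarying b) : ∃ C : ℝ≥0, ∀ u, 0 < u →
    weight 0 ∞ b u ≤ C * tailNorm ∞ b u := by
  obtain ⟨C, hC⟩ := exists_le_tailNorm ENNReal.top_ne_zero hb
  refine ⟨C, fun u hu => ?_⟩
  simpa [weight_zero_eq] using hC u hu

/-- For `q = ∞`, `weight * T ^ (-a) ≲ T ^ (1 - a)` pointwise. -/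
theorem exists_wNorm_top_le (hb : SVZero ∞ b) : ∃ C : ℝ≥0, ∀ (E : Set ℝ) (a : ℝ) (B : ℝ≥0∞),
    MeasurableSet E → E ⊆ Ioi 0 → (∀ u ∈ E, tailNorm ∞ b u ^ (1 - a) ≤ B) →
      wNorm ∞ b E (fun u => tailNorm ∞ b u ^ (-a)) ≤ C * B := by
  obtain ⟨C, hC⟩ := exists_weight_top_le hb.1
  refine ⟨C, fun E a B hE hE0 h => ?_⟩
  rw [wNorm, eLpNorm_exponent_top]
  refine eLpNormEssSup_le_of_ae_enorm_bound ?_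
  filter_upwards [ae_restrict_mem hE] with u hu
  rw [enorm_eq_self]
  have h0 := tailNorm_pos ENNReal.top_ne_zero hb.1 (hE0 hu)
  have h1 := hb.tailNorm_ne_top ENNReal.top_ne_zero (hE0 hu)
  calc weight 0 ∞ b u * tailNorm ∞ b u ^ (-a)
      ≤ C * tailNorm ∞ b u * tailNorm ∞ b u ^ (-a) := by gcongr; exact hC u (hE0 hu)
    _ = C * tailNorm ∞ b u ^ (1 - a) := by
        rw [mul_assoc, sub_eq_add_neg, ENNReal.rpow_add _ _ h0.ne' h1, ENNReal.rpow_one]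
    _ ≤ C * B := by gcongr; exact h u hu

/-- The substitution bounds the `q`-th power by the integral of `s ^ (-(1 + ε))` over `[W, ∞)`, with
`W` the `q`-th power of the tail at `t`. It converges at infinity because `ε > 0`. -/
theorem exists_wNorm_Ioc_tailNorm_rpow_le (hq : q ≠ 0) (hb : SVZero q b) {ε : ℝ} (hε : 0 < ε) :
    ∃ C : ℝ≥0, ∀ t, 0 < t → wNorm q b (Ioc 0 t) (fun u => tailNorm q b u ^ (-(1 + ε))) ≤
      C * tailNorm q b t ^ (-ε) := by
  rcases eq_or_ne q ∞ with rfl | ht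
  · obtain ⟨C, hC⟩ := exists_wNorm_top_le hb
    refine ⟨C, fun t ht => hC _ _ _ measurableSet_Ioc Ioc_subset_Ioi_self fun u hu => ?_⟩
    rw [show 1 - (1 + ε) = -ε by ring, ENNReal.rpow_neg, ENNReal.rpow_neg]
    gcongr
    exact tailNorm_antitone hu.2
  · have hr := ENNReal.toReal_pos hq ht
    refine ⟨(Real.toNNReal (1 / ε)) ^ (1 / q.toReal), fun t h0 => ?_⟩
    rw [wNorm_rpow hq ht]
    have hW := tailInt_pos hq hb h0
    have hg : Measurable (fun s : ℝ => ENNReal.ofReal (s ^ (-(1 + ε)))) := by fun_prop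
    have key : ∫⁻ u in Ioc 0 t, weight 0 q b u ^ q.toReal *
        (tailNorm q b u ^ (-(1 + ε))) ^ q.toReal ≤
          ENNReal.ofReal (tailInt q b t ^ (-ε) / ε) := by
      refine setLIntegral_Ioc_zero_le fun a ha => ?_
      rw [← lintegral_Ici_rpow hW hε]
      refine le_trans (le_of_eq ?_) ((setLIntegral_comp_tailInt_le hq ht hb ha hg (t := t)).trans
        (lintegral_mono_set Ico_subset_Ici_self))
      refine setLIntegral_congr_fun measurableSet_Ioc fun u hu => ?_
      rw [tailNorm_rpow_mul hq ht hb (ha.trans hu.1)]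
    calc _ ≤ ENNReal.ofReal (tailInt q b t ^ (-ε) / ε) ^ (1 / q.toReal) := by gcongr
      _ = _ := by
        rw [div_eq_mul_one_div, mul_comm, ENNReal.ofReal_mul (by positivity),
          ENNReal.mul_rpow_of_nonneg _ _ (by positivity), ← tailNorm_rpow_mul hq ht hb h0,
          ← ENNReal.rpow_mul (tailNorm q b t ^ (-ε)), mul_one_div_cancel hr.ne', ENNReal.rpow_one,
          ENNReal.coe_rpow_of_nonneg _ (by positivity), ENNReal.ofReal]

/-- The counterpart at the other end: the integral of `s ^ (-a)` over `(0, W)` converges at 0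
because `a < 1`. -/
theorem exists_wNorm_Ioi_tailNorm_rpow_le (hq : q ≠ 0) (hb : SVZero q b) {a : ℝ} (ha : a < 1) :
    ∃ C : ℝ≥0, ∀ t, 0 < t → wNorm q b (Ioi t) (fun u => tailNorm q b u ^ (-a)) ≤
      C * tailNorm q b t ^ (1 - a) := by
  rcases eq_or_ne q ∞ with rfl | ht
  · obtain ⟨C, hC⟩ := exists_wNorm_top_le hb
    refine ⟨C, fun t ht => hC _ _ _ measurableSet_Ioi (Ioi_subset_Ioi ht.le) fun u hu => ?_⟩
    refine ENNReal.rpow_le_rpow (tailNorm_antitone (le_of_lt hu)) (by linarith)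
  · have hr := ENNReal.toReal_pos hq ht
    refine ⟨(Real.toNNReal (1 / (1 - a))) ^ (1 / q.toReal), fun t h0 => ?_⟩
    rw [wNorm_rpow hq ht]
    have hW := tailInt_pos hq hb h0
    have ha' : 0 < 1 - a := by linarith
    have hg : Measurable (fun s : ℝ => ENNReal.ofReal (s ^ (-a))) := by fun_prop
    have key : ∫⁻ u in Ioi t, weight 0 q b u ^ q.toReal * (tailNorm q b u ^ (-a)) ^ q.toReal =
        ENNReal.ofReal (tailInt q b t ^ (1 - a) / (1 - a)) := by
      rw [← lintegral_Ioo_rpow hW ha, ← lintegral_comp_tailInt hq ht hb h0 hg]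
      refine setLIntegral_congr_fun measurableSet_Ioi fun u hu => ?_
      rw [tailNorm_rpow_mul hq ht hb (h0.trans hu)]
    rw [key, div_eq_mul_one_div, mul_comm, ENNReal.ofReal_mul (by positivity),
      ENNReal.mul_rpow_of_nonneg _ _ (by positivity), ← tailNorm_rpow_mul hq ht hb h0,
      ← ENNReal.rpow_mul (tailNorm q b t ^ (1 - a)), mul_one_div_cancel hr.ne', ENNReal.rpow_one,
      ENNReal.coe_rpow_of_nonneg _ (by positivity), ENNReal.ofReal]

/-- The intermediate value property of the tail for finite exponents. -/
theorem exists_tailNorm_eq (hq : q ≠ 0) (ht : q ≠ ∞) (hb : SVZero q b) {a t y : ℝ} (ha : 0 < a)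
    (hat : a ≤ t) (h1 : (tailNorm q b t).toReal ≤ y) (h2 : y ≤ (tailNorm q b a).toReal) :
    ∃ x ∈ Icc a t, (tailNorm q b x).toReal = y := by
  have hfin : tailMeasure q b (Ioi a) ≠ ∞ := by
    rw [tailMeasure_Ioi hq ht ha.le]
    exact ENNReal.rpow_ne_top_of_nonneg (by positivity) (hb.tailNorm_ne_top hq ha)
  have hint : IntegrableOn (fun _ : ℝ => (1 : ℝ)) (Ioi a) (tailMeasure q b) :=
    integrableOn_const hfin
  have hcont : ContinuousOn (fun u => (tailMeasure q b).real (Ioi u)) (Ici a) := by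
    simpa using hint.continuousOn_Ici_primitive_Ioi
  have hcont' : ContinuousOn (fun u => (tailNorm q b u).toReal) (Icc a t) := by
    have h3 := (hcont.mono (fun x (hx : x ∈ Icc a t) => hx.1)).rpow_const (p := 1 / q.toReal)
      (fun x _ => Or.inr (by positivity))
    refine h3.congr fun u hu => ?_
    simp only
    rw [tailMeasure_real_Ioi hq ht (ha.le.trans hu.1), tailInt_eq,
      ← Real.rpow_mul ENNReal.toReal_nonneg, mul_one_div_cancel (ENNReal.toReal_pos hq ht).ne',
      Real.rpow_one]
  obtain ⟨x, hx, hxy⟩ := intermediate_value_Icc' hat hcont' ⟨h1, h2⟩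
  exact ⟨x, hx, hxy⟩

end

theorem mul_wNorm_le {q : ℝ≥0∞} {b : ℝ → ℝ} {E : Set ℝ} {φ ψ : ℝ → ℝ≥0∞} {C : ℝ≥0∞} (hC : C ≠ ∞)
    (hE : MeasurableSet E) (h : ∀ u ∈ E, C * ψ u ≤ φ u) :
    C * wNorm q b E ψ ≤ wNorm q b E φ := by
  rcases eq_or_ne C 0 with rfl | h0
  · simp
  calc C * wNorm q b E ψ ≤ C * (C⁻¹ * wNorm q b E φ) := by
        gcongr
        refine wNorm_le_mul (ENNReal.inv_ne_top.2 h0) hE fun u hu => ?_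
        calc ψ u = C⁻¹ * (C * ψ u) := by
              rw [← mul_assoc, ENNReal.inv_mul_cancel h0 hC, one_mul]
          _ ≤ C⁻¹ * φ u := by gcongr; exact h u hu
    _ = wNorm q b E φ := by rw [← mul_assoc, ENNReal.mul_inv_cancel h0 hC, one_mul]

/-- Unlike subadditivity in the set, the quasi-triangle inequality in the function uses
measurability of both summands. -/
theorem exists_wNorm_add_le (q : ℝ≥0∞) {b : ℝ → ℝ} (hb : SlowlyVarying b) : ∃ C : ℝ≥0,
    ∀ (E : Set ℝ) (φ ψ : ℝ → ℝ≥0∞), E ⊆ Ioi 0 → Measurable φ → Measurable ψ →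
      wNorm q b E (fun u => φ u + ψ u) ≤ C * (wNorm q b E φ + wNorm q b E ψ) := by
  refine ⟨q.LpAddConst.toNNReal, fun E φ ψ hE hφ hψ => ?_⟩
  have hw : AEMeasurable (weight 0 q b) (volume.restrict E) :=
    (hb.aemeasurable_weight q).mono_measure (Measure.restrict_mono hE le_rfl)
  rw [ENNReal.coe_toNNReal (ENNReal.LpAddConst_lt_top q).ne]
  have h := eLpNorm_add_le' (hw.mul hφ.aemeasurable).aestronglyMeasurable
    (hw.mul hψ.aemeasurable).aestronglyMeasurable q
  refine le_trans (le_of_eq ?_) h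
  rw [wNorm]
  congr 1
  ext u
  simp [mul_add]

/-! ### `K`-functionals of quasi-normed couples. -/

section kFunctional

variable {V : Type*} [Add V] {S₀ S₁ : Set V} {N₀ N₁ : V → ℝ≥0∞} {t : ℝ≥0∞} {f : V}

theorem kFunctional_le {f₀ f₁ : V} (h₀ : f₀ ∈ S₀) (h₁ : f₁ ∈ S₁) (h : f = f₀ + f₁) :
    kFunctional S₀ S₁ N₀ N₁ t f ≤ N₀ f₀ + t * N₁ f₁ :=
  iInf₂_le_of_le f₀ h₀ (iInf₂_le_of_le f₁ h₁ (iInf_le_of_le h le_rfl))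

theorem le_kFunctional {x : ℝ≥0∞}
    (h : ∀ f₀ ∈ S₀, ∀ f₁ ∈ S₁, f = f₀ + f₁ → x ≤ N₀ f₀ + t * N₁ f₁) :
    x ≤ kFunctional S₀ S₁ N₀ N₁ t f :=
  le_iInf₂ fun f₀ h₀ => le_iInf₂ fun f₁ h₁ => le_iInf fun e => h f₀ h₀ f₁ h₁ e

theorem le_mul_kFunctional {x c : ℝ≥0∞} (hc : c ≠ 0) (hc' : c ≠ ∞)
    (h : ∀ f₀ ∈ S₀, ∀ f₁ ∈ S₁, f = f₀ + f₁ → x ≤ c * (N₀ f₀ + t * N₁ f₁)) :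
    x ≤ c * kFunctional S₀ S₁ N₀ N₁ t f := by
  rw [mul_comm, ← ENNReal.div_le_iff hc hc']
  refine le_kFunctional fun f₀ h₀ f₁ h₁ e => ?_
  rw [ENNReal.div_le_iff hc hc', mul_comm]
  exact h f₀ h₀ f₁ h₁ e

theorem exists_of_kFunctional_lt {x : ℝ≥0∞} (h : kFunctional S₀ S₁ N₀ N₁ t f < x) :
    ∃ f₀ ∈ S₀, ∃ f₁ ∈ S₁, f = f₀ + f₁ ∧ N₀ f₀ + t * N₁ f₁ < x := by
  by_contra! h'
  exact absurd (le_kFunctional h') (not_le.2 h)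

end kFunctional

section Couple

variable {𝕜 V : Type*} [RCLike 𝕜] [AddCommGroup V] [Module 𝕜 V] [TopologicalSpace V]

theorem QuasiNormedSubspace.qnorm_zero (A : QuasiNormedSubspace 𝕜 V) : A.qnorm 0 = 0 := by
  simpa using A.smul 0 0 A.toSubmodule.zero_mem

theorem QuasiNormedSubspace.qnorm_neg (A : QuasiNormedSubspace 𝕜 V) {x : V}
    (hx : x ∈ A.toSubmodule) : A.qnorm (-x) = A.qnorm x := by
  simpa using A.smul (-1) x hx

theorem QuasiNormedSubspace.exists_ofReal_qnorm_add_le (A : QuasiNormedSubspace 𝕜 V) :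
    ∃ C : ℝ≥0, ∀ x ∈ A.toSubmodule, ∀ y ∈ A.toSubmodule, ENNReal.ofReal (A.qnorm (x + y)) ≤
      C * (ENNReal.ofReal (A.qnorm x) + ENNReal.ofReal (A.qnorm y)) := by
  obtain ⟨C, hC⟩ := A.add_le
  refine ⟨C.toNNReal, fun x hx y hy => ?_⟩
  have hx0 := A.nonneg x hx
  have hy0 := A.nonneg y hy
  rw [← ENNReal.ofReal_add hx0 hy0]
  calc ENNReal.ofReal (A.qnorm (x + y)) ≤ ENNReal.ofReal (C * (A.qnorm x + A.qnorm y)) :=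
        ENNReal.ofReal_le_ofReal (hC x hx y hy)
    _ = _ := by rw [ENNReal.ofReal_mul' (by positivity)]; rfl

variable (A₀ A₁ : QuasiNormedSubspace 𝕜 V)

theorem K_mono (f : V) : Monotone (fun t => K A₀ A₁ t f) := fun s t hst =>
  le_kFunctional fun f₀ h₀ f₁ h₁ e => (kFunctional_le h₀ h₁ e).trans (by
    gcongr)

theorem ofReal_mul_K_le {s t : ℝ} (hs : 0 < s) (hst : s ≤ t) (f : V) :
    ENNReal.ofReal s * K A₀ A₁ t f ≤ ENNReal.ofReal t * K A₀ A₁ s f := by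
  have ht := hs.trans_le hst
  refine le_mul_kFunctional (by simpa using ht) ENNReal.ofReal_ne_top fun f₀ h₀ f₁ h₁ e => ?_
  calc ENNReal.ofReal s * K A₀ A₁ t f
      ≤ ENNReal.ofReal s * (ENNReal.ofReal (A₀.qnorm f₀) +
          ENNReal.ofReal t * ENNReal.ofReal (A₁.qnorm f₁)) := by
        gcongr; exact kFunctional_le h₀ h₁ e
    _ = ENNReal.ofReal s * ENNReal.ofReal (A₀.qnorm f₀) +
          ENNReal.ofReal t * (ENNReal.ofReal s * ENNReal.ofReal (A₁.qnorm f₁)) := by ring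
    _ ≤ ENNReal.ofReal t * ENNReal.ofReal (A₀.qnorm f₀) +
          ENNReal.ofReal t * (ENNReal.ofReal s * ENNReal.ofReal (A₁.qnorm f₁)) := by gcongr
    _ = _ := by ring

theorem K_ne_top {f : V} (hf : f ∈ A₀.toSubmodule ⊔ A₁.toSubmodule) (t : ℝ) :
    K A₀ A₁ t f ≠ ∞ := by
  obtain ⟨f₀, h₀, f₁, h₁, rfl⟩ := Submodule.mem_sup.1 hf
  exact ne_top_of_le_ne_top (by finiteness) (kFunctional_le h₀ h₁ rfl)

theorem exists_K_add_le : ∃ C : ℝ≥0, 0 < C ∧ ∀ (t : ℝ) (f g : V),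
    K A₀ A₁ t (f + g) ≤ C * (K A₀ A₁ t f + K A₀ A₁ t g) := by
  obtain ⟨C₀, hC₀⟩ := A₀.exists_ofReal_qnorm_add_le
  obtain ⟨C₁, hC₁⟩ := A₁.exists_ofReal_qnorm_add_le
  set C : ℝ≥0 := C₀ + C₁ + 1 with hC
  have hCpos : 0 < C := by positivity
  refine ⟨C, hCpos, fun t f g => ?_⟩
  have h0 : (C : ℝ≥0∞) ≠ 0 := by simpa using hCpos.ne'
  have hC₀' : (C₀ : ℝ≥0∞) ≤ C := by
    rw [ENNReal.coe_le_coe, hC, add_assoc]; exact le_self_add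
  have hC₁' : (C₁ : ℝ≥0∞) ≤ C := by
    rw [ENNReal.coe_le_coe, hC, add_comm C₀, add_assoc]; exact le_self_add
  -- Dividing by `C` and moving one term across by truncated subtraction lets the two infima be
  -- handled one after the other.
  rw [mul_comm, ← ENNReal.div_le_iff h0 ENNReal.coe_ne_top, ← tsub_le_iff_right]
  refine le_kFunctional fun f₀ h₀ f₁ h₁ e => ?_
  rw [tsub_le_iff_tsub_le]
  refine le_kFunctional fun g₀ h₀' g₁ h₁' e' => ?_
  rw [tsub_le_iff_right, ENNReal.div_le_iff h0 ENNReal.coe_ne_top]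
  calc K A₀ A₁ t (f + g)
      ≤ ENNReal.ofReal (A₀.qnorm (f₀ + g₀)) +
          ENNReal.ofReal t * ENNReal.ofReal (A₁.qnorm (f₁ + g₁)) :=
        kFunctional_le (add_mem h₀ h₀') (add_mem h₁ h₁') (by rw [e, e']; abel)
    _ ≤ C * (ENNReal.ofReal (A₀.qnorm f₀) + ENNReal.ofReal (A₀.qnorm g₀)) +
          ENNReal.ofReal t * (C * (ENNReal.ofReal (A₁.qnorm f₁) +
            ENNReal.ofReal (A₁.qnorm g₁))) := by
        gcongr
        · exact (hC₀ _ h₀ _ h₀').trans (by gcongr)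
        · exact (hC₁ _ h₁ _ h₁').trans (by gcongr)
    _ = _ := by ring

theorem K_le_qnorm_left {f : V} (hf : f ∈ A₀.toSubmodule) (t : ℝ) :
    K A₀ A₁ t f ≤ ENNReal.ofReal (A₀.qnorm f) := by
  refine (kFunctional_le (f₁ := 0) hf A₁.toSubmodule.zero_mem (by simp)).trans ?_
  simp [A₁.qnorm_zero]

theorem K_le_qnorm_right {f : V} (hf : f ∈ A₁.toSubmodule) (t : ℝ) :
    K A₀ A₁ t f ≤ ENNReal.ofReal t * ENNReal.ofReal (A₁.qnorm f) := by
  refine (kFunctional_le (f₀ := 0) A₀.toSubmodule.zero_mem hf (by simp)).trans ?_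
  simp [A₀.qnorm_zero]

theorem K_zero (t : ℝ) : K A₀ A₁ t 0 = 0 := by
  simpa [A₀.qnorm_zero] using K_le_qnorm_left A₀ A₁ A₀.toSubmodule.zero_mem t

/-- If `f ≠ 0`, the Hausdorff property gives a neighbourhood `W` of 0 with `f ∉ W + W`; a
decomposition of small cost has both parts in `W`, by the continuity of the embeddings. -/
theorem eq_zero_of_K_eq_zero [IsTopologicalAddGroup V] [T2Space V] {t : ℝ} (ht : 0 < t) {f : V}
    (h : K A₀ A₁ t f = 0) : f = 0 := by
  by_contra hf
  have hU : {x : V | x ≠ f} ∈ 𝓝 (0 : V) := isOpen_ne.mem_nhds (Ne.symm hf)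
  obtain ⟨W, hWo, hW0, hW⟩ := exists_open_nhds_zero_add_subset hU
  have hW' : W ∈ 𝓝 (0 : V) := hWo.mem_nhds hW0
  obtain ⟨δ₀, hδ₀, h₀⟩ := A₀.continuous_embedding W hW'
  obtain ⟨δ₁, hδ₁, h₁⟩ := A₁.continuous_embedding W hW'
  have hpos : 0 < min δ₀ (t * δ₁) := by positivity
  have hlt : K A₀ A₁ t f < ENNReal.ofReal (min δ₀ (t * δ₁)) := by rw [h]; simpa using hpos
  obtain ⟨f₀, hf₀, f₁, hf₁, e, hv⟩ := exists_of_kFunctional_lt hlt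
  have hn₀ := A₀.nonneg f₀ hf₀
  have hn₁ := A₁.nonneg f₁ hf₁
  rw [← ENNReal.ofReal_mul ht.le, ← ENNReal.ofReal_add hn₀ (by positivity),
    ENNReal.ofReal_lt_ofReal_iff hpos, lt_min_iff] at hv
  have hm₀ : f₀ ∈ W := h₀ f₀ hf₀ (by nlinarith [mul_nonneg ht.le hn₁])
  have hm₁ : f₁ ∈ W := h₁ f₁ hf₁ (lt_of_mul_lt_mul_left (by linarith [hv.2]) ht.le)
  exact hW (add_mem_add hm₀ hm₁) e.symm

/-- When `K > 0`, the infimum lies strictly below `2K`. When `K = 0` it need not be attained a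
priori, and the previous lemma forces `f = 0`. -/
theorem exists_near_optimal [IsTopologicalAddGroup V] [T2Space V] {t : ℝ} (ht : 0 < t) {f : V}
    (hf : f ∈ A₀.toSubmodule ⊔ A₁.toSubmodule) :
    ∃ f₀ ∈ A₀.toSubmodule, ∃ f₁ ∈ A₁.toSubmodule, f = f₀ + f₁ ∧
      ENNReal.ofReal (A₀.qnorm f₀) ≤ 2 * K A₀ A₁ t f ∧
      ENNReal.ofReal t * ENNReal.ofReal (A₁.qnorm f₁) ≤ 2 * K A₀ A₁ t f := by
  rcases eq_or_ne (K A₀ A₁ t f) 0 with h | h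
  · obtain rfl := eq_zero_of_K_eq_zero A₀ A₁ ht h
    exact ⟨0, zero_mem _, 0, zero_mem _, by simp, by simp [A₀.qnorm_zero], by simp [A₁.qnorm_zero]⟩
  · have hlt : K A₀ A₁ t f < 2 * K A₀ A₁ t f := by
      rw [two_mul]; exact ENNReal.lt_add_right (K_ne_top A₀ A₁ hf t) h
    obtain ⟨f₀, hf₀, f₁, hf₁, e, hv⟩ := exists_of_kFunctional_lt hlt
    exact ⟨f₀, hf₀, f₁, hf₁, e, le_self_add.trans hv.le, le_add_self.trans hv.le⟩

theorem interpNorm_zero_eq (q : ℝ≥0∞) (b : ℝ → ℝ) (f : V) :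
    interpNorm A₀ A₁ 0 q b f = wNorm q b (Ioi 0) (fun u => K A₀ A₁ u f) := rfl

/-- `K` is non-decreasing in `u`, so its value at `t` can be pulled out of the norm over `(t, ∞)`.
-/
theorem K_mul_tailNorm_le {f : V} (hf : f ∈ A₀.toSubmodule ⊔ A₁.toSubmodule) (q : ℝ≥0∞)
    (b : ℝ → ℝ) (t : ℝ) :
    K A₀ A₁ t f * tailNorm q b t ≤ kNorm A₀ A₁ 0 q b (Ioi t) f := by
  rw [← wNorm_one]
  refine mul_wNorm_le (K_ne_top A₀ A₁ hf t) measurableSet_Ioi fun u hu => ?_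
  rw [mul_one]
  exact K_mono A₀ A₁ f (le_of_lt hu)

end Couple

/-! ### The direct implication. -/

section rho

variable {q₀ q₁ : ℝ≥0∞} {b₀ b₁ : ℝ → ℝ}

theorem rho_mul_tailNorm (hq₁ : q₁ ≠ 0) (hb₁ : SVZero q₁ b₁) {t : ℝ} (ht : 0 < t) :
    rho q₀ q₁ b₀ b₁ t * tailNorm q₁ b₁ t = tailNorm q₀ b₀ t :=
  ENNReal.div_mul_cancel (tailNorm_pos hq₁ hb₁.1 ht).ne' (hb₁.tailNorm_ne_top hq₁ ht)

theorem rho_ne_zero (hq₀ : q₀ ≠ 0) (hq₁ : q₁ ≠ 0) (hb₀ : SVZero q₀ b₀) (hb₁ : SVZero q₁ b₁) {t : ℝ}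
    (ht : 0 < t) : rho q₀ q₁ b₀ b₁ t ≠ 0 :=
  ENNReal.div_ne_zero.2 ⟨(tailNorm_pos hq₀ hb₀.1 ht).ne', hb₁.tailNorm_ne_top hq₁ ht⟩

theorem rho_ne_top (hq₀ : q₀ ≠ 0) (hq₁ : q₁ ≠ 0) (hb₀ : SVZero q₀ b₀) (hb₁ : SVZero q₁ b₁) {t : ℝ}
    (ht : 0 < t) : rho q₀ q₁ b₀ b₁ t ≠ ∞ :=
  ENNReal.div_ne_top (hb₀.tailNorm_ne_top hq₀ ht) (tailNorm_pos hq₁ hb₁.1 ht).ne'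

/-- The upper estimate in the Holmstedt formula holds without any condition on `ρ`. -/
theorem exists_interpK_le {𝕜 V : Type*} [RCLike 𝕜] [AddCommGroup V] [Module 𝕜 V]
    [TopologicalSpace V] [IsTopologicalAddGroup V] [T2Space V]
    (A₀ A₁ : QuasiNormedSubspace 𝕜 V) (hq₀ : q₀ ≠ 0) (hq₁ : q₁ ≠ 0)
    (hb₀ : SVZero q₀ b₀) (hb₁ : SVZero q₁ b₁) :
    ∃ C : ℝ≥0, ∀ (f : V) (t : ℝ), f ∈ A₀.toSubmodule ⊔ A₁.toSubmodule → 0 < t →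
      interpK A₀ A₁ q₀ q₁ b₀ b₁ (rho q₀ q₁ b₀ b₁ t) f ≤
        C * (kNorm A₀ A₁ 0 q₀ b₀ (Ioo 0 t) f +
          rho q₀ q₁ b₀ b₁ t * kNorm A₀ A₁ 0 q₁ b₁ (Ioi t) f) := by
  obtain ⟨C, hC, hadd⟩ := exists_K_add_le A₀ A₁
  obtain ⟨D₀, hD₀⟩ := exists_wNorm_union_le q₀ b₀
  obtain ⟨D₁, hD₁⟩ := exists_wNorm_union_le q₁ b₁
  obtain ⟨E, hE⟩ := exists_wNorm_id_le_tailNorm hq₁ hb₁.1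
  refine ⟨1 + D₀ * (C * 3) + D₀ * 2 + D₁ * (2 * E + C * 3), fun f t hf ht => ?_⟩
  set ρ := rho q₀ q₁ b₀ b₁ t with hρ
  set I := kNorm A₀ A₁ 0 q₀ b₀ (Ioo 0 t) f with hI
  set J := kNorm A₀ A₁ 0 q₁ b₁ (Ioi t) f with hJ
  set κ := K A₀ A₁ t f with hκ
  have hκt : κ ≠ ∞ := K_ne_top A₀ A₁ hf t
  have ht0 : ENNReal.ofReal t ≠ 0 := by simpa using ht
  obtain ⟨f₀, h₀, f₁, h₁, e, hn₀, hn₁⟩ := exists_near_optimal A₀ A₁ ht hf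
  have hn₁' : ∀ u, ENNReal.ofReal u * ENNReal.ofReal (A₁.qnorm f₁) ≤
      2 * κ * (ENNReal.ofReal t)⁻¹ * ENNReal.ofReal u := by
    intro u
    calc ENNReal.ofReal u * ENNReal.ofReal (A₁.qnorm f₁)
        = (ENNReal.ofReal t * (ENNReal.ofReal t)⁻¹) *
          (ENNReal.ofReal u * ENNReal.ofReal (A₁.qnorm f₁)) := by
          rw [ENNReal.mul_inv_cancel ht0 ENNReal.ofReal_ne_top, one_mul]
      _ = (ENNReal.ofReal t * ENNReal.ofReal (A₁.qnorm f₁)) *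
          ((ENNReal.ofReal t)⁻¹ * ENNReal.ofReal u) := by ring
      _ ≤ (2 * κ) * ((ENNReal.ofReal t)⁻¹ * ENNReal.ofReal u) := by gcongr
      _ = _ := by ring
  -- Below `t`, `K(u, f₁) ≤ u ‖f₁‖ ≤ 2 (u/t) K(t, f) ≤ 2 K(u, f)`, and `f₀ = f - f₁`; this gives the
  -- factor 3.
  have hK₀ : ∀ u ∈ Ioo 0 t, K A₀ A₁ u f₀ ≤ (C * 3 : ℝ≥0) * K A₀ A₁ u f := by
    intro u hu
    have e' : f₀ = f + -f₁ := by rw [e]; abel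
    calc K A₀ A₁ u f₀ ≤ C * (K A₀ A₁ u f + K A₀ A₁ u (-f₁)) := by rw [e']; exact hadd _ _ _
      _ ≤ C * (K A₀ A₁ u f + 2 * K A₀ A₁ u f) := by
          gcongr
          refine (K_le_qnorm_right A₀ A₁ (neg_mem h₁) u).trans ?_
          rw [A₁.qnorm_neg h₁]
          refine (hn₁' u).trans ?_
          rw [mul_assoc, mul_assoc]
          gcongr
          have h2 := ofReal_mul_K_le A₀ A₁ hu.1 hu.2.le f
          calc κ * ((ENNReal.ofReal t)⁻¹ * ENNReal.ofReal u)
              = (ENNReal.ofReal t)⁻¹ * (ENNReal.ofReal u * κ) := by ring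
            _ ≤ (ENNReal.ofReal t)⁻¹ * (ENNReal.ofReal t * K A₀ A₁ u f) := by gcongr
            _ = K A₀ A₁ u f := by
                rw [← mul_assoc, ENNReal.inv_mul_cancel ht0 ENNReal.ofReal_ne_top, one_mul]
      _ = _ := by push_cast; ring
  -- Above `t` the roles change: `K(u, f₀) ≤ ‖f₀‖ ≤ 2 K(t, f) ≤ 2 K(u, f)`.
  have hK₁ : ∀ u ∈ Ioi t, K A₀ A₁ u f₁ ≤ (C * 3 : ℝ≥0) * K A₀ A₁ u f := by
    intro u hu
    have e' : f₁ = f + -f₀ := by rw [e]; abel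
    calc K A₀ A₁ u f₁ ≤ C * (K A₀ A₁ u f + K A₀ A₁ u (-f₀)) := by rw [e']; exact hadd _ _ _
      _ ≤ C * (K A₀ A₁ u f + 2 * K A₀ A₁ u f) := by
          gcongr
          refine (K_le_qnorm_left A₀ A₁ (neg_mem h₀) u).trans ?_
          rw [A₀.qnorm_neg h₀]
          refine hn₀.trans ?_
          gcongr
          exact K_mono A₀ A₁ f (le_of_lt hu)
      _ = _ := by push_cast; ring
  have hJκ : κ * tailNorm q₁ b₁ t ≤ J := K_mul_tailNorm_le A₀ A₁ hf q₁ b₁ t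
  -- The choice of `ρ` enters here: the part of the norm of `f₀` beyond `t`, of size `K(t, f)` times
  -- the first tail, is absorbed by `ρ * J`.
  have hρκ : κ * tailNorm q₀ b₀ t ≤ ρ * J := by
    rw [← rho_mul_tailNorm (q₀ := q₀) (b₀ := b₀) hq₁ hb₁ ht]
    calc κ * (ρ * tailNorm q₁ b₁ t) = ρ * (κ * tailNorm q₁ b₁ t) := by ring
      _ ≤ _ := by gcongr
  have hN₀ : interpNorm A₀ A₁ 0 q₀ b₀ f₀ ≤ D₀ * ((C * 3 : ℝ≥0) * I + 2 * (ρ * J)) := by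
    rw [interpNorm_zero_eq, ← Ioc_union_Ioi_eq_Ioi ht.le]
    refine (hD₀ _ _ _ measurableSet_Ioc measurableSet_Ioi).trans ?_
    rw [← wNorm_Ioo_eq_Ioc]
    gcongr
    · exact wNorm_le_mul ENNReal.coe_ne_top measurableSet_Ioo hK₀
    · refine le_trans ?_ (mul_le_mul_right hρκ 2)
      rw [← mul_assoc, ← wNorm_one]
      refine wNorm_le_mul (by finiteness) measurableSet_Ioi fun u _ => ?_
      rw [mul_one]
      exact (K_le_qnorm_left A₀ A₁ h₀ u).trans hn₀
  have hN₁ : interpNorm A₀ A₁ 0 q₁ b₁ f₁ ≤ D₁ * ((2 * E : ℝ≥0) * J + (C * 3 : ℝ≥0) * J) := by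
    rw [interpNorm_zero_eq, ← Ioc_union_Ioi_eq_Ioi ht.le]
    refine (hD₁ _ _ _ measurableSet_Ioc measurableSet_Ioi).trans ?_
    gcongr
    · calc wNorm q₁ b₁ (Ioc 0 t) (fun u => K A₀ A₁ u f₁)
          ≤ (2 * κ * (ENNReal.ofReal t)⁻¹) * wNorm q₁ b₁ (Ioc 0 t) (fun u => ENNReal.ofReal u) := by
            refine wNorm_le_mul (ENNReal.mul_ne_top (by finiteness) (by simpa using ht))
              measurableSet_Ioc fun u _ => ?_
            exact (K_le_qnorm_right A₀ A₁ h₁ u).trans (hn₁' u)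
        _ ≤ (2 * κ * (ENNReal.ofReal t)⁻¹) * (E * (ENNReal.ofReal t * tailNorm q₁ b₁ t)) := by
            gcongr; exact hE t ht
        _ = ((ENNReal.ofReal t)⁻¹ * ENNReal.ofReal t) *
              ((2 * E : ℝ≥0) * (κ * tailNorm q₁ b₁ t)) := by push_cast; ring
        _ ≤ (2 * E : ℝ≥0) * J := by
            rw [ENNReal.inv_mul_cancel ht0 ENNReal.ofReal_ne_top, one_mul]; gcongr
    · exact wNorm_le_mul ENNReal.coe_ne_top measurableSet_Ioi hK₁
  -- If the right side is finite, the two norm bounds show that `f₀` and `f₁` are admissible in the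
  -- interpolation couple.
  rcases eq_or_ne (I + ρ * J) ∞ with htop | hfin
  · rw [htop, ENNReal.mul_top (by
      rw [ENNReal.coe_ne_zero]; positivity)]
    exact le_top
  obtain ⟨hI', hJ'⟩ := ENNReal.add_ne_top.1 hfin
  have hJ'' : J ≠ ∞ := by
    intro h
    rw [h, ENNReal.mul_top (rho_ne_zero hq₀ hq₁ hb₀ hb₁ ht)] at hJ'
    exact hJ' rfl
  have hm₀ : f₀ ∈ interpSpace A₀ A₁ 0 q₀ b₀ :=
    ⟨Submodule.mem_sup_left h₀, hN₀.trans_lt (by finiteness)⟩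
  have hm₁ : f₁ ∈ interpSpace A₀ A₁ 0 q₁ b₁ :=
    ⟨Submodule.mem_sup_right h₁, hN₁.trans_lt (by finiteness)⟩
  calc interpK A₀ A₁ q₀ q₁ b₀ b₁ ρ f
      ≤ interpNorm A₀ A₁ 0 q₀ b₀ f₀ + ρ * interpNorm A₀ A₁ 0 q₁ b₁ f₁ := kFunctional_le hm₀ hm₁ e
    _ ≤ D₀ * ((C * 3 : ℝ≥0) * I + 2 * (ρ * J)) +
          ρ * (D₁ * ((2 * E : ℝ≥0) * J + (C * 3 : ℝ≥0) * J)) := by gcongr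
    _ = (D₀ * (C * 3) : ℝ≥0) * I +
          (D₀ * 2 + D₁ * (2 * E + C * 3) : ℝ≥0) * (ρ * J) := by push_cast; ring
    _ ≤ (1 + D₀ * (C * 3) + D₀ * 2 + D₁ * (2 * E + C * 3) : ℝ≥0) * I +
          (1 + D₀ * (C * 3) + D₀ * 2 + D₁ * (2 * E + C * 3) : ℝ≥0) * (ρ * J) := by
        gcongr
        · rw [add_assoc, add_assoc, add_left_comm]; exact le_self_add
        · exact le_add_self
    _ = _ := by ring

theorem RhoCondition.exists_cross_le (hq₁ : q₁ ≠ 0) (hb₁ : SVZero q₁ b₁)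
    (h : RhoCondition q₀ q₁ b₀ b₁) : ∃ ε : ℝ, 0 < ε ∧ ∃ M : ℝ≥0, ∀ s t, 0 < s → s ≤ t →
      tailNorm q₀ b₀ s ^ (1 + ε) * tailNorm q₁ b₁ t ≤
        M * (tailNorm q₀ b₀ t ^ (1 + ε) * tailNorm q₁ b₁ s) := by
  obtain ⟨ε, hε, g, hg, c, hc, h⟩ := h
  refine ⟨ε, hε, c * c, fun s t hs hst => ?_⟩
  have ht := hs.trans_le hst
  have h1 := (h s hs).1
  have h2 := (h t ht).2
  have h3 : (g s : ℝ≥0∞) ≤ g t := ENNReal.coe_le_coe.2 (hg (mem_Ioi.2 hs) (mem_Ioi.2 ht) hst)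
  simp only [ENNReal.smul_def, smul_eq_mul] at h1 h2
  have h4 : rhoEps ε q₀ q₁ b₀ b₁ s ≤ (c * c : ℝ≥0) * rhoEps ε q₀ q₁ b₀ b₁ t := by
    calc _ ≤ c * (g s : ℝ≥0∞) := h1
      _ ≤ c * (c * rhoEps ε q₀ q₁ b₀ b₁ t) := by gcongr; exact h3.trans h2
      _ = _ := by push_cast; ring
  have e1 : tailNorm q₀ b₀ s ^ (1 + ε) = rhoEps ε q₀ q₁ b₀ b₁ s * tailNorm q₁ b₁ s :=
    (ENNReal.div_mul_cancel (tailNorm_pos hq₁ hb₁.1 hs).ne' (hb₁.tailNorm_ne_top hq₁ hs)).symm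
  have e2 : tailNorm q₀ b₀ t ^ (1 + ε) = rhoEps ε q₀ q₁ b₀ b₁ t * tailNorm q₁ b₁ t :=
    (ENNReal.div_mul_cancel (tailNorm_pos hq₁ hb₁.1 ht).ne' (hb₁.tailNorm_ne_top hq₁ ht)).symm
  rw [e1, e2]
  calc rhoEps ε q₀ q₁ b₀ b₁ s * tailNorm q₁ b₁ s * tailNorm q₁ b₁ t
      ≤ ((c * c : ℝ≥0) * rhoEps ε q₀ q₁ b₀ b₁ t) * tailNorm q₁ b₁ s * tailNorm q₁ b₁ t := by gcongr
    _ = _ := by ring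

theorem inv_le_of_mul_le {a b c d M : ℝ≥0∞} (ha : a ≠ 0) (ha' : a ≠ ∞) (hb : b ≠ 0) (hb' : b ≠ ∞)
    (hd : d ≠ 0) (hd' : d ≠ ∞) (h : a * d ≤ M * (c * b)) : b⁻¹ ≤ M * (c * d⁻¹) * a⁻¹ := by
  calc b⁻¹ = (a * a⁻¹) * (d * d⁻¹) * b⁻¹ := by
        rw [ENNReal.mul_inv_cancel ha ha', ENNReal.mul_inv_cancel hd hd', one_mul, one_mul]
    _ = (a * d) * (a⁻¹ * d⁻¹ * b⁻¹) := by ring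
    _ ≤ (M * (c * b)) * (a⁻¹ * d⁻¹ * b⁻¹) := by gcongr
    _ = M * (c * d⁻¹) * a⁻¹ * (b * b⁻¹) := by ring
    _ = _ := by rw [ENNReal.mul_inv_cancel hb hb', mul_one]

/-- By the cross inequality, `1/T₁(u) ≤ c T₀(u)^(-(1+ε))` for `u < t`, with `c = M T₀(t)^(1+ε) /
T₁(t)`. The norm of this power over `(0, t)` is a multiple of `T₀(t)^(-ε)`, and the product is a
multiple of `ρ(t)`. -/
theorem exists_wNorm_Ioo_le_rho (hq₀ : q₀ ≠ 0) (hq₁ : q₁ ≠ 0)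
    (hb₀ : SVZero q₀ b₀) (hb₁ : SVZero q₁ b₁) (h : RhoCondition q₀ q₁ b₀ b₁) :
    ∃ C : ℝ≥0, ∀ (φ : ℝ → ℝ≥0∞) (n : ℝ≥0∞) (t : ℝ), 0 < t → n ≠ ∞ →
      (∀ u, 0 < u → φ u * tailNorm q₁ b₁ u ≤ n) →
        wNorm q₀ b₀ (Ioo 0 t) φ ≤ C * (rho q₀ q₁ b₀ b₁ t * n) := by
  obtain ⟨ε, hε, M, hM⟩ := h.exists_cross_le hq₁ hb₁
  obtain ⟨C, hC⟩ := exists_wNorm_Ioc_tailNorm_rpow_le hq₀ hb₀ hε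
  refine ⟨M * C, fun φ n t ht hn hφ => ?_⟩
  have hp₀ : ∀ u, 0 < u → tailNorm q₀ b₀ u ≠ 0 := fun u hu => (tailNorm_pos hq₀ hb₀.1 hu).ne'
  have hp₁ : ∀ u, 0 < u → tailNorm q₁ b₁ u ≠ 0 := fun u hu => (tailNorm_pos hq₁ hb₁.1 hu).ne'
  have hf₀ : ∀ u, 0 < u → tailNorm q₀ b₀ u ≠ ∞ := fun u hu => hb₀.tailNorm_ne_top hq₀ hu
  have hf₁ : ∀ u, 0 < u → tailNorm q₁ b₁ u ≠ ∞ := fun u hu => hb₁.tailNorm_ne_top hq₁ hu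
  set c := M * (tailNorm q₀ b₀ t ^ (1 + ε) * (tailNorm q₁ b₁ t)⁻¹) with hc
  have hct : c ≠ ∞ := by
    have h1 : tailNorm q₀ b₀ t ^ (1 + ε) ≠ ∞ :=
      ENNReal.rpow_ne_top_of_nonneg (by linarith) (hf₀ t ht)
    have h2 : (tailNorm q₁ b₁ t)⁻¹ ≠ ∞ := ENNReal.inv_ne_top.2 (hp₁ t ht)
    finiteness
  calc wNorm q₀ b₀ (Ioo 0 t) φ
      ≤ (n * c) * wNorm q₀ b₀ (Ioo 0 t) (fun u => tailNorm q₀ b₀ u ^ (-(1 + ε))) := by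
        refine wNorm_le_mul (by finiteness) measurableSet_Ioo fun u hu => ?_
        calc φ u ≤ n * (tailNorm q₁ b₁ u)⁻¹ := by
              rw [← div_eq_mul_inv, ENNReal.le_div_iff_mul_le (Or.inl (hp₁ u hu.1))
                (Or.inl (hf₁ u hu.1))]
              exact hφ u hu.1
          _ ≤ n * (c * (tailNorm q₀ b₀ u ^ (1 + ε))⁻¹) := by
              gcongr
              refine inv_le_of_mul_le ?_ ?_ (hp₁ u hu.1) (hf₁ u hu.1) (hp₁ t ht) (hf₁ t ht)
                (hM u t hu.1 hu.2.le)
              · exact (ENNReal.rpow_pos (tailNorm_pos hq₀ hb₀.1 hu.1) (hf₀ u hu.1)).ne'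
              · exact ENNReal.rpow_ne_top_of_nonneg (by linarith) (hf₀ u hu.1)
          _ = _ := by rw [ENNReal.rpow_neg, mul_assoc n]
    _ ≤ (n * c) * (C * tailNorm q₀ b₀ t ^ (-ε)) := by
        gcongr
        rw [wNorm_Ioo_eq_Ioc]
        exact hC t ht
    _ = (M * C : ℝ≥0) * (tailNorm q₀ b₀ t ^ (1 + ε) * tailNorm q₀ b₀ t ^ (-ε) *
          (tailNorm q₁ b₁ t)⁻¹ * n) := by rw [hc]; push_cast; ring
    _ = _ := by
        rw [← ENNReal.rpow_add _ _ (hp₀ t ht) (hf₀ t ht), add_neg_cancel_right, ENNReal.rpow_one,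
          rho, div_eq_mul_inv]

theorem exists_rho_mul_wNorm_Ioi_le (hq₀ : q₀ ≠ 0) (hq₁ : q₁ ≠ 0)
    (hb₀ : SVZero q₀ b₀) (hb₁ : SVZero q₁ b₁) (h : RhoCondition q₀ q₁ b₀ b₁) :
    ∃ C : ℝ≥0, ∀ (φ : ℝ → ℝ≥0∞) (n : ℝ≥0∞) (t : ℝ), 0 < t → n ≠ ∞ →
      (∀ u, 0 < u → φ u * tailNorm q₀ b₀ u ≤ n) →
        rho q₀ q₁ b₀ b₁ t * wNorm q₁ b₁ (Ioi t) φ ≤ C * n := by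
  obtain ⟨ε, hε, M, hM⟩ := h.exists_cross_le hq₁ hb₁
  -- Raising the cross inequality to the power `1/(1+ε)` puts the exponent on the second tail; as `a
  -- < 1`, the norm of `T₁^(-a)` over `(t, ∞)` is finite.
  set a : ℝ := (1 + ε)⁻¹ with ha
  have ha0 : 0 < a := by positivity
  have ha1 : a < 1 := inv_lt_one_of_one_lt₀ (by linarith)
  obtain ⟨C, hC⟩ := exists_wNorm_Ioi_tailNorm_rpow_le hq₁ hb₁ ha1
  refine ⟨M ^ a * C, fun φ n t ht hn hφ => ?_⟩
  have hp₀ : ∀ u, 0 < u → tailNorm q₀ b₀ u ≠ 0 := fun u hu => (tailNorm_pos hq₀ hb₀.1 hu).ne'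
  have hp₁ : ∀ u, 0 < u → tailNorm q₁ b₁ u ≠ 0 := fun u hu => (tailNorm_pos hq₁ hb₁.1 hu).ne'
  have hf₀ : ∀ u, 0 < u → tailNorm q₀ b₀ u ≠ ∞ := fun u hu => hb₀.tailNorm_ne_top hq₀ hu
  have hf₁ : ∀ u, 0 < u → tailNorm q₁ b₁ u ≠ ∞ := fun u hu => hb₁.tailNorm_ne_top hq₁ hu
  have hM' : ∀ s u, 0 < s → s ≤ u → tailNorm q₁ b₁ u ^ a * tailNorm q₀ b₀ s ≤
      (M ^ a : ℝ≥0) * (tailNorm q₁ b₁ s ^ a * tailNorm q₀ b₀ u) := by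
    intro s u hs hsu
    have h1 := ENNReal.rpow_le_rpow (hM s u hs hsu) ha0.le
    rw [ENNReal.mul_rpow_of_nonneg _ _ ha0.le, ENNReal.mul_rpow_of_nonneg _ _ ha0.le,
      ENNReal.mul_rpow_of_nonneg _ _ ha0.le, ← ENNReal.rpow_mul, ← ENNReal.rpow_mul, ha,
      mul_inv_cancel₀ (by linarith), ENNReal.rpow_one, ENNReal.rpow_one, ← ha] at h1
    rw [ENNReal.coe_rpow_of_nonneg _ ha0.le, mul_comm (tailNorm q₁ b₁ u ^ a),
      mul_comm (tailNorm q₁ b₁ s ^ a)]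
    exact h1
  set c := (M ^ a : ℝ≥0) * (tailNorm q₁ b₁ t ^ a * (tailNorm q₀ b₀ t)⁻¹) with hc
  have hct : c ≠ ∞ := by
    have h1 : tailNorm q₁ b₁ t ^ a ≠ ∞ := ENNReal.rpow_ne_top_of_nonneg ha0.le (hf₁ t ht)
    have h2 : (tailNorm q₀ b₀ t)⁻¹ ≠ ∞ := ENNReal.inv_ne_top.2 (hp₀ t ht)
    finiteness
  have key : wNorm q₁ b₁ (Ioi t) φ ≤ (n * c) * (C * tailNorm q₁ b₁ t ^ (1 - a)) := by
    refine le_trans (b := (n * c) * wNorm q₁ b₁ (Ioi t) (fun u => tailNorm q₁ b₁ u ^ (-a))) ?_ ?_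
    · refine wNorm_le_mul (by finiteness) measurableSet_Ioi fun u hu => ?_
      have hu0 : 0 < u := ht.trans hu
      calc φ u ≤ n * (tailNorm q₀ b₀ u)⁻¹ := by
            rw [← div_eq_mul_inv, ENNReal.le_div_iff_mul_le (Or.inl (hp₀ u hu0))
              (Or.inl (hf₀ u hu0))]
            exact hφ u hu0
        _ ≤ n * (c * (tailNorm q₁ b₁ u ^ a)⁻¹) := by
            gcongr
            refine inv_le_of_mul_le ?_ ?_ (hp₀ u hu0) (hf₀ u hu0) (hp₀ t ht) (hf₀ t ht)
              (hM' t u ht (le_of_lt hu))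
            · exact (ENNReal.rpow_pos (tailNorm_pos hq₁ hb₁.1 hu0) (hf₁ u hu0)).ne'
            · exact ENNReal.rpow_ne_top_of_nonneg ha0.le (hf₁ u hu0)
        _ = _ := by rw [ENNReal.rpow_neg, mul_assoc n]
    · gcongr
      exact hC t ht
  calc rho q₀ q₁ b₀ b₁ t * wNorm q₁ b₁ (Ioi t) φ
      ≤ rho q₀ q₁ b₀ b₁ t * ((n * c) * (C * tailNorm q₁ b₁ t ^ (1 - a))) := by gcongr
    _ = (M ^ a * C : ℝ≥0) * n * (rho q₀ q₁ b₀ b₁ t * (tailNorm q₁ b₁ t ^ a *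
          tailNorm q₁ b₁ t ^ (1 - a)) * (tailNorm q₀ b₀ t)⁻¹) := by rw [hc]; push_cast; ring
    _ = _ := by
        rw [← ENNReal.rpow_add _ _ (hp₁ t ht) (hf₁ t ht), add_sub_cancel, ENNReal.rpow_one,
          rho_mul_tailNorm hq₁ hb₁ ht, ENNReal.mul_inv_cancel (hp₀ t ht) (hf₀ t ht), mul_one]

theorem RhoCondition.holmstedtFormula {𝕜 V : Type*} [RCLike 𝕜] [AddCommGroup V] [Module 𝕜 V]
    [TopologicalSpace V] [IsTopologicalAddGroup V] [T2Space V]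
    (A₀ A₁ : QuasiNormedSubspace 𝕜 V) (hq₀ : q₀ ≠ 0) (hq₁ : q₁ ≠ 0)
    (hb₀ : SVZero q₀ b₀) (hb₁ : SVZero q₁ b₁) (h : RhoCondition q₀ q₁ b₀ b₁) :
    HolmstedtFormula A₀ A₁ q₀ q₁ b₀ b₁ := by
  obtain ⟨c₁, hc₁⟩ := exists_interpK_le A₀ A₁ hq₀ hq₁ hb₀ hb₁
  obtain ⟨C, hC, hadd⟩ := exists_K_add_le A₀ A₁
  obtain ⟨D₀, hD₀⟩ := exists_wNorm_add_le q₀ hb₀.1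
  obtain ⟨D₁, hD₁⟩ := exists_wNorm_add_le q₁ hb₁.1
  obtain ⟨E₀, hE₀⟩ := exists_wNorm_Ioo_le_rho hq₀ hq₁ hb₀ hb₁ h
  obtain ⟨E₁, hE₁⟩ := exists_rho_mul_wNorm_Ioi_le hq₀ hq₁ hb₀ hb₁ h
  set c₂ : ℝ≥0 := C * D₀ * (1 + E₀) + C * D₁ * (1 + E₁) with hc₂
  refine ⟨1 + c₁ + c₂, by positivity, ?_⟩
  rintro ⟨f, t⟩ ⟨hf, ht⟩
  simp only at hf ht
  simp only [ENNReal.smul_def, smul_eq_mul]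
  constructor
  · refine (hc₁ f t hf ht).trans ?_
    gcongr
    rw [add_assoc, add_left_comm]
    exact le_self_add
  refine le_mul_kFunctional (by rw [ENNReal.coe_ne_zero]; positivity) ENNReal.coe_ne_top
    fun f₀ h₀ f₁ h₁ e => ?_
  set ρ := rho q₀ q₁ b₀ b₁ t with hρ
  set n₀ := interpNorm A₀ A₁ 0 q₀ b₀ f₀ with hn₀
  set n₁ := interpNorm A₀ A₁ 0 q₁ b₁ f₁ with hn₁
  have hK : ∀ u, K A₀ A₁ u f ≤ C * (K A₀ A₁ u f₀ + K A₀ A₁ u f₁) := fun u => by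
    rw [e]; exact hadd u f₀ f₁
  have hsplit : ∀ (q : ℝ≥0∞) (b : ℝ → ℝ) (D : ℝ≥0) (E : Set ℝ), MeasurableSet E →
      wNorm q b E (fun u => K A₀ A₁ u f₀ + K A₀ A₁ u f₁) ≤
        D * (wNorm q b E (fun u => K A₀ A₁ u f₀) + wNorm q b E (fun u => K A₀ A₁ u f₁)) →
      kNorm A₀ A₁ 0 q b E f ≤ (C * D : ℝ≥0) * (wNorm q b E (fun u => K A₀ A₁ u f₀) +
        wNorm q b E (fun u => K A₀ A₁ u f₁)) := by
    intro q b D E hE hD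
    refine (wNorm_le_mul ENNReal.coe_ne_top hE fun u _ => hK u).trans ?_
    push_cast
    rw [mul_assoc]
    gcongr
  have hI := hsplit q₀ b₀ D₀ (Ioo 0 t) measurableSet_Ioo (hD₀ _ _ _ Ioo_subset_Ioi_self
    (K_mono A₀ A₁ f₀).measurable (K_mono A₀ A₁ f₁).measurable)
  have hJ := hsplit q₁ b₁ D₁ (Ioi t) measurableSet_Ioi (hD₁ _ _ _ (Ioi_subset_Ioi ht.le)
    (K_mono A₀ A₁ f₀).measurable (K_mono A₀ A₁ f₁).measurable)
  have hI₁ : wNorm q₀ b₀ (Ioo 0 t) (fun u => K A₀ A₁ u f₁) ≤ E₀ * (ρ * n₁) :=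
    hE₀ _ _ t ht h₁.2.ne fun u hu => (K_mul_tailNorm_le A₀ A₁ h₁.1 q₁ b₁ u).trans
      (wNorm_mono_set (Ioi_subset_Ioi hu.le) _)
  have hJ₀ : ρ * wNorm q₁ b₁ (Ioi t) (fun u => K A₀ A₁ u f₀) ≤ E₁ * n₀ :=
    hE₁ _ _ t ht h₀.2.ne fun u hu => (K_mul_tailNorm_le A₀ A₁ h₀.1 q₀ b₀ u).trans
      (wNorm_mono_set (Ioi_subset_Ioi hu.le) _)
  have hI₀ : wNorm q₀ b₀ (Ioo 0 t) (fun u => K A₀ A₁ u f₀) ≤ n₀ :=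
    wNorm_mono_set Ioo_subset_Ioi_self _
  have hJ₁ : wNorm q₁ b₁ (Ioi t) (fun u => K A₀ A₁ u f₁) ≤ n₁ :=
    wNorm_mono_set (Ioi_subset_Ioi ht.le) _
  calc kNorm A₀ A₁ 0 q₀ b₀ (Ioo 0 t) f + ρ * kNorm A₀ A₁ 0 q₁ b₁ (Ioi t) f
      ≤ (C * D₀ : ℝ≥0) * (n₀ + E₀ * (ρ * n₁)) + ρ * ((C * D₁ : ℝ≥0) *
          (wNorm q₁ b₁ (Ioi t) (fun u => K A₀ A₁ u f₀) + n₁)) := by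
        gcongr
        · exact hI.trans (by gcongr)
        · exact hJ.trans (by gcongr)
    _ = (C * D₀ : ℝ≥0) * (n₀ + E₀ * (ρ * n₁)) + (C * D₁ : ℝ≥0) *
          (ρ * wNorm q₁ b₁ (Ioi t) (fun u => K A₀ A₁ u f₀) + ρ * n₁) := by ring
    _ ≤ (C * D₀ : ℝ≥0) * (n₀ + E₀ * (ρ * n₁)) + (C * D₁ : ℝ≥0) * (E₁ * n₀ + ρ * n₁) := by gcongr
    -- Non-negative terms are added so that the total is exactly the chosen constant times `n₀ + ρ *
    -- n₁`.
    _ ≤ (C * D₀ : ℝ≥0) * (n₀ + E₀ * (ρ * n₁)) + (C * D₁ : ℝ≥0) * (E₁ * n₀ + ρ * n₁) +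
          ((1 + c₁ + C * D₀ * E₀ + C * D₁ : ℝ≥0) * n₀ +
            (1 + c₁ + C * D₀ + C * D₁ * E₁ : ℝ≥0) * (ρ * n₁)) := le_self_add
    _ = _ := by rw [hc₂]; push_cast; ring

end rho

/-! ### Quasi-concave functions and uniform constants. -/

section QuasiConcave

theorem QuasiConcave.of_mul_le {φ : ℝ → ℝ} (h0 : ∀ t, 0 < t → 0 < φ t)
    (h1 : ∀ s t, 0 < s → s ≤ t → φ s ≤ φ t) (h2 : ∀ s t, 0 < s → s ≤ t → s * φ t ≤ t * φ s) :
    QuasiConcave φ := by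
  refine ⟨h0, fun s hs t _ hst => h1 s t hs hst, fun s hs t ht hst => ?_⟩
  have hs' : 0 < s := hs
  have ht' : 0 < t := ht
  have h := h2 (1 / t) (1 / s) (by positivity) (one_div_le_one_div_of_le hs' hst)
  have h3 := mul_le_mul_of_nonneg_left h (mul_pos hs' ht').le
  calc s * φ (1 / s) = s * t * (1 / t * φ (1 / s)) := by field_simp
    _ ≤ s * t * (1 / s * φ (1 / t)) := h3
    _ = t * φ (1 / t) := by field_simp

theorem QuasiConcave.mul_le {φ : ℝ → ℝ} (h : QuasiConcave φ) {s t : ℝ} (hs : 0 < s)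
    (hst : s ≤ t) : s * φ t ≤ t * φ s := by
  have ht := hs.trans_le hst
  have h1 := h.monotone_transpose (show 1 / t ∈ Ioi 0 from by simpa using ht)
    (show 1 / s ∈ Ioi 0 from by simpa using hs) (one_div_le_one_div_of_le hs hst)
  simp only [one_div_one_div] at h1
  have h3 := mul_le_mul_of_nonneg_left h1 (mul_pos hs ht).le
  calc s * φ t = s * t * (1 / t * φ t) := by field_simp
    _ ≤ s * t * (1 / s * φ s) := h3
    _ = t * φ s := by field_simp

theorem quasiConcave_min_one_div {s : ℝ} (hs : 0 < s) : QuasiConcave (fun u => min 1 (u / s)) := by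
  refine .of_mul_le (fun t ht => by positivity) (fun a t _ hat => by gcongr) fun a t ha hat => ?_
  have ht := ha.trans_le hat
  rw [mul_min_of_nonneg _ _ ha.le, mul_min_of_nonneg _ _ ht.le]
  refine min_le_min (by linarith) (le_of_eq (by ring))

/-- A majorant of a sequence in the unit ball scaled by `2 ^ (-n)` has finite norm. -/
theorem wNorm_iSup_lt_top {q : ℝ≥0∞} {b : ℝ → ℝ} (hq : q ≠ 0) (hb : SlowlyVarying b)
    {ψ : ℕ → ℝ → ℝ≥0∞} (hm : ∀ n, AEMeasurable (ψ n) (volume.restrict (Ioi 0)))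
    (h : ∀ n, wNorm q b (Ioi 0) (ψ n) ≤ 2⁻¹ ^ n) :
    wNorm q b (Ioi 0) (fun u => ⨆ n, ψ n u) < ∞ := by
  rcases eq_or_ne q ∞ with rfl | ht
  · refine lt_of_le_of_lt ?_ ENNReal.one_lt_top
    rw [wNorm, eLpNorm_exponent_top]
    refine eLpNormEssSup_le_of_ae_enorm_bound ?_
    have h1 : ∀ n, ∀ᵐ u ∂volume.restrict (Ioi 0), weight 0 ∞ b u * ψ n u ≤ 1 := by
      intro n
      have h2 := h n
      rw [wNorm, eLpNorm_exponent_top] at h2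
      filter_upwards [ae_le_eLpNormEssSup (f := fun u => weight 0 ∞ b u * ψ n u)
        (μ := volume.restrict (Ioi 0))] with u hu
      rw [enorm_eq_self] at hu
      exact hu.trans (h2.trans (pow_le_one₀ zero_le (by simp)))
    filter_upwards [ae_all_iff.2 h1] with u hu
    rw [enorm_eq_self, ENNReal.mul_iSup]
    exact iSup_le hu
  · have hr := ENNReal.toReal_pos hq ht
    set r := q.toReal with hrdef
    have h1 : ∀ n, ∫⁻ u in Ioi 0, weight 0 q b u ^ r * ψ n u ^ r ≤ ((2⁻¹ : ℝ≥0∞) ^ r) ^ n := by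
      intro n
      have h2 := ENNReal.rpow_le_rpow (h n) hr.le
      rw [wNorm_rpow hq ht, ← hrdef, ← ENNReal.rpow_mul, one_div_mul_cancel hr.ne',
        ENNReal.rpow_one, ← ENNReal.rpow_natCast, ← ENNReal.rpow_mul, mul_comm (n : ℝ),
        ENNReal.rpow_mul, ENNReal.rpow_natCast] at h2
      exact h2
    rw [wNorm_rpow hq ht, ← hrdef]
    refine ENNReal.rpow_lt_top_of_nonneg (by positivity) (ne_top_of_le_ne_top ?_ (calc
      ∫⁻ u in Ioi 0, weight 0 q b u ^ r * (⨆ n, ψ n u) ^ r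
        -- A power of a supremum is bounded by the sum of the powers, so a geometric series suffices
        -- even when `q < 1`.
        ≤ ∫⁻ u in Ioi 0, ∑' n, weight 0 q b u ^ r * ψ n u ^ r := by
          refine lintegral_mono fun u => ?_
          have e : (⨆ n, ψ n u) ^ r = ⨆ n, ψ n u ^ r :=
            (ENNReal.orderIsoRpow r hr).map_iSup (ψ · u)
          rw [e, ENNReal.mul_iSup]
          exact iSup_le fun n => ENNReal.le_tsum n
      _ = ∑' n, ∫⁻ u in Ioi 0, weight 0 q b u ^ r * ψ n u ^ r :=
          lintegral_tsum fun n => ((hb.aemeasurable_weight q).pow_const _).mul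
            ((hm n).pow_const _)
      _ ≤ ∑' n : ℕ, ((2⁻¹ : ℝ≥0∞) ^ r) ^ n := ENNReal.tsum_le_tsum h1))
    rw [ENNReal.tsum_geometric]
    refine ENNReal.inv_ne_top.2 (tsub_pos_of_lt ?_).ne'
    exact ENNReal.rpow_lt_one (by simp) hr

theorem QuasiConcave.aemeasurable {φ : ℝ → ℝ} (h : QuasiConcave φ) :
    AEMeasurable (fun u => ENNReal.ofReal (φ u)) (volume.restrict (Ioi 0)) :=
  (aemeasurable_restrict_of_monotoneOn measurableSet_Ioi h.monotone).ennreal_ofReal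

/-- `φ(t) ‖u ^ (-1/q) b(u)‖ ≤ ‖u ^ (-1/q) b(u) φ(u)‖` for non-decreasing `φ`. -/
theorem mul_tailNorm_le_wNorm {φ : ℝ → ℝ≥0∞} {q : ℝ≥0∞} {b : ℝ → ℝ} {t : ℝ}
    (ht : 0 ≤ t) (h : ∀ u, t < u → φ t ≤ φ u) (hfin : φ t ≠ ∞) :
    φ t * tailNorm q b t ≤ wNorm q b (Ioi 0) φ := by
  rw [← wNorm_one]
  refine le_trans ?_ (wNorm_mono_set (Ioi_subset_Ioi ht) _)
  exact mul_wNorm_le hfin measurableSet_Ioi fun u hu => by simpa using h u hu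

/-- A family of weighted inequalities that holds for every quasi-concave function, with constants
that may depend on the function, holds with a uniform constant. -/
theorem exists_uniform_bound {p q : ℝ≥0∞} {b c : ℝ → ℝ} (hq : q ≠ 0) (hb : SlowlyVarying b)
    (a : ℝ → ℝ≥0∞) (E : ℝ → Set ℝ) (hE : ∀ t, MeasurableSet (E t))
    (hE0 : ∀ t, 0 < t → E t ⊆ Ioi 0)
    (h : ∀ φ : ℝ → ℝ, QuasiConcave φ → wNorm q b (Ioi 0) (fun u => ENNReal.ofReal (φ u)) < ∞ →
      ∃ k : ℝ≥0, ∀ t, 0 < t → a t * wNorm p c (E t) (fun u => ENNReal.ofReal (φ u)) ≤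
        k * wNorm q b (Ioi 0) (fun u => ENNReal.ofReal (φ u))) :
    ∃ k : ℝ≥0, ∀ φ : ℝ → ℝ, QuasiConcave φ →
      wNorm q b (Ioi 0) (fun u => ENNReal.ofReal (φ u)) < ∞ → ∀ t, 0 < t →
        a t * wNorm p c (E t) (fun u => ENNReal.ofReal (φ u)) ≤
          k * wNorm q b (Ioi 0) (fun u => ENNReal.ofReal (φ u)) := by
  -- Gliding hump: take `φ n` violating the bound with constant `4 ^ n` and weight it so that its
  -- norm is at most `2 ^ (-n)`. The weighted supremum is again quasi-concave of finite norm, yet it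
  -- violates the bound by `2 ^ n` for every `n`.
  by_contra! hcon
  choose φ hφ hfin t ht hlt using fun n : ℕ => hcon (4 ^ n)
  set m : ℕ → ℝ≥0∞ := fun n => wNorm q b (Ioi 0) (fun u => ENNReal.ofReal (φ n u)) with hm
  have hm0 : ∀ n, m n ≠ 0 := by
    intro n h0
    have h1 := mul_tailNorm_le_wNorm (φ := fun u => ENNReal.ofReal (φ n u)) (q := q) (b := b)
      zero_le_one (fun u hu => ENNReal.ofReal_le_ofReal
        ((hφ n).monotone (mem_Ioi.2 one_pos) (mem_Ioi.2 (one_pos.trans hu)) hu.le))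
      ENNReal.ofReal_ne_top
    have h2 : m n = wNorm q b (Ioi 0) (fun u => ENNReal.ofReal (φ n u)) := rfl
    rw [← h2, h0, nonpos_iff_eq_zero, mul_eq_zero, ENNReal.ofReal_eq_zero] at h1
    rcases h1 with h1 | h1
    · exact absurd ((hφ n).pos 1 one_pos) (not_lt.2 h1)
    · exact (tailNorm_pos hq hb one_pos).ne' h1
  have hmt : ∀ n, m n ≠ ∞ := fun n => (hfin n).ne
  set w : ℕ → ℝ≥0∞ := fun n => 2⁻¹ ^ n * (m n)⁻¹ with hw
  have hwt : ∀ n, w n ≠ ∞ := fun n =>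
    ENNReal.mul_ne_top (by finiteness) (ENNReal.inv_ne_top.2 (hm0 n))
  have hw0 : ∀ n, w n ≠ 0 := fun n =>
    mul_ne_zero (by simp) (ENNReal.inv_ne_zero.2 (hmt n))
  set Φ : ℝ → ℝ≥0∞ := fun u => ⨆ n, w n * ENNReal.ofReal (φ n u) with hΦ
  have hΦfin : wNorm q b (Ioi 0) Φ < ∞ := by
    refine wNorm_iSup_lt_top hq hb (fun n => (hφ n).aemeasurable.const_mul _) fun n => ?_
    refine (wNorm_const_mul_le (hwt n) _).trans (le_of_eq ?_)
    rw [hw, mul_assoc]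
    exact (congrArg _ (ENNReal.inv_mul_cancel (hm0 n) (hmt n))).trans (mul_one _)
  have hΦmono : ∀ s u, 0 < s → s ≤ u → Φ s ≤ Φ u := fun s u hs hsu => by
    refine iSup_mono fun n => ?_
    gcongr
    exact (hφ n).monotone (mem_Ioi.2 hs) (mem_Ioi.2 (hs.trans_le hsu)) hsu
  have hΦmul : ∀ s u, 0 < s → s ≤ u → ENNReal.ofReal s * Φ u ≤ ENNReal.ofReal u * Φ s := by
    intro s u hs hsu
    simp only [hΦ, ENNReal.mul_iSup]
    refine iSup_mono fun n => ?_
    rw [mul_left_comm, mul_left_comm (ENNReal.ofReal u), ← ENNReal.ofReal_mul hs.le,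
      ← ENNReal.ofReal_mul (hs.trans_le hsu).le]
    exact mul_le_mul_right (ENNReal.ofReal_le_ofReal ((hφ n).mul_le hs hsu)) _
  -- An infinite value at `u` would persist to the right of `u`, and the positive tail would make
  -- the norm infinite.
  have hΦtop : ∀ u, 0 < u → Φ u ≠ ∞ := by
    intro u hu htop
    have h1 : ∀ K : ℝ≥0, K * tailNorm q b u ≤ wNorm q b (Ioi 0) Φ := by
      intro K
      rw [← wNorm_one]
      refine le_trans ?_ (wNorm_mono_set (Ioi_subset_Ioi hu.le) _)
      refine mul_wNorm_le ENNReal.coe_ne_top measurableSet_Ioi fun v hv => ?_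
      have := hΦmono u v hu (le_of_lt hv)
      rw [htop, top_le_iff] at this
      simp [this]
    obtain ⟨K, hK⟩ := ENNReal.exists_nat_mul_gt (tailNorm_pos hq hb hu).ne' hΦfin.ne
    exact absurd (h1 K) (not_le.2 (by exact_mod_cast hK))
  have hle : ∀ n u, w n * ENNReal.ofReal (φ n u) ≤ Φ u := fun n u =>
    le_iSup (fun n => w n * ENNReal.ofReal (φ n u)) n
  have hΦpos : ∀ u, 0 < u → Φ u ≠ 0 := fun u hu h0 => by
    have := hle 0 u
    rw [h0, nonpos_iff_eq_zero, mul_eq_zero, ENNReal.ofReal_eq_zero] at this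
    rcases this with h1 | h1
    · exact hw0 0 h1
    · exact absurd ((hφ 0).pos u hu) (not_lt.2 h1)
  have hqc : QuasiConcave (fun u => (Φ u).toReal) := by
    refine .of_mul_le (fun u hu => ENNReal.toReal_pos (hΦpos u hu) (hΦtop u hu))
      (fun s u hs hsu => ENNReal.toReal_mono (hΦtop u (hs.trans_le hsu)) (hΦmono s u hs hsu))
      fun s u hs hsu => ?_
    have h1 := ENNReal.toReal_mono (ENNReal.mul_ne_top ENNReal.ofReal_ne_top (hΦtop s hs))
      (hΦmul s u hs hsu)
    rwa [ENNReal.toReal_mul, ENNReal.toReal_mul, ENNReal.toReal_ofReal hs.le,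
      ENNReal.toReal_ofReal (hs.trans_le hsu).le] at h1
  have hofReal : ∀ u, 0 < u → ENNReal.ofReal (Φ u).toReal = Φ u := fun u hu =>
    ENNReal.ofReal_toReal (hΦtop u hu)
  have hN : wNorm q b (Ioi 0) (fun u => ENNReal.ofReal (Φ u).toReal) < ∞ :=
    (wNorm_mono measurableSet_Ioi fun u hu => (hofReal u hu).le).trans_lt hΦfin
  obtain ⟨k, hk⟩ := h _ hqc hN
  have hB : ∀ n : ℕ, (2 : ℝ≥0∞) ^ n ≤
      k * wNorm q b (Ioi 0) (fun u => ENNReal.ofReal (Φ u).toReal) := by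
    intro n
    refine le_trans ?_ (hk (t n) (ht n))
    have h1 : w n * wNorm p c (E (t n)) (fun u => ENNReal.ofReal (φ n u)) ≤
        wNorm p c (E (t n)) (fun u => ENNReal.ofReal (Φ u).toReal) := by
      refine mul_wNorm_le (hwt n) (hE _) fun u hu => ?_
      rw [hofReal u (hE0 _ (ht n) hu)]
      exact hle n u
    calc (2 : ℝ≥0∞) ^ n = w n * ((4 ^ n : ℝ≥0) * m n) := by
          have e4 : ((4 ^ n : ℝ≥0) : ℝ≥0∞) = 2 ^ n * 2 ^ n := by
            push_cast; rw [← mul_pow]; norm_num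
          rw [hw, e4]
          calc (2 : ℝ≥0∞) ^ n = 2 ^ n * (2⁻¹ ^ n * 2 ^ n) * ((m n)⁻¹ * m n) := by
                rw [ENNReal.inv_mul_cancel (hm0 n) (hmt n), ← mul_pow,
                  ENNReal.inv_mul_cancel (by norm_num) (by norm_num), one_pow, mul_one, mul_one]
            _ = _ := by ring
      _ ≤ w n * (a (t n) * wNorm p c (E (t n)) (fun u => ENNReal.ofReal (φ n u))) :=
          mul_le_mul_right (hlt n).le _
      _ = a (t n) * (w n * wNorm p c (E (t n)) (fun u => ENNReal.ofReal (φ n u))) := by ring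
      _ ≤ _ := by gcongr
  have hBt : (k : ℝ≥0∞) * wNorm q b (Ioi 0) (fun u => ENNReal.ofReal (Φ u).toReal) ≠ ∞ :=
    ENNReal.mul_ne_top ENNReal.coe_ne_top hN.ne
  obtain ⟨n, hn⟩ := ENNReal.exists_nat_gt hBt
  refine absurd ((hB n).trans_lt hn) (not_lt.2 ?_)
  exact_mod_cast n.lt_two_pow_self.le

end QuasiConcave

/-! ### Weighted inequalities extracted from the formula. -/

section fromFormula

variable {𝕜 V : Type*} [RCLike 𝕜] [AddCommGroup V] [Module 𝕜 V] [TopologicalSpace V]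
  {A₀ A₁ : QuasiNormedSubspace 𝕜 V} {q₀ q₁ : ℝ≥0∞} {b₀ b₁ : ℝ → ℝ}

theorem zero_mem_interpSpace (A₀ A₁ : QuasiNormedSubspace 𝕜 V) (q : ℝ≥0∞) (b : ℝ → ℝ) :
    (0 : V) ∈ interpSpace A₀ A₁ 0 q b ∧ interpNorm A₀ A₁ 0 q b 0 = 0 := by
  have h : interpNorm A₀ A₁ 0 q b 0 = 0 := by
    rw [interpNorm_zero_eq, wNorm]
    simp only [K_zero, mul_zero]
    exact eLpNorm_zero'
  exact ⟨⟨zero_mem _, by rw [h]; exact ENNReal.zero_lt_top⟩, h⟩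

theorem KSurjective.exists_wNorm_equiv (h : KSurjective A₀ A₁) {φ : ℝ → ℝ} (hφ : QuasiConcave φ) :
    ∃ f ∈ A₀.toSubmodule ⊔ A₁.toSubmodule, ∃ k : ℝ≥0, ∀ (q : ℝ≥0∞) (b : ℝ → ℝ) (E : Set ℝ),
      MeasurableSet E → E ⊆ Ioi 0 →
        wNorm q b E (fun u => ENNReal.ofReal (φ u)) ≤ k * kNorm A₀ A₁ 0 q b E f ∧
        kNorm A₀ A₁ 0 q b E f ≤ k * wNorm q b E (fun u => ENNReal.ofReal (φ u)) := by
  obtain ⟨f, hf, k, -, hk⟩ := h φ hφ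
  exact ⟨f, hf, k, fun q b E hE hE0 =>
    ⟨wNorm_le_mul ENNReal.coe_ne_top hE fun u hu => (hk u (hE0 hu)).1,
      wNorm_le_mul ENNReal.coe_ne_top hE fun u hu => (hk u (hE0 hu)).2⟩⟩

/-- With `f` in the second space, the decomposition `f = 0 + f` bounds the left side of the formula
by `ρ(t) ‖f‖`; only the term `I` is kept on the right. -/
theorem HolmstedtFormula.exists_wNorm_Ioo_le (hq₀ : q₀ ≠ 0) (hq₁ : q₁ ≠ 0)
    (hb₀ : SVZero q₀ b₀) (hb₁ : SVZero q₁ b₁)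
    (hs : KSurjective A₀ A₁) (hH : HolmstedtFormula A₀ A₁ q₀ q₁ b₀ b₁) :
    ∃ k : ℝ≥0, ∀ φ : ℝ → ℝ, QuasiConcave φ →
      wNorm q₁ b₁ (Ioi 0) (fun u => ENNReal.ofReal (φ u)) < ∞ → ∀ t, 0 < t →
        (rho q₀ q₁ b₀ b₁ t)⁻¹ * wNorm q₀ b₀ (Ioo 0 t) (fun u => ENNReal.ofReal (φ u)) ≤
          k * wNorm q₁ b₁ (Ioi 0) (fun u => ENNReal.ofReal (φ u)) := by
  refine exists_uniform_bound hq₁ hb₁.1 _ _ (fun _ => measurableSet_Ioo)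
    (fun _ _ => Ioo_subset_Ioi_self) fun φ hφ hfin => ?_
  obtain ⟨f, hf, k, hk⟩ := hs.exists_wNorm_equiv hφ
  obtain ⟨c, -, hc⟩ := hH
  refine ⟨k * c * k, fun t ht => ?_⟩
  have h1 := (hc (f, t) ⟨hf, ht⟩).2
  simp only [ENNReal.smul_def, smul_eq_mul] at h1
  have hn := (hk q₁ b₁ (Ioi 0) measurableSet_Ioi subset_rfl).2
  have hm : f ∈ interpSpace A₀ A₁ 0 q₁ b₁ := ⟨hf, hn.trans_lt (by finiteness)⟩
  obtain ⟨hz, hz'⟩ := zero_mem_interpSpace A₀ A₁ q₀ b₀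
  have h2 : interpK A₀ A₁ q₀ q₁ b₀ b₁ (rho q₀ q₁ b₀ b₁ t) f ≤
      rho q₀ q₁ b₀ b₁ t * kNorm A₀ A₁ 0 q₁ b₁ (Ioi 0) f := by
    refine (kFunctional_le hz hm (by simp)).trans ?_
    rw [hz', zero_add]; rfl
  calc (rho q₀ q₁ b₀ b₁ t)⁻¹ * wNorm q₀ b₀ (Ioo 0 t) (fun u => ENNReal.ofReal (φ u))
      ≤ (rho q₀ q₁ b₀ b₁ t)⁻¹ * (k * kNorm A₀ A₁ 0 q₀ b₀ (Ioo 0 t) f) := by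
        gcongr; exact (hk q₀ b₀ _ measurableSet_Ioo Ioo_subset_Ioi_self).1
    _ ≤ (rho q₀ q₁ b₀ b₁ t)⁻¹ * (k * (c * (rho q₀ q₁ b₀ b₁ t *
          (k * wNorm q₁ b₁ (Ioi 0) (fun u => ENNReal.ofReal (φ u)))))) := by
        gcongr
        refine le_self_add.trans (h1.trans ?_)
        gcongr
        exact h2.trans (by gcongr)
    _ = ((rho q₀ q₁ b₀ b₁ t)⁻¹ * rho q₀ q₁ b₀ b₁ t) * ((k * c * k : ℝ≥0) *
          wNorm q₁ b₁ (Ioi 0) (fun u => ENNReal.ofReal (φ u))) := by push_cast; ring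
    _ = _ := by
        rw [ENNReal.inv_mul_cancel (rho_ne_zero hq₀ hq₁ hb₀ hb₁ ht)
          (rho_ne_top hq₀ hq₁ hb₀ hb₁ ht), one_mul]

/-- The symmetric case `f = f + 0`, keeping `ρ J`. The truncation `max t 0` equals `t` for every `t`
in question. -/
theorem HolmstedtFormula.exists_rho_mul_wNorm_Ioi_le (hq₀ : q₀ ≠ 0) (hb₀ : SVZero q₀ b₀)
    (hs : KSurjective A₀ A₁) (hH : HolmstedtFormula A₀ A₁ q₀ q₁ b₀ b₁) :
    ∃ k : ℝ≥0, ∀ φ : ℝ → ℝ, QuasiConcave φ →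
      wNorm q₀ b₀ (Ioi 0) (fun u => ENNReal.ofReal (φ u)) < ∞ → ∀ t, 0 < t →
        rho q₀ q₁ b₀ b₁ t * wNorm q₁ b₁ (Ioi (max t 0)) (fun u => ENNReal.ofReal (φ u)) ≤
          k * wNorm q₀ b₀ (Ioi 0) (fun u => ENNReal.ofReal (φ u)) := by
  refine exists_uniform_bound hq₀ hb₀.1 _ _ (fun _ => measurableSet_Ioi)
    (fun t _ => Ioi_subset_Ioi (le_max_right t 0)) fun φ hφ hfin => ?_
  obtain ⟨f, hf, k, hk⟩ := hs.exists_wNorm_equiv hφ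
  obtain ⟨c, -, hc⟩ := hH
  refine ⟨k * c * k, fun t ht => ?_⟩
  have h1 := (hc (f, t) ⟨hf, ht⟩).2
  simp only [ENNReal.smul_def, smul_eq_mul] at h1
  have hn := (hk q₀ b₀ (Ioi 0) measurableSet_Ioi subset_rfl).2
  have hm : f ∈ interpSpace A₀ A₁ 0 q₀ b₀ := ⟨hf, hn.trans_lt (by finiteness)⟩
  obtain ⟨hz, hz'⟩ := zero_mem_interpSpace A₀ A₁ q₁ b₁
  have h2 : interpK A₀ A₁ q₀ q₁ b₀ b₁ (rho q₀ q₁ b₀ b₁ t) f ≤ kNorm A₀ A₁ 0 q₀ b₀ (Ioi 0) f := by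
    refine (kFunctional_le hm hz (by simp)).trans ?_
    rw [hz', mul_zero, add_zero]; rfl
  rw [max_eq_left ht.le]
  calc rho q₀ q₁ b₀ b₁ t * wNorm q₁ b₁ (Ioi t) (fun u => ENNReal.ofReal (φ u))
      ≤ rho q₀ q₁ b₀ b₁ t * (k * kNorm A₀ A₁ 0 q₁ b₁ (Ioi t) f) := by
        gcongr; exact (hk q₁ b₁ _ measurableSet_Ioi (Ioi_subset_Ioi ht.le)).1
    _ = k * (rho q₀ q₁ b₀ b₁ t * kNorm A₀ A₁ 0 q₁ b₁ (Ioi t) f) := by ring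
    _ ≤ k * (c * (k * wNorm q₀ b₀ (Ioi 0) (fun u => ENNReal.ofReal (φ u)))) :=
        mul_le_mul_right (le_add_self.trans (h1.trans (mul_le_mul_right (h2.trans hn) _))) _
    _ = _ := by push_cast; ring

end fromFormula

/-! ### Test functions. -/

section TestFunctions

variable {q : ℝ≥0∞} {b : ℝ → ℝ}

/-- The norm of `min(1, u/s)` is controlled by the tail at `s`. -/
theorem exists_wNorm_min_le (hq : q ≠ 0) (hb : SVZero q b) : ∃ C : ℝ≥0, ∀ s, 0 < s →
    wNorm q b (Ioi 0) (fun u => ENNReal.ofReal (min 1 (u / s))) ≤ C * tailNorm q b s := by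
  obtain ⟨D, hD⟩ := exists_wNorm_union_le q b
  obtain ⟨E, hE⟩ := exists_wNorm_id_le_tailNorm hq hb.1
  refine ⟨D * (E + 1), fun s hs => ?_⟩
  have hs0 : ENNReal.ofReal s ≠ 0 := by simpa using hs
  rw [← Ioc_union_Ioi_eq_Ioi hs.le]
  refine (hD _ _ _ measurableSet_Ioc measurableSet_Ioi).trans ?_
  have h1 : wNorm q b (Ioc 0 s) (fun u => ENNReal.ofReal (min 1 (u / s))) ≤ E * tailNorm q b s := by
    calc wNorm q b (Ioc 0 s) (fun u => ENNReal.ofReal (min 1 (u / s)))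
        ≤ (ENNReal.ofReal s)⁻¹ * wNorm q b (Ioc 0 s) (fun u => ENNReal.ofReal u) := by
          refine wNorm_le_mul (ENNReal.inv_ne_top.2 hs0) measurableSet_Ioc fun u hu => ?_
          rw [← ENNReal.ofReal_inv_of_pos hs, ← ENNReal.ofReal_mul (by positivity)]
          refine ENNReal.ofReal_le_ofReal ((min_le_right _ _).trans (le_of_eq ?_))
          rw [div_eq_inv_mul]
      _ ≤ (ENNReal.ofReal s)⁻¹ * (E * (ENNReal.ofReal s * tailNorm q b s)) := by
          gcongr; exact hE s hs
      _ = ((ENNReal.ofReal s)⁻¹ * ENNReal.ofReal s) * (E * tailNorm q b s) := by ring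
      _ = _ := by rw [ENNReal.inv_mul_cancel hs0 ENNReal.ofReal_ne_top, one_mul]
  have h2 : wNorm q b (Ioi s) (fun u => ENNReal.ofReal (min 1 (u / s))) ≤ tailNorm q b s := by
    rw [← wNorm_one]
    exact wNorm_mono measurableSet_Ioi fun u _ => by simp
  calc (D : ℝ≥0∞) * _ ≤ D * (E * tailNorm q b s + tailNorm q b s) := by gcongr
    _ = _ := by push_cast; ring

/-- A quasi-concave majorant of `1 / tailNorm` on `[a, t]` of almost minimal norm. -/
theorem exists_quasiConcave_majorant (hq : q ≠ 0) (hb : SVZero q b) : ∃ C : ℝ≥0, ∀ a t, 0 < a →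
    a ≤ t → ∃ φ : ℝ → ℝ, QuasiConcave φ ∧
      (∀ u ∈ Icc a t, (tailNorm q b u)⁻¹ ≤ ENNReal.ofReal (φ u)) ∧
      wNorm q b (Ioi 0) (fun u => ENNReal.ofReal (φ u)) ≤
        C * (1 + wNorm q b (Ioc a t) (fun u => (tailNorm q b u)⁻¹)) := by
  obtain ⟨M, hM⟩ := exists_mul_tailNorm_le hq hb.1
  obtain ⟨D, hD⟩ := exists_wNorm_union_le q b
  obtain ⟨E, hE⟩ := exists_wNorm_id_le_tailNorm hq hb.1
  refine ⟨D * (D * (M * E + (1 + M)) + 1), fun a t ha hat => ?_⟩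
  have ht := ha.trans_le hat
  set T : ℝ → ℝ := fun u => (tailNorm q b u).toReal with hT
  have hTpos : ∀ u, 0 < u → 0 < T u := fun u hu => toReal_tailNorm_pos hq hb hu
  have hTof : ∀ u, 0 < u → ENNReal.ofReal (T u)⁻¹ = (tailNorm q b u)⁻¹ := fun u hu => by
    rw [ENNReal.ofReal_inv_of_pos (hTpos u hu), ENNReal.ofReal_toReal (hb.tailNorm_ne_top hq hu)]
  have hTanti : ∀ s u, 0 < s → s ≤ u → T u ≤ T s := fun s u hs hsu =>
    ENNReal.toReal_mono (hb.tailNorm_ne_top hq hs) (tailNorm_antitone hsu)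
  have hTM : ∀ s u, 0 < s → s ≤ u → s * T s ≤ M * (u * T u) := by
    intro s u hs hsu
    have hu := hs.trans_le hsu
    have h1 := ENNReal.toReal_mono (ENNReal.mul_ne_top ENNReal.coe_ne_top (ENNReal.mul_ne_top
      ENNReal.ofReal_ne_top (hb.tailNorm_ne_top hq hu))) (hM s u hs hsu)
    simpa [ENNReal.toReal_mul, ENNReal.toReal_ofReal, hs.le, hu.le] using h1
  have hinvM : ∀ s u, 0 < s → s ≤ u → (u * T u)⁻¹ ≤ M * (s * T s)⁻¹ := by
    intro s u hs hsu
    have h1 := mul_pos hs (hTpos s hs)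
    have h2 := mul_pos (hs.trans_le hsu) (hTpos u (hs.trans_le hsu))
    rw [inv_le_iff_one_le_mul₀ h2, ← div_eq_mul_inv, div_mul_eq_mul_div, le_div_iff₀ h1, one_mul]
    exact hTM s u hs hsu
  -- A supremum of quasi-concave functions; the term `s = u` gives the lower bound `1/T(u)` on `[a,
  -- t]`.
  set φ : ℝ → ℝ := fun u => ⨆ s : Icc a t, min 1 (u / s) * (T s)⁻¹ with hφ
  have hmem : ∀ s : Icc a t, 0 < (s : ℝ) := fun s => ha.trans_le s.2.1
  have hterm : ∀ (u : ℝ) (s : Icc a t), min 1 (u / s) * (T s)⁻¹ ≤ (T t)⁻¹ := by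
    intro u s
    have h1 : (T s)⁻¹ ≤ (T t)⁻¹ := inv_anti₀ (hTpos t ht) (hTanti s t (hmem s) s.2.2)
    have h2 : 0 < (T s)⁻¹ := inv_pos.2 (hTpos s (hmem s))
    calc min 1 (u / s) * (T s)⁻¹ ≤ 1 * (T s)⁻¹ := by gcongr; exact min_le_left _ _
      _ ≤ _ := by rw [one_mul]; exact h1
  have hbdd : ∀ u, BddAbove (range fun s : Icc a t => min 1 (u / (s : ℝ)) * (T s)⁻¹) := fun u =>
    ⟨(T t)⁻¹, by rintro _ ⟨s, rfl⟩; exact hterm u s⟩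
  have hne : Nonempty (Icc a t) := ⟨⟨a, le_rfl, hat⟩⟩
  have hqc : ∀ s : Icc a t, QuasiConcave (fun u => min 1 (u / s)) := fun s =>
    quasiConcave_min_one_div (hmem s)
  have hle : ∀ (u : ℝ) (s : Icc a t), min 1 (u / s) * (T s)⁻¹ ≤ φ u := fun u s =>
    le_ciSup (hbdd u) s
  refine ⟨φ, .of_mul_le (fun u hu => ?_) (fun u v hu huv => ?_) (fun u v hu huv => ?_), ?_, ?_⟩
  · obtain ⟨s⟩ := hne
    refine lt_of_lt_of_le ?_ (hle u s)
    exact mul_pos ((hqc s).pos u hu) (inv_pos.2 (hTpos s (hmem s)))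
  · refine ciSup_le fun s => le_trans ?_ (hle v s)
    exact mul_le_mul_of_nonneg_right ((hqc s).monotone (mem_Ioi.2 hu)
      (mem_Ioi.2 (hu.trans_le huv)) huv) (inv_nonneg.2 (hTpos s (hmem s)).le)
  · rw [mul_comm, ← le_div_iff₀ hu]
    refine ciSup_le fun s => ?_
    rw [le_div_iff₀ hu]
    calc min 1 (v / s) * (T s)⁻¹ * u = (u * min 1 (v / s)) * (T s)⁻¹ := by ring
      _ ≤ (v * min 1 (u / s)) * (T s)⁻¹ :=
          mul_le_mul_of_nonneg_right ((hqc s).mul_le hu huv) (inv_nonneg.2 (hTpos s (hmem s)).le)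
      _ = v * (min 1 (u / s) * (T s)⁻¹) := by ring
      _ ≤ v * φ u := mul_le_mul_of_nonneg_left (hle u s) (hu.trans_le huv).le
  · intro u hu
    have hu0 := ha.trans_le hu.1
    rw [← hTof u hu0]
    refine ENNReal.ofReal_le_ofReal ?_
    simpa [div_self hu0.ne'] using hle u ⟨u, hu⟩
  have hφ_low : ∀ u ∈ Ioc 0 a, φ u ≤ M * (a * T a)⁻¹ * u := by
    intro u hu
    refine ciSup_le fun s => ?_
    have hTs := inv_nonneg.2 (hTpos s (hmem s)).le
    calc min 1 (u / s) * (T s)⁻¹ ≤ u / s * (T s)⁻¹ := by gcongr; exact min_le_right _ _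
      _ = (s * T s)⁻¹ * u := by rw [mul_inv, div_eq_mul_inv]; ring
      _ ≤ M * (a * T a)⁻¹ * u :=
          mul_le_mul_of_nonneg_right (hinvM a s ha s.2.1) hu.1.le
  -- Terms with `s ≤ u` are controlled because `T` is non-increasing, terms with `s ≥ u` because `s
  -- * T s` is almost increasing.
  have hφ_mid : ∀ u ∈ Ioc a t, φ u ≤ (1 + M) * (T u)⁻¹ := by
    intro u hu
    have hu0 := ha.trans hu.1
    have hTu := inv_pos.2 (hTpos u hu0)
    refine ciSup_le fun s => ?_
    have hTs := inv_nonneg.2 (hTpos s (hmem s)).le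
    rcases le_total (s : ℝ) u with hsu | hsu
    · calc min 1 (u / s) * (T s)⁻¹ ≤ 1 * (T s)⁻¹ := by gcongr; exact min_le_left _ _
        _ ≤ 1 * (T u)⁻¹ := by
            gcongr
            · exact hTpos u hu0
            · exact hTanti s u (hmem s) hsu
        _ ≤ (1 + M) * (T u)⁻¹ := by gcongr; simp
    · calc min 1 (u / s) * (T s)⁻¹ ≤ u / s * (T s)⁻¹ := by gcongr; exact min_le_right _ _
        _ = (s * T s)⁻¹ * u := by rw [mul_inv, div_eq_mul_inv]; ring
        _ ≤ M * (u * T u)⁻¹ * u := mul_le_mul_of_nonneg_right (hinvM u s hu0 hsu) hu0.le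
        _ = M * (T u)⁻¹ := by field_simp
        _ ≤ (1 + M) * (T u)⁻¹ := by gcongr; simp
  have hφ_high : ∀ u, φ u ≤ (T t)⁻¹ := fun u => ciSup_le (hterm u)
  set L := wNorm q b (Ioc a t) (fun u => (tailNorm q b u)⁻¹) with hL
  have h1 : wNorm q b (Ioc 0 a) (fun u => ENNReal.ofReal (φ u)) ≤ (M * E : ℝ≥0) := by
    have hTa := tailNorm_pos hq hb.1 ha
    have ha0 : ENNReal.ofReal a ≠ 0 := by simpa using ha
    have hTa' := hb.tailNorm_ne_top hq ha
    calc wNorm q b (Ioc 0 a) (fun u => ENNReal.ofReal (φ u))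
        ≤ (M * (ENNReal.ofReal a * tailNorm q b a)⁻¹) *
          wNorm q b (Ioc 0 a) (fun u => ENNReal.ofReal u) := by
          refine wNorm_le_mul (ENNReal.mul_ne_top ENNReal.coe_ne_top (ENNReal.inv_ne_top.2
            (mul_ne_zero ha0 hTa.ne'))) measurableSet_Ioc fun u hu => ?_
          refine (ENNReal.ofReal_le_ofReal (hφ_low u hu)).trans (le_of_eq ?_)
          have hp := mul_pos ha (hTpos a ha)
          rw [ENNReal.ofReal_mul (by positivity), ENNReal.ofReal_mul (by positivity),
            ENNReal.ofReal_coe_nnreal, ENNReal.ofReal_inv_of_pos hp, ENNReal.ofReal_mul ha.le,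
            ENNReal.ofReal_toReal hTa']
      _ ≤ (M * (ENNReal.ofReal a * tailNorm q b a)⁻¹) *
          (E * (ENNReal.ofReal a * tailNorm q b a)) := by gcongr; exact hE a ha
      _ = (M * E : ℝ≥0) * ((ENNReal.ofReal a * tailNorm q b a)⁻¹ *
          (ENNReal.ofReal a * tailNorm q b a)) := by push_cast; ring
      _ = _ := by
          rw [ENNReal.inv_mul_cancel (mul_ne_zero ha0 hTa.ne')
            (ENNReal.mul_ne_top ENNReal.ofReal_ne_top hTa'), mul_one]
  have h2 : wNorm q b (Ioc a t) (fun u => ENNReal.ofReal (φ u)) ≤ (1 + M : ℝ≥0) * L := by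
    refine wNorm_le_mul ENNReal.coe_ne_top measurableSet_Ioc fun u hu => ?_
    refine (ENNReal.ofReal_le_ofReal (hφ_mid u hu)).trans (le_of_eq ?_)
    rw [ENNReal.ofReal_mul (by positivity), hTof u (ha.trans hu.1)]
    congr 1
    rw [ENNReal.ofReal, Real.toNNReal_add zero_le_one (NNReal.coe_nonneg M)]
    simp
  have h3 : wNorm q b (Ioi t) (fun u => ENNReal.ofReal (φ u)) ≤ 1 := by
    calc wNorm q b (Ioi t) (fun u => ENNReal.ofReal (φ u))
        ≤ (tailNorm q b t)⁻¹ * wNorm q b (Ioi t) (fun _ => 1) := by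
          refine wNorm_le_mul (ENNReal.inv_ne_top.2 (tailNorm_pos hq hb.1 ht).ne')
            measurableSet_Ioi fun u _ => ?_
          rw [mul_one, ← hTof t ht]
          exact ENNReal.ofReal_le_ofReal (hφ_high u)
      _ = 1 := by
          rw [wNorm_one, ENNReal.inv_mul_cancel (tailNorm_pos hq hb.1 ht).ne'
            (hb.tailNorm_ne_top hq ht)]
  rw [← Ioc_union_Ioi_eq_Ioi ht.le, ← Ioc_union_Ioc_eq_Ioc ha.le hat]
  calc wNorm q b (Ioc 0 a ∪ Ioc a t ∪ Ioi t) (fun u => ENNReal.ofReal (φ u))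
      ≤ D * (D * ((M * E : ℝ≥0) + (1 + M : ℝ≥0) * L) + 1) := by
        refine (hD _ _ _ (measurableSet_Ioc.union measurableSet_Ioc) measurableSet_Ioi).trans ?_
        gcongr
        refine (hD _ _ _ measurableSet_Ioc measurableSet_Ioc).trans ?_
        gcongr
    _ ≤ D * (D * ((M * E : ℝ≥0) + (1 + M : ℝ≥0) * L) + 1) +
          D * (D * ((M * E : ℝ≥0) * L + (1 + M : ℝ≥0)) + L) := le_self_add
    _ = _ := by push_cast; ring

/-- `‖u ^ (-1/q) b(u) / T(u)‖` in `L^q(a, t)` is at most `log(T(a)/T(t)) ^ (1/q)`, up to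
constants. -/
theorem exists_wNorm_tailNorm_inv_le (hq : q ≠ 0) (hb : SVZero q b) : ∃ C : ℝ≥0, ∀ a t, 0 < a →
    a ≤ t → ∀ y : ℝ, 1 ≤ y →
      Real.log ((tailNorm q b a).toReal / (tailNorm q b t).toReal) ≤ y →
        wNorm q b (Ioc a t) (fun u => (tailNorm q b u)⁻¹) ≤
          C * ENNReal.ofReal (y ^ q⁻¹.toReal) := by
  rcases eq_or_ne q ∞ with rfl | htop
  · obtain ⟨C, hC⟩ := exists_wNorm_top_le hb
    refine ⟨C, fun a t ha hat y _ _ => ?_⟩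
    have h := hC (Ioc a t) 1 1 measurableSet_Ioc (fun u hu => ha.trans hu.1) (by simp)
    simpa [ENNReal.rpow_neg_one] using h
  · have hr := ENNReal.toReal_pos hq htop
    refine ⟨q.toReal.toNNReal ^ (1 / q.toReal), fun a t ha hat y hy hle => ?_⟩
    rw [wNorm_tailNorm_inv hq htop hb ha hat]
    calc _ ≤ ENNReal.ofReal (q.toReal * y) ^ (1 / q.toReal) := by gcongr
      _ = _ := by
        rw [ENNReal.ofReal_mul hr.le, ENNReal.mul_rpow_of_nonneg _ _ (by positivity),
          ENNReal.coe_rpow_of_nonneg _ (by positivity), ENNReal.ofReal_rpow_of_pos (x := y)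
          (by linarith), ENNReal.toReal_inv, one_div]
        rfl

end TestFunctions

/-! ### Comparison of exponents and iteration. -/

theorem le_rpow_of_mul_rpow_le {κ B α β x : ℝ} (hκ : 0 < κ) (hαβ : β < α) (hx : 0 < x)
    (h : κ * x ^ α ≤ B * x ^ β) : x ≤ (B / κ) ^ (α - β)⁻¹ := by
  have h1 : x ^ (α - β) ≤ B / κ := by
    rw [Real.rpow_sub hx, div_le_div_iff₀ (Real.rpow_pos_of_pos hx _) hκ]
    linarith
  have h2 := Real.rpow_le_rpow (by positivity) h1 (inv_nonneg.2 (sub_pos.2 hαβ).le)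
  rwa [← Real.rpow_mul hx.le, mul_inv_cancel₀ (sub_pos.2 hαβ).ne', Real.rpow_one] at h2

/-- If a weighted inequality from the larger exponent `q` to the smaller exponent `p` holds on an
interval where the two tails are comparable, the tails do not decrease much on that interval. -/
theorem exists_log_tailNorm_le {p q : ℝ≥0∞} {v w : ℝ → ℝ} (hp : p ≠ 0) (hpq : p < q)
    (hv : SVZero p v) (hw : SVZero q w) (c A : ℝ≥0) :
    ∃ X : ℝ, ∀ (a t : ℝ) (r : ℝ≥0∞), 0 < a → a ≤ t → r ≠ 0 → r ≠ ∞ →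
      (∀ φ : ℝ → ℝ, QuasiConcave φ → wNorm q w (Ioi 0) (fun u => ENNReal.ofReal (φ u)) < ∞ →
        wNorm p v (Ioc a t) (fun u => ENNReal.ofReal (φ u)) ≤
          c * (r * wNorm q w (Ioi 0) (fun u => ENNReal.ofReal (φ u)))) →
      (∀ u ∈ Icc a t, tailNorm p v u ≤ A * (r * tailNorm q w u) ∧
        r * tailNorm q w u ≤ A * tailNorm p v u) →
      Real.log ((tailNorm p v a).toReal / (tailNorm p v t).toReal) ≤ X := by
  have hq : q ≠ 0 := (pos_iff_ne_zero.2 hp |>.trans hpq).ne'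
  have hpt : p ≠ ∞ := hpq.ne_top
  have hpr := ENNReal.toReal_pos hp hpt
  obtain ⟨C, hC⟩ := exists_quasiConcave_majorant hq hw
  obtain ⟨D, hD⟩ := exists_wNorm_tailNorm_inv_le hq hw
  set α := 1 / p.toReal with hα
  set β := q⁻¹.toReal with hβ
  have hβ0 : 0 ≤ β := ENNReal.toReal_nonneg
  have hβα : β < α := by
    rw [hα, one_div, ← ENNReal.toReal_inv]
    exact (ENNReal.toReal_lt_toReal (ENNReal.inv_ne_top.2 hq) (ENNReal.inv_ne_top.2 hp)).2
      (ENNReal.inv_lt_inv.2 hpq)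
  set B : ℝ≥0 := A * (c * C) with hB
  set d : ℝ := Real.log ((A : ℝ) * A) with hd
  set κ : ℝ := p.toReal ^ α with hκdef
  have hκ : 0 < κ := by positivity
  set Y : ℝ := (B * (1 + D * 2 ^ β) + 1) / κ with hY
  -- Beyond 1 and `d` the logarithmic drop `x` satisfies `1 ≤ x` and `d + x ≤ 2 * x`; the last entry
  -- is the bound that `κ * x ^ α ≤ κ * Y * x ^ β` forces, since `β < α`.
  refine ⟨max (max 1 d) (Y ^ (α - β)⁻¹), fun a t r ha hat hr0 hrt hmain hcomp => ?_⟩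
  have ht := ha.trans_le hat
  set x := Real.log ((tailNorm p v a).toReal / (tailNorm p v t).toReal) with hx
  by_contra! hlt
  obtain ⟨h1, h2⟩ := max_lt_iff.1 hlt
  obtain ⟨h3, h4⟩ := max_lt_iff.1 h1
  have hx0 : 0 < x := by linarith
  have hSa := toReal_tailNorm_pos hp hv ha
  have hSt := toReal_tailNorm_pos hp hv ht
  have hTa := toReal_tailNorm_pos hq hw ha
  have hTt := toReal_tailNorm_pos hq hw ht
  have hr := ENNReal.toReal_pos hr0 hrt
  -- Comparability at the two endpoints costs a factor `A * A` in the ratio of the other tail, hence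
  -- the summand `d`.
  have hlog : Real.log ((tailNorm q w a).toReal / (tailNorm q w t).toReal) ≤ 2 * x := by
    have e1 := ENNReal.toReal_mono (ENNReal.mul_ne_top ENNReal.coe_ne_top
      (hv.tailNorm_ne_top hp ha)) (hcomp a ⟨le_rfl, hat⟩).2
    have e2 := ENNReal.toReal_mono (ENNReal.mul_ne_top ENNReal.coe_ne_top
      (ENNReal.mul_ne_top hrt (hw.tailNorm_ne_top hq ht))) (hcomp t ⟨hat, le_rfl⟩).1
    simp only [ENNReal.toReal_mul, ENNReal.coe_toReal] at e1 e2
    have hA : (0 : ℝ) < A := by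
      by_contra hA
      have : (A : ℝ) = 0 := le_antisymm (not_lt.1 hA) A.2
      rw [this, zero_mul] at e2
      linarith
    have e3 : (tailNorm q w a).toReal / (tailNorm q w t).toReal ≤
        (A * A) * ((tailNorm p v a).toReal / (tailNorm p v t).toReal) := by
      rw [← mul_div_assoc, div_le_div_iff₀ hTt hSt]
      have e4 := mul_le_mul e1 e2 hSt.le (by positivity)
      have e5 : r.toReal * ((tailNorm q w a).toReal * (tailNorm p v t).toReal) ≤
          r.toReal * (A * A * (tailNorm p v a).toReal * (tailNorm q w t).toReal) := by
        nlinarith [e4]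
      exact le_of_mul_le_mul_left e5 hr
    calc _ ≤ Real.log ((A * A) * ((tailNorm p v a).toReal / (tailNorm p v t).toReal)) :=
          Real.log_le_log (by positivity) e3
      _ = d + x := by rw [Real.log_mul (by positivity) (by positivity)]
      _ ≤ 2 * x := by linarith
  obtain ⟨φ, hφ, hφ1, hφ2⟩ := hC a t ha hat
  have hL := hD a t ha hat (2 * x) (by linarith) hlog
  set L := wNorm q w (Ioc a t) (fun u => (tailNorm q w u)⁻¹) with hLdef
  have hfin : wNorm q w (Ioi 0) (fun u => ENNReal.ofReal (φ u)) < ∞ :=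
    hφ2.trans_lt (ENNReal.mul_lt_top ENNReal.coe_lt_top
      (ENNReal.add_lt_top.2 ⟨ENNReal.one_lt_top, hL.trans_lt (by finiteness)⟩))
  -- The hypothesis is applied to the majorant of `1/T`, where `T` is the tail of exponent `q`;
  -- proportionality of the tails turns it into a bound for the reciprocal of the tail of exponent
  -- `p`.
  have hkey : r * wNorm p v (Ioc a t) (fun u => (tailNorm p v u)⁻¹) ≤ r * (B * (1 + L)) := by
    calc r * wNorm p v (Ioc a t) (fun u => (tailNorm p v u)⁻¹)
        ≤ r * ((r⁻¹ * A) * wNorm p v (Ioc a t) (fun u => ENNReal.ofReal (φ u))) := by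
          gcongr
          refine wNorm_le_mul (ENNReal.mul_ne_top (ENNReal.inv_ne_top.2 hr0) ENNReal.coe_ne_top)
            measurableSet_Ioc fun u hu => ?_
          have hu' : u ∈ Icc a t := ⟨hu.1.le, hu.2⟩
          have hu0 := ha.trans hu.1
          refine le_trans ?_ (mul_le_mul_right (hφ1 u hu') _)
          have h5 := inv_le_of_mul_le (M := A) (c := 1) (tailNorm_pos hq hw.1 hu0).ne'
            (hw.tailNorm_ne_top hq hu0) (tailNorm_pos hp hv.1 hu0).ne'
            (hv.tailNorm_ne_top hp hu0) hr0 hrt (by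
              rw [one_mul, mul_comm (tailNorm q w u)]; exact (hcomp u hu').2)
          rwa [one_mul, mul_comm (A : ℝ≥0∞)] at h5
      _ = (r * r⁻¹) * (A * wNorm p v (Ioc a t) (fun u => ENNReal.ofReal (φ u))) := by ring
      _ = A * wNorm p v (Ioc a t) (fun u => ENNReal.ofReal (φ u)) := by
          rw [ENNReal.mul_inv_cancel hr0 hrt, one_mul]
      _ ≤ A * (c * (r * (C * (1 + L)))) := by
          refine mul_le_mul_right ((hmain φ hφ hfin).trans ?_) _
          gcongr
      _ = r * (B * (1 + L)) := by rw [hB]; push_cast; ring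
  rw [ENNReal.mul_le_mul_iff_right hr0 hrt, wNorm_tailNorm_inv hp hpt hv ha hat, ← hx, ← hα,
    ENNReal.ofReal_rpow_of_pos (by positivity), Real.mul_rpow hpr.le hx0.le] at hkey
  have hreal : κ * x ^ α ≤ B * (1 + D * (2 * x) ^ β) := by
    have h6 : ENNReal.ofReal (κ * x ^ α) ≤ ENNReal.ofReal (B * (1 + D * (2 * x) ^ β)) := by
      refine hkey.trans ?_
      rw [ENNReal.ofReal_mul (NNReal.coe_nonneg B), ENNReal.ofReal_add zero_le_one (by positivity),
        ENNReal.ofReal_mul (NNReal.coe_nonneg D), ENNReal.ofReal_one, ENNReal.ofReal_coe_nnreal,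
        ENNReal.ofReal_coe_nnreal]
      gcongr
    exact (ENNReal.ofReal_le_ofReal_iff (by positivity)).1 h6
  have hxβ : 1 ≤ x ^ β := Real.one_le_rpow h3.le hβ0
  have hle : κ * x ^ α ≤ (B * (1 + D * 2 ^ β) + 1) * x ^ β := by
    calc κ * x ^ α ≤ B * (1 + D * (2 * x) ^ β) := hreal
      _ = B * (1 + D * (2 ^ β * x ^ β)) := by rw [Real.mul_rpow (by norm_num) hx0.le]
      _ ≤ B * (x ^ β + D * (2 ^ β * x ^ β)) := by gcongr
      _ = B * (1 + D * 2 ^ β) * x ^ β := by ring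
      _ ≤ (B * (1 + D * 2 ^ β) + 1) * x ^ β := by gcongr; linarith
  exact absurd (le_rpow_of_mul_rpow_le hκ hβα hx0 hle) (not_le.2 h2)

/-- If `R` is almost increasing and doubles whenever `S` drops by a factor `N`, then `R * S ^ δ` is
almost increasing, where `N ^ δ = 2`. -/
theorem mul_rpow_almost_monotone {R S : ℝ → ℝ} {M N : ℝ} (hN : 1 < N)
    (hR : ∀ t, 0 < t → 0 < R t) (hS : ∀ t, 0 < t → 0 < S t)
    (hSa : ∀ s t, 0 < s → s ≤ t → S t ≤ S s)
    (hivt : ∀ s t y, 0 < s → s ≤ t → S t ≤ y → y ≤ S s → ∃ x ∈ Icc s t, S x = y)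
    (hM : ∀ s t, 0 < s → s ≤ t → R s ≤ M * R t)
    (hdouble : ∀ s t, 0 < s → s ≤ t → N * S t ≤ S s → 2 * R s ≤ R t)
    {s t : ℝ} (hs : 0 < s) (hst : s ≤ t) :
    R s * S s ^ Real.logb N 2 ≤ 2 * M * (R t * S t ^ Real.logb N 2) := by
  have hN0 : 0 < N := by linarith
  -- Induction on the number of drops: the intermediate value property supplies a point where `S`
  -- has dropped by exactly `N`, and the doubling is used up to that point.
  have hiter : ∀ (k : ℕ) (s t : ℝ), 0 < s → s ≤ t → N ^ k * S t ≤ S s → 2 ^ k * R s ≤ M * R t := by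
    intro k
    induction k with
    | zero => intro s t hs hst _; simpa using hM s t hs hst
    | succ k ih =>
      intro s t hs hst h
      have ht := hs.trans_le hst
      have hSt := hS t ht
      have h1 : N ^ k * S t ≤ S s / N := by
        rw [le_div_iff₀ hN0]; calc _ = N ^ (k + 1) * S t := by ring
          _ ≤ _ := h
      have h2 : S t ≤ S s / N := le_trans (le_mul_of_one_le_left hSt.le (one_le_pow₀ hN.le)) h1
      obtain ⟨x, hx, hxS⟩ := hivt s t (S s / N) hs hst h2 (div_le_self (hS s hs).le hN.le)
      have h3 := hdouble s x hs hx.1 (by rw [hxS, mul_div_cancel₀ _ hN0.ne'])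
      have h4 := ih x t (hs.trans_le hx.1) hx.2 (by rw [hxS]; exact h1)
      calc 2 ^ (k + 1) * R s = 2 ^ k * (2 * R s) := by ring
        _ ≤ 2 ^ k * R x := by gcongr
        _ ≤ _ := h4
  have ht := hs.trans_le hst
  have hSt := hS t ht
  have hSs := hS s hs
  set δ := Real.logb N 2 with hδ
  have hδ0 : 0 ≤ δ := (Real.logb_pos hN (by norm_num)).le
  have hNδ : N ^ δ = 2 := Real.rpow_logb hN0 hN.ne' (by norm_num)
  have hratio : 1 ≤ S s / S t := (one_le_div hSt).2 (hSa s t hs hst)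
  -- `k` counts the full drops between `s` and `t`; the incomplete last one costs the factor 2 in
  -- the final constant.
  obtain ⟨k, hk1, hk2⟩ := exists_nat_pow_near hratio hN
  rw [le_div_iff₀ hSt] at hk1
  rw [div_lt_iff₀ hSt] at hk2
  have h5 := hiter k s t hs hst hk1
  have h6 : S s ^ δ ≤ 2 ^ (k + 1) * S t ^ δ := by
    calc S s ^ δ ≤ (N ^ (k + 1) * S t) ^ δ := Real.rpow_le_rpow hSs.le hk2.le hδ0
      _ = (N ^ (k + 1)) ^ δ * S t ^ δ := Real.mul_rpow (by positivity) hSt.le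
      _ = 2 ^ (k + 1) * S t ^ δ := by
          rw [← Real.rpow_natCast, ← Real.rpow_mul hN0.le, mul_comm _ δ, Real.rpow_mul hN0.le, hNδ,
            Real.rpow_natCast]
  have hRs := hR s hs
  calc R s * S s ^ δ ≤ R s * (2 ^ (k + 1) * S t ^ δ) := by gcongr
    _ = 2 * (2 ^ k * R s) * S t ^ δ := by ring
    _ ≤ 2 * (M * R t) * S t ^ δ := by gcongr
    _ = _ := by ring

/-! ### The converse implication. -/

section Converse

variable {q₀ q₁ : ℝ≥0∞} {b₀ b₁ : ℝ → ℝ}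

theorem rhoCondition_of_almost_monotone (hq₀ : q₀ ≠ 0) (hq₁ : q₁ ≠ 0) (hb₀ : SVZero q₀ b₀)
    (hb₁ : SVZero q₁ b₁) {ε : ℝ} (hε : 0 < ε) {M : ℝ}
    (h : ∀ s t, 0 < s → s ≤ t →
      (tailNorm q₀ b₀ s).toReal ^ (1 + ε) / (tailNorm q₁ b₁ s).toReal ≤
        M * ((tailNorm q₀ b₀ t).toReal ^ (1 + ε) / (tailNorm q₁ b₁ t).toReal)) :
    RhoCondition q₀ q₁ b₀ b₁ := by
  set F : ℝ → ℝ := fun t => (tailNorm q₀ b₀ t).toReal ^ (1 + ε) / (tailNorm q₁ b₁ t).toReal with hF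
  have hFpos : ∀ t, 0 < t → 0 < F t := fun t ht =>
    div_pos (Real.rpow_pos_of_pos (toReal_tailNorm_pos hq₀ hb₀ ht) _)
      (toReal_tailNorm_pos hq₁ hb₁ ht)
  have hFeq : ∀ t, 0 < t → rhoEps ε q₀ q₁ b₀ b₁ t = ENNReal.ofReal (F t) := by
    intro t ht
    rw [hF, ENNReal.ofReal_div_of_pos (toReal_tailNorm_pos hq₁ hb₁ ht),
      ← ENNReal.ofReal_rpow_of_pos (toReal_tailNorm_pos hq₀ hb₀ ht),
      ENNReal.ofReal_toReal (hb₀.tailNorm_ne_top hq₀ ht),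
      ENNReal.ofReal_toReal (hb₁.tailNorm_ne_top hq₁ ht), rhoEps]
  -- The running supremum is non-decreasing, and almost monotonicity makes it equivalent to `F`.
  set G : ℝ → ℝ≥0∞ := fun t => ⨆ s ∈ Ioc 0 t, ENNReal.ofReal (F s) with hG
  have hGle : ∀ t, 0 < t → G t ≤ ENNReal.ofReal (M * F t) := fun t _ =>
    iSup₂_le fun s hs => ENNReal.ofReal_le_ofReal (h s t hs.1 hs.2)
  have hGt : ∀ t, 0 < t → G t ≠ ∞ := fun t ht =>
    ne_top_of_le_ne_top ENNReal.ofReal_ne_top (hGle t ht)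
  have hleG : ∀ t, 0 < t → ENNReal.ofReal (F t) ≤ G t := fun t ht =>
    le_iSup₂ (f := fun s (_ : s ∈ Ioc 0 t) => ENNReal.ofReal (F s)) t ⟨ht, le_rfl⟩
  refine ⟨ε, hε, fun t => (G t).toNNReal, fun s hs t ht hst => ?_, 1 + M.toNNReal, by positivity,
    fun t ht => ?_⟩
  · exact ENNReal.toNNReal_mono (hGt t ht) (biSup_mono fun u hu => ⟨hu.1, hu.2.trans hst⟩)
  · simp only [ENNReal.smul_def, smul_eq_mul, ENNReal.coe_toNNReal (hGt t ht), hFeq t ht]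
    push_cast
    rw [add_mul, add_mul, one_mul, one_mul]
    refine ⟨(hleG t ht).trans le_self_add, (hGle t ht).trans (le_trans ?_ le_add_self)⟩
    rw [ENNReal.ofReal_mul' (hFpos t ht).le]
    rfl

variable {𝕜 V : Type*} [RCLike 𝕜] [AddCommGroup V] [Module 𝕜 V] [TopologicalSpace V]
  {A₀ A₁ : QuasiNormedSubspace 𝕜 V}

/-- The test function is `min(1, u/t)`: its first norm is a multiple of `T₀(t)`, while its second
norm over `(s, ∞)` is at least `T₁(t)`. -/
theorem HolmstedtFormula.exists_rho_le (hq₀ : q₀ ≠ 0) (hq₁ : q₁ ≠ 0)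
    (hb₀ : SVZero q₀ b₀) (hb₁ : SVZero q₁ b₁)
    (hs : KSurjective A₀ A₁) (hH : HolmstedtFormula A₀ A₁ q₀ q₁ b₀ b₁) :
    ∃ M : ℝ≥0, ∀ s t, 0 < s → s ≤ t → rho q₀ q₁ b₀ b₁ s ≤ M * rho q₀ q₁ b₀ b₁ t := by
  obtain ⟨k, hk⟩ := hH.exists_rho_mul_wNorm_Ioi_le hq₀ hb₀ hs
  obtain ⟨C, hC⟩ := exists_wNorm_min_le hq₀ hb₀
  refine ⟨k * C, fun s t hs0 hst => ?_⟩
  have ht := hs0.trans_le hst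
  have hfin := (hC t ht).trans_lt
    (ENNReal.mul_lt_top ENNReal.coe_lt_top (hb₀.tailNorm_ne_top hq₀ ht).lt_top)
  have h1 := hk _ (quasiConcave_min_one_div ht) hfin s hs0
  rw [max_eq_left hs0.le] at h1
  have h2 : tailNorm q₁ b₁ t ≤
      wNorm q₁ b₁ (Ioi s) (fun u => ENNReal.ofReal (min 1 (u / t))) := by
    refine le_trans ?_ (wNorm_mono_set (Ioi_subset_Ioi hst) _)
    rw [← wNorm_one]
    refine wNorm_mono measurableSet_Ioi fun u hu => ?_
    rw [min_eq_left ((one_le_div ht).2 (le_of_lt hu)), ENNReal.ofReal_one]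
  rw [rho.eq_1 q₀ q₁ b₀ b₁ t, ← mul_div_assoc,
    ENNReal.le_div_iff_mul_le (Or.inl (tailNorm_pos hq₁ hb₁.1 ht).ne')
      (Or.inl (hb₁.tailNorm_ne_top hq₁ ht))]
  calc rho q₀ q₁ b₀ b₁ s * tailNorm q₁ b₁ t
      ≤ rho q₀ q₁ b₀ b₁ s * wNorm q₁ b₁ (Ioi s) (fun u => ENNReal.ofReal (min 1 (u / t))) := by
        gcongr
    _ ≤ _ := h1
    _ ≤ k * (C * tailNorm q₀ b₀ t) := by gcongr; exact hC t ht
    _ = _ := by push_cast; ring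

/-- If the tail `S` of finite exponent stays comparable to its initial value as long as `ρ` does,
then `ρ * S ^ δ` is almost increasing for some `δ`. -/
theorem exists_rho_mul_rpow_le (hq₀ : q₀ ≠ 0) (hq₁ : q₁ ≠ 0)
    (hb₀ : SVZero q₀ b₀) (hb₁ : SVZero q₁ b₁) {M : ℝ≥0}
    (hM : ∀ s t, 0 < s → s ≤ t → rho q₀ q₁ b₀ b₁ s ≤ M * rho q₀ q₁ b₀ b₁ t)
    {p : ℝ≥0∞} {v : ℝ → ℝ} (hp : p ≠ 0) (hpt : p ≠ ∞) (hv : SVZero p v) {X : ℝ}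
    (hX : ∀ s t, 0 < s → s ≤ t → rho q₀ q₁ b₀ b₁ t ≤ 2 * rho q₀ q₁ b₀ b₁ s →
      Real.log ((tailNorm p v s).toReal / (tailNorm p v t).toReal) ≤ X) :
    ∃ δ : ℝ, 0 < δ ∧ δ < 1 ∧ ∀ s t, 0 < s → s ≤ t →
      (tailNorm q₀ b₀ s).toReal / (tailNorm q₁ b₁ s).toReal * (tailNorm p v s).toReal ^ δ ≤
        2 * M * ((tailNorm q₀ b₀ t).toReal / (tailNorm q₁ b₁ t).toReal *
          (tailNorm p v t).toReal ^ δ) := by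
  -- The drop factor exceeds `exp X`, so that a larger drop contradicts `hX` unless `ρ` doubles; the
  -- summand 4 makes it exceed 2, whence `δ < 1`.
  have hN : 1 < Real.exp X + 4 := by linarith [Real.exp_pos X]
  have hN2 : (2 : ℝ) < Real.exp X + 4 := by linarith [Real.exp_pos X]
  have hρ : ∀ t, (rho q₀ q₁ b₀ b₁ t).toReal =
      (tailNorm q₀ b₀ t).toReal / (tailNorm q₁ b₁ t).toReal := fun t => ENNReal.toReal_div _ _
  have hρt : ∀ t, 0 < t → rho q₀ q₁ b₀ b₁ t ≠ ∞ := fun t ht => rho_ne_top hq₀ hq₁ hb₀ hb₁ ht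
  refine ⟨Real.logb (Real.exp X + 4) 2, Real.logb_pos hN (by norm_num), ?_, fun s t hs hst => ?_⟩
  · rw [Real.logb_lt_iff_lt_rpow hN (by norm_num), Real.rpow_one]
    exact hN2
  refine mul_rpow_almost_monotone
    (R := fun t => (tailNorm q₀ b₀ t).toReal / (tailNorm q₁ b₁ t).toReal)
    (S := fun t => (tailNorm p v t).toReal) hN
    (fun t ht => div_pos (toReal_tailNorm_pos hq₀ hb₀ ht) (toReal_tailNorm_pos hq₁ hb₁ ht))
    (fun t ht => toReal_tailNorm_pos hp hv ht)
    (fun s t hs hst => ENNReal.toReal_mono (hv.tailNorm_ne_top hp hs) (tailNorm_antitone hst))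
    (fun s t y hs hst h1 h2 => exists_tailNorm_eq hp hpt hv hs hst h1 h2)
    (fun s t hs hst => ?_) (fun s t hs hst h => ?_) hs hst
  · have h1 := ENNReal.toReal_mono (ENNReal.mul_ne_top ENNReal.coe_ne_top
      (hρt t (hs.trans_le hst))) (hM s t hs hst)
    simpa only [ENNReal.toReal_mul, hρ, ENNReal.coe_toReal] using h1
  · by_contra! hlt
    have ht := hs.trans_le hst
    have h1 : rho q₀ q₁ b₀ b₁ t ≤ 2 * rho q₀ q₁ b₀ b₁ s := by
      rw [← ENNReal.toReal_le_toReal (hρt t ht) (ENNReal.mul_ne_top (by simp) (hρt s hs)),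
        ENNReal.toReal_mul, hρ, hρ]
      simpa using hlt.le
    have hSt := toReal_tailNorm_pos hp hv ht
    have hSs := toReal_tailNorm_pos hp hv hs
    have h2 := hX s t hs hst h1
    rw [Real.log_le_iff_le_exp (by positivity), div_le_iff₀ hSt] at h2
    linarith

theorem HolmstedtFormula.rhoCondition (hq₀ : q₀ ≠ 0) (hq₁ : q₁ ≠ 0) (hq : q₀ ≠ q₁)
    (hb₀ : SVZero q₀ b₀) (hb₁ : SVZero q₁ b₁)
    (hs : KSurjective A₀ A₁) (hH : HolmstedtFormula A₀ A₁ q₀ q₁ b₀ b₁) :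
    RhoCondition q₀ q₁ b₀ b₁ := by
  obtain ⟨M, hM⟩ := hH.exists_rho_le hq₀ hq₁ hb₀ hb₁ hs
  have hρ0 : ∀ t, 0 < t → rho q₀ q₁ b₀ b₁ t ≠ 0 := fun t ht => rho_ne_zero hq₀ hq₁ hb₀ hb₁ ht
  have hρt : ∀ t, 0 < t → rho q₀ q₁ b₀ b₁ t ≠ ∞ := fun t ht => rho_ne_top hq₀ hq₁ hb₀ hb₁ ht
  have hT : ∀ u, 0 < u → tailNorm q₀ b₀ u = rho q₀ q₁ b₀ b₁ u * tailNorm q₁ b₁ u := fun u hu =>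
    (rho_mul_tailNorm hq₁ hb₁ hu).symm
  have h2M : ((M : ℝ≥0) : ℝ≥0∞) ≤ ((2 * M : ℝ≥0) : ℝ≥0∞) := by
    rw [ENNReal.coe_le_coe, two_mul]; exact le_self_add
  -- The logarithmic bound concerns the tail of the smaller exponent, so the order decides which
  -- half of the formula is used: `I` if `q₀ < q₁`, `ρ J` otherwise.
  rcases lt_or_gt_of_ne hq with hlt | hlt
  · obtain ⟨k, hk⟩ := hH.exists_wNorm_Ioo_le hq₀ hq₁ hb₀ hb₁ hs
    obtain ⟨X, hX⟩ := exists_log_tailNorm_le hq₀ hlt hb₀ hb₁ k (2 * M)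
    have hcomp : ∀ s t, 0 < s → s ≤ t → rho q₀ q₁ b₀ b₁ t ≤ 2 * rho q₀ q₁ b₀ b₁ s →
        Real.log ((tailNorm q₀ b₀ s).toReal / (tailNorm q₀ b₀ t).toReal) ≤ X := by
      intro s t hs hst h
      have ht := hs.trans_le hst
      refine hX s t (rho q₀ q₁ b₀ b₁ t) hs hst (hρ0 t ht) (hρt t ht) (fun φ hφ hfin => ?_)
        fun u hu => ?_
      · have h1 := hk φ hφ hfin t ht
        rw [mul_comm, ← div_eq_mul_inv, ENNReal.div_le_iff (hρ0 t ht) (hρt t ht)] at h1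
        refine (wNorm_mono_set (Ioc_subset_Ioc_left hs.le) _).trans ?_
        rw [← wNorm_Ioo_eq_Ioc]
        exact h1.trans (le_of_eq (by ring))
      · have hu0 := hs.trans_le hu.1
        rw [hT u hu0, ← mul_assoc, ← mul_assoc]
        refine ⟨mul_le_mul_left ((hM u t hu0 hu.2).trans (by gcongr)) _, mul_le_mul_left ?_ _⟩
        calc rho q₀ q₁ b₀ b₁ t ≤ 2 * rho q₀ q₁ b₀ b₁ s := h
          _ ≤ 2 * (M * rho q₀ q₁ b₀ b₁ u) := by gcongr; exact hM s u hs hu.1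
          _ = _ := by push_cast; ring
    obtain ⟨δ, hδ0, -, hδ⟩ := exists_rho_mul_rpow_le hq₀ hq₁ hb₀ hb₁ hM hq₀ hlt.ne_top hb₀ (X := X)
      hcomp
    refine rhoCondition_of_almost_monotone hq₀ hq₁ hb₀ hb₁ hδ0 (M := 2 * M)
      fun s t hs hst => ?_
    have e : ∀ u, 0 < u → (tailNorm q₀ b₀ u).toReal ^ (1 + δ) / (tailNorm q₁ b₁ u).toReal =
        (tailNorm q₀ b₀ u).toReal / (tailNorm q₁ b₁ u).toReal *
          (tailNorm q₀ b₀ u).toReal ^ δ := fun u hu => by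
      rw [Real.rpow_add (toReal_tailNorm_pos hq₀ hb₀ hu), Real.rpow_one]; ring
    rw [e s hs, e t (hs.trans_le hst)]
    exact hδ s t hs hst
  · obtain ⟨k, hk⟩ := hH.exists_rho_mul_wNorm_Ioi_le hq₀ hb₀ hs
    obtain ⟨X, hX⟩ := exists_log_tailNorm_le hq₁ hlt hb₁ hb₀ k (2 * M)
    have hcomp : ∀ s t, 0 < s → s ≤ t → rho q₀ q₁ b₀ b₁ t ≤ 2 * rho q₀ q₁ b₀ b₁ s →
        Real.log ((tailNorm q₁ b₁ s).toReal / (tailNorm q₁ b₁ t).toReal) ≤ X := by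
      intro s t hs hst h
      have ht := hs.trans_le hst
      refine hX s t (rho q₀ q₁ b₀ b₁ s)⁻¹ hs hst (ENNReal.inv_ne_zero.2 (hρt s hs))
        (ENNReal.inv_ne_top.2 (hρ0 s hs)) (fun φ hφ hfin => ?_) fun u hu => ?_
      · have h1 := hk φ hφ hfin s hs
        rw [max_eq_left hs.le] at h1
        refine (wNorm_mono_set Ioc_subset_Ioi_self _).trans ?_
        rw [mul_left_comm, mul_comm _⁻¹, ← div_eq_mul_inv,
          ENNReal.le_div_iff_mul_le (Or.inl (hρ0 s hs)) (Or.inl (hρt s hs)), mul_comm]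
        exact h1
      · have hu0 := hs.trans_le hu.1
        rw [mul_left_comm, mul_comm _⁻¹, mul_comm _⁻¹, ← div_eq_mul_inv, ← div_eq_mul_inv,
          ENNReal.le_div_iff_mul_le (Or.inl (hρ0 s hs)) (Or.inl (hρt s hs)),
          ENNReal.div_le_iff (hρ0 s hs) (hρt s hs), hT u hu0]
        constructor
        · calc tailNorm q₁ b₁ u * rho q₀ q₁ b₀ b₁ s
              ≤ tailNorm q₁ b₁ u * ((2 * M : ℝ≥0) * rho q₀ q₁ b₀ b₁ u) := by
                gcongr
                exact (hM s u hs hu.1).trans (by gcongr)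
            _ = _ := by ring
        · calc rho q₀ q₁ b₀ b₁ u * tailNorm q₁ b₁ u
              ≤ (M * (2 * rho q₀ q₁ b₀ b₁ s)) * tailNorm q₁ b₁ u := by
                gcongr
                exact (hM u t hu0 hu.2).trans (by gcongr)
            _ = _ := by push_cast; ring
    obtain ⟨δ, hδ0, hδ1, hδ⟩ := exists_rho_mul_rpow_le hq₀ hq₁ hb₀ hb₁ hM hq₁ hlt.ne_top hb₁
      (X := X) hcomp
    have hδ' : 0 < 1 - δ := by linarith
    -- Here `T₀ / T₁^(1-δ)` is almost increasing; the power `γ` turns it into `T₀^γ / T₁`, so `ε = γ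
    -- - 1`, which is positive because `0 < δ < 1`.
    set γ := (1 - δ)⁻¹ with hγ
    have hγ1 : 1 < γ := (one_lt_inv₀ hδ').2 (by linarith)
    refine rhoCondition_of_almost_monotone hq₀ hq₁ hb₀ hb₁ (ε := γ - 1) (by linarith)
      (M := (2 * M : ℝ) ^ γ) fun s t hs hst => ?_
    have ht := hs.trans_le hst
    have e : ∀ u, 0 < u → (tailNorm q₀ b₀ u).toReal ^ (1 + (γ - 1)) / (tailNorm q₁ b₁ u).toReal =
        ((tailNorm q₀ b₀ u).toReal / (tailNorm q₁ b₁ u).toReal *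
          (tailNorm q₁ b₁ u).toReal ^ δ) ^ γ := fun u hu => by
      have h0 := toReal_tailNorm_pos hq₀ hb₀ hu
      have h1 := toReal_tailNorm_pos hq₁ hb₁ hu
      have e1 : (tailNorm q₀ b₀ u).toReal / (tailNorm q₁ b₁ u).toReal *
          (tailNorm q₁ b₁ u).toReal ^ δ =
            (tailNorm q₀ b₀ u).toReal / (tailNorm q₁ b₁ u).toReal ^ (1 - δ) := by
        rw [Real.rpow_sub h1, Real.rpow_one]
        field_simp
      rw [e1, Real.div_rpow h0.le (by positivity), ← Real.rpow_mul h1.le, hγ,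
        mul_inv_cancel₀ hδ'.ne', Real.rpow_one, add_sub_cancel]
    have hpos : ∀ u, 0 < u → 0 ≤ (tailNorm q₀ b₀ u).toReal / (tailNorm q₁ b₁ u).toReal *
          (tailNorm q₁ b₁ u).toReal ^ δ := fun u _ => by positivity
    rw [e s hs, e t ht, ← Real.mul_rpow (by positivity) (hpos t ht)]
    exact Real.rpow_le_rpow (hpos s hs) (hδ s t hs hst) (by linarith)

end Converse

end Holmstedt

end

theorem mainTheorem1 {𝕜 V : Type*} [RCLike 𝕜] [AddCommGroup V] [Module 𝕜 V]
    [TopologicalSpace V] [IsTopologicalAddGroup V] [ContinuousSMul 𝕜 V] [T2Space V]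
    (A₀ A₁ : Holmstedt.QuasiNormedSubspace 𝕜 V)
    (q₀ q₁ : ℝ≥0∞) (hq₀ : 0 < q₀) (hq₁ : 0 < q₁) (hq : q₀ ≠ q₁)
    (b₀ b₁ : ℝ → ℝ) (hb₀ : Holmstedt.SVZero q₀ b₀) (hb₁ : Holmstedt.SVZero q₁ b₁) :
    (Holmstedt.RhoCondition q₀ q₁ b₀ b₁ → Holmstedt.HolmstedtFormula A₀ A₁ q₀ q₁ b₀ b₁) ∧
    (Holmstedt.KSurjective A₀ A₁ → Holmstedt.HolmstedtFormula A₀ A₁ q₀ q₁ b₀ b₁ →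
      Holmstedt.RhoCondition q₀ q₁ b₀ b₁) := by
  exact ⟨fun h => h.holmstedtFormula A₀ A₁ hq₀.ne' hq₁.ne' hb₀ hb₁,
    fun hs hH => hH.rhoCondition hq₀.ne' hq₁.ne' hq hb₀ hb₁ hs⟩
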